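/- Let $N\ge 1$ and $b_0,\dots,b_{\lfloor (N-2)/2\rfloor}\in\mathbb C$. Write $t=(t_1,t_2,\dots)$, and let $\mathbf s_k(t)$ be defined by $e^{\sum_{i\ge1}t_iz^i}=\sum_{k\ge 0}\mathbf s_k(t)z^k$, with $\mathbf s_k=0$ for $k<0$. For a partition $\lambda=(\lambda_1\ge\dots\ge\lambda_\ell\ge 0)$ put $\mathbf s_\lambda=\det(\mathbf s_{\lambda_i-i+j})_{1\le i,j\le \ell}$. Let $\mathbb Y^{(\ell)}_k$ be the set of partitions $(\lambda_1,\dots,\lambda_\ell)$ of $k$ with at most $\ell$ parts and $\lambda_i+\lambda_{\ell+1-i}=2k/\ell$ for all $i$, and let $\mathbb L^{(\ell)}_k$ be the complex span of the $\mathbf s_\lambda$, $\lambda\in\mathbb Y^{(\ell)}_k$. Let $\Lambda=(\delta_{i,j-1})_{1\le i,j\le N}$, and let $J$ be the $N\times N$ block diagonal matrix with blocks $\begin{pmatrix}0&1\\-1&0\end{pmatrix}$ and, for odd $N$, a last $1\times1$ block $0$. For an $N\times N$ matrix $a$ let $a_0,a_+,a_-$ be its parts in, strictly above and strictly below these diagonal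 blocks, and put $(a)_{\mathfrak k}=(a_--J(a_+)^\top J)+\frac12(a_0-J(a_0)^\top J)$. The finite Pfaff lattice is $\partial L/\partial t_i=[-(L^i)_{\mathfrak k},L]$, $i\ge1$, for $N\times N$ matrices $L$ that are zero above the first superdiagonal, with superdiagonal $1,a_1,1,a_2,\dots$ and with diagonal $0,-d_1,d_1,-d_2,d_2,\dots$, ending with $0$ if $N\ge 2$ is even (with diagonal $0$ if $N=1$). Let $m_N(0)$ be the skew-symmetric antidiagonal matrix whose entries above the diagonal are, from the upper right corner inwards, $b_{\lfloor (N-2)/2\rfloor},\dots,b_1,b_0$ (with $0$ in the centre if $N$ is odd). Let $E_{\ell,N}(t)$ consist of the first $\ell$ rows of $e^{\sum_i t_i\Lambda^i}$, and put $m_\ell(t)=E_{\ell,N}(t)m_N(0)E_{\ell,N}(t)^\top$. For even $\ell$ with $0\le\ell\le N$ put $\tau_\ell(t)=\mathrm{pf}\,m_\ell(t)$. **(a)** $\tau_0=1$, and for every even $\ell$ with $0\le \ell\le N$, $$\tau_\ell(t)=\sum_{\lambda\in\mathbb Y^{(\ell)}_{\ell(N-\ell)/2}}\Bigl(\prod_{i=1}^{\ell/2}b_{\lambda_i-i+\ell-\lfloor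 (N+1)/2\rfloor}\Bigr)\mathbf s_\lambda(t)\ \in\ \mathbb L^{(\ell)}_{\ell(N-\ell)/2}.$$ **(b)** Let $[z^{-1}]=(z^{-1},z^{-2}/2,z^{-3}/3,\dots)$ and $$\tilde q_{2n}(t;z)=z^{2n}\tau_{2n}(t-[z^{-1}]),\qquad \tilde q_{2n+1}(t;z)=z^{2n}\Bigl(z+\frac{\partial}{\partial t_1}\Bigr)\tau_{2n}(t-[z^{-1}]).$$ For $0\le k\le N-1$, $\tilde q_k=\sum_{j=0}^{k}\tilde Q_{k+1,j+1}(t)z^j$ is a polynomial in $z$ of degree at most $k$, with coefficients polynomial in $t$; so $\tilde Q(t)$ is a lower-triangular $N\times N$ matrix. **(c)** Let $\Omega$ be the set of $t\in\mathbb C^\infty$ at which no $\tau_{2n}(t)$, $0\le 2n\le N$, vanishes. If all $b_i\ne0$, then $\Omega\neq\emptyset$. On $\Omega$, $\tilde Q(t)$ is invertible and $\tilde Q(t)\Lambda\tilde Q(t)^{-1}$ is a rational function of $t$, without poles. Put $\rho_n=\tau_{2n}\tau_{2n+2}$ for $2n+2\le N$ and, for $N$ odd, $\rho_{(N-1)/2}=\tau_{N-1}$.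 Every point of $\Omega$ has an open neighbourhood in $\Omega$ (in the product topology) on which all the $\rho_n$ have continuous square roots. **(d)** Let $U\subseteq\Omega$ be open, and fix continuous square roots $\sqrt{\rho_n}$ on $U$. Let $D(t)$ be the invertible diagonal matrix with entries $\frac1{\sqrt{\rho_0}},\frac1{\sqrt{\rho_0}},\frac1{\sqrt{\rho_1}},\frac1{\sqrt{\rho_1}},\dots$ (for odd $N$ the last entry $1/\sqrt{\tau_{N-1}}$ occurs once). Then on $U$ the matrix $L(t)$ defined by $$D(t)^{-1}L(t)D(t)=\tilde Q(t)\Lambda\tilde Q(t)^{-1}$$ has the form required above and solves the Pfaff lattice for all $i\ge1$. At every $t\in U$ the polynomials $q_k=D_k\tilde q_k$, $0\le k\le N-1$ (with $D_k$ the $(k+1)$-st diagonal entry of $D$), have degree $k$ in $z$ and are skew-orthonormal for the skew inner product $\langle z^i,z^j\rangle=m_{ij}(t)$, where $m_{ij}(t)$, $0\le i,j\le N-1$, are the entries of $m_N(t)$: $\langle q_i,q_j\rangle=J_{ij}$ (indices of $J$ from $0$). Moreover, $q_{2n+1}$ has no term in $z^{2n}$ and has the same leading coefficient as $q_{2n}$.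 The vector $q=(q_0,\dots,q_{N-1})^\top$ is an eigenvector of $L$ up to a boundary term: $$Lq=zq-(0,\dots,0,\kappa z^N)^\top,\qquad \kappa^2=\frac{\tau_{N-2}(t)}{\prod_{i=0}^{(N-2)/2}b_i}\ (N\text{ even}),\qquad \kappa^2=\tau_{N-1}(t)\ (N\text{ odd}).$$ Finally, if $p_0,\dots,p_{N-1}$ are polynomials in $z$ with $\deg p_k=k$ and $\langle p_i,p_j\rangle=J_{ij}$, such that every $p_{2n+1}$ has no term in $z^{2n}$ and has the same leading coefficient as $p_{2n}$, then for every $n$ with $2n+1\le N-1$ there is a sign $\varepsilon_n=\pm1$ with $p_{2n}=\varepsilon_nq_{2n}$ and $p_{2n+1}=\varepsilon_nq_{2n+1}$; and, for odd $N$, $p_{N-1}=c\,q_{N-1}$ with a nonzero constant $c$. -/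

import Mathlib

open MvPolynomial

noncomputable section

namespace FinitePfaff

/-- Polynomials over `ℂ` in the times `t₁, t₂, …`; the variable `X i` is `t_i`. -/
abbrev TPoly : Type := MvPolynomial ℕ+ ℂ

/-! ### Schur polynomials and self-dual partitions -/

/-- The formal power series `∑_{i ≥ 1} t_i z^i` in `z`. -/
def timeSeries : PowerSeries TPoly :=
  PowerSeries.mk fun i => if h : 0 < i then X (⟨i, h⟩ : ℕ+) else 0

/-- The elementary Schur polynomials, `∑_k s_k(t) z^k = exp (∑_{i ≥ 1} t_i z^i)`, and `s_k = 0`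
for `k < 0`. -/
def elemSchur (k : ℤ) : TPoly :=
  if 0 ≤ k then PowerSeries.coeff k.toNat ((PowerSeries.exp TPoly).subst timeSeries) else 0

/-- The Schur polynomial `s_μ = det (s_{μ_i - i + j})` of a partition `μ` with at most `ℓ` parts. -/
def schur {ℓ : ℕ} (μ : Fin ℓ → ℕ) : TPoly :=
  Matrix.det (Matrix.of fun i j : Fin ℓ => elemSchur ((μ i : ℤ) - (i : ℤ) + (j : ℤ)))

/-- The self-dual partitions `𝕐^{(n)}_k`: partitions of `k` with at most `n` parts such that
`μ_i + μ_{n+1-i} = 2k/n` for all `i`. (The bound `μ_i < k + 1` is automatic and only makes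
finiteness visible.) -/
def selfDual (n k : ℕ) : Finset (Fin n → ℕ) :=
  open Classical in
  (Fintype.piFinset fun _ : Fin n => Finset.range (k + 1)).filter fun μ =>
    Antitone μ ∧ ∑ i, μ i = k ∧ ∀ i, n * (μ i + μ i.rev) = 2 * k

theorem mem_selfDual {n k : ℕ} {μ : Fin n → ℕ} :
    μ ∈ selfDual n k ↔
      Antitone μ ∧ ∑ i, μ i = k ∧ ∀ i, n * (μ i + μ i.rev) = 2 * k := by
  classical
  unfold selfDual
  rw [Finset.mem_filter, Fintype.mem_piFinset, and_iff_right_iff_imp]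
  rintro ⟨-, h, -⟩ i
  rw [Finset.mem_range, Nat.lt_succ_iff, ← h]
  exact Finset.single_le_sum (f := μ) (fun _ _ => Nat.zero_le _) (Finset.mem_univ i)

/-- The space `𝕃^{(n)}_k` of complex linear combinations of the `s_μ`, `μ ∈ 𝕐^{(n)}_k`. -/
def schurSpan (n k : ℕ) : Submodule ℂ TPoly :=
  Submodule.span ℂ (schur '' (selfDual n k : Set (Fin n → ℕ)))

/-! ### The Pfaff lattice -/

/-- The shift matrix `Λ`, with ones on the first superdiagonal. -/
def shiftMat (R : Type*) [Zero R] [One R] (N : ℕ) : Matrix (Fin N) (Fin N) R :=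
  Matrix.of fun i j => if (i : ℕ) + 1 = j then 1 else 0

/-- The skew-symmetric matrix `J`, with `2 × 2` blocks `(0 1; -1 0)` on the diagonal, and a last
`1 × 1` block `0` for odd `N`. -/
def skewJ (N : ℕ) : Matrix (Fin N) (Fin N) ℂ :=
  Matrix.of fun i j =>
    if (i : ℕ) % 2 = 0 ∧ (j : ℕ) = i + 1 then 1
    else if (j : ℕ) % 2 = 0 ∧ (i : ℕ) = j + 1 then -1
    else 0

/-- The part `a_-` of `a` strictly below the `2 × 2` diagonal blocks. -/
def lowerPart {N : ℕ} (a : Matrix (Fin N) (Fin N) ℂ) : Matrix (Fin N) (Fin N) ℂ :=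
  Matrix.of fun i j => if (j : ℕ) / 2 < (i : ℕ) / 2 then a i j else 0

/-- The part `a_+` of `a` strictly above the `2 × 2` diagonal blocks. -/
def upperPart {N : ℕ} (a : Matrix (Fin N) (Fin N) ℂ) : Matrix (Fin N) (Fin N) ℂ :=
  Matrix.of fun i j => if (i : ℕ) / 2 < (j : ℕ) / 2 then a i j else 0

/-- The part `a_0` of `a` in the `2 × 2` diagonal blocks (with a last `1 × 1` block for odd
`N`). -/
def blockPart {N : ℕ} (a : Matrix (Fin N) (Fin N) ℂ) : Matrix (Fin N) (Fin N) ℂ :=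
  Matrix.of fun i j => if (i : ℕ) / 2 = (j : ℕ) / 2 then a i j else 0

/-- The projection `a ↦ (a)_𝔨`. -/
def projK {N : ℕ} (a : Matrix (Fin N) (Fin N) ℂ) : Matrix (Fin N) (Fin N) ℂ :=
  (lowerPart a - skewJ N * (upperPart a).transpose * skewJ N) +
    (1 / 2 : ℂ) • (blockPart a - skewJ N * (blockPart a).transpose * skewJ N)

/-- The form of the Lax matrices: zero above the first superdiagonal; superdiagonal
`1, a₁, 1, a₂, …`; diagonal `0, -d₁, d₁, -d₂, d₂, …`, ending with `0` for even `N`. -/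
structure IsPfaffForm {N : ℕ} (L : Matrix (Fin N) (Fin N) ℂ) : Prop where
  above : ∀ i j : Fin N, (i : ℕ) + 1 < j → L i j = 0
  super : ∀ i j : Fin N, (i : ℕ) % 2 = 0 → (j : ℕ) = i + 1 → L i j = 1
  diag_first : ∀ i : Fin N, (i : ℕ) = 0 → L i i = 0
  diag_pair : ∀ i j : Fin N, (i : ℕ) % 2 = 1 → (j : ℕ) = i + 1 → L i i = -L j j
  diag_last : ∀ i : Fin N, N % 2 = 0 → (i : ℕ) + 1 = N → L i i = 0

/-- `L`, a matrix function of `t = (t₁, t₂, …) ∈ ℂ^∞`, satisfies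
`∂L/∂t_i = [-(L^i)_𝔨, L]` for all `i ≥ 1` at the point `t`. -/
def SolvesPfaffAt {N : ℕ} (L : (ℕ+ → ℂ) → Matrix (Fin N) (Fin N) ℂ) (t : ℕ+ → ℂ) : Prop :=
  ∀ (i : ℕ+) (k l : Fin N),
    HasDerivAt (fun s : ℂ => L (Function.update t i s) k l)
      ((-projK (L t ^ (i : ℕ)) * L t - L t * -projK (L t ^ (i : ℕ))) k l) (t i)

/-! ### Moment matrices and τ-functions -/

/-- The antidiagonal skew-symmetric matrix `m_N(0)`: from the centre outwards, the entries above
the diagonal are `b₀, b₁, …, b_{⌊(N-2)/2⌋}`. -/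
def initMat (N : ℕ) (b : ℕ → ℂ) : Matrix (Fin N) (Fin N) ℂ :=
  Matrix.of fun i j =>
    if (i : ℕ) + j + 1 = N then
      if (i : ℕ) < j then b (N / 2 - 1 - i)
      else if (j : ℕ) < i then -b (N / 2 - 1 - j)
      else 0
    else 0

/-- The matrix `exp (∑_i t_i Λ^i)`; recall `Λ^i = 0` for `i ≥ N`, and the sum is nilpotent. -/
def expShift (N : ℕ) : Matrix (Fin N) (Fin N) TPoly :=
  IsNilpotent.exp
    (∑ i ∈ Finset.range N, (X i.succPNat : TPoly) • shiftMat TPoly N ^ (i + 1))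

/-- The matrix `E_{ℓ,N}(t)` of the first `ℓ` rows of `exp (∑_i t_i Λ^i)` (used for `ℓ ≤ N` only;
by convention further rows are zero). -/
def evolMat (ℓ N : ℕ) : Matrix (Fin ℓ) (Fin N) TPoly :=
  Matrix.of fun i j => if h : (i : ℕ) < N then expShift N ⟨i, h⟩ j else 0

/-- The moment matrix `m_ℓ(t) = E_{ℓ,N}(t) m_N(0) E_{ℓ,N}(t)ᵀ`. -/
def moment (ℓ N : ℕ) (b : ℕ → ℂ) : Matrix (Fin ℓ) (Fin ℓ) TPoly :=
  evolMat ℓ N * (initMat N b).map (C : ℂ →+* TPoly) * (evolMat ℓ N).transpose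

/-- The Pfaffian of a (skew-symmetric) matrix of even size,
`(1 / (2ⁿ n!)) ∑_σ sgn σ ∏_i A_{σ(2i-1), σ(2i)}`. -/
def pf {n : ℕ} (A : Matrix (Fin (2 * n)) (Fin (2 * n)) TPoly) : TPoly :=
  (1 / (2 ^ n * (n.factorial : ℂ)) : ℂ) •
    ∑ σ : Equiv.Perm (Fin (2 * n)), (Equiv.Perm.sign σ : ℤ) •
      ∏ i : Fin n, A (σ ⟨2 * i, by omega⟩) (σ ⟨2 * i + 1, by omega⟩)

/-- The τ-function `τ_{2n}(t) = pf m_{2n}(t)`. -/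
def tau (N : ℕ) (b : ℕ → ℂ) (n : ℕ) : TPoly := pf (moment (2 * n) N b)

/-! ### The polynomials `q̃_k` and the matrix `Q̃` -/

/-- The substitution `f(t) ↦ f(t - [z⁻¹])`, where `[z⁻¹] = (z⁻¹, z⁻²/2, z⁻³/3, …)`, with values in
the Laurent polynomials in `z`. -/
def vertexShift : TPoly →ₐ[ℂ] LaurentPolynomial TPoly :=
  MvPolynomial.aeval fun i : ℕ+ =>
    LaurentPolynomial.C (X i : TPoly) -
      LaurentPolynomial.C (C (1 / ((i : ℕ) : ℂ)) : TPoly) * LaurentPolynomial.T (-((i : ℕ) : ℤ))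

/-- `q̃_{2n} = z^{2n} τ_{2n}(t - [z⁻¹])` and `q̃_{2n+1} = z^{2n} (z + ∂/∂t₁) τ_{2n}(t - [z⁻¹])`. -/
def qTilde (N : ℕ) (b : ℕ → ℂ) (k : ℕ) : LaurentPolynomial TPoly :=
  if k % 2 = 0 then
    LaurentPolynomial.T (k : ℤ) * vertexShift (tau N b (k / 2))
  else
    LaurentPolynomial.T ((k : ℤ) - 1) *
      (LaurentPolynomial.T 1 * vertexShift (tau N b (k / 2)) +
        vertexShift (pderiv 1 (tau N b (k / 2))))

/-- The matrix `Q̃` of coefficients of the `q̃_k`: the entry `(k, j)` (counted from `0`) is the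
coefficient of `z^j` in `q̃_k`. -/
def QTilde (N : ℕ) (b : ℕ → ℂ) : Matrix (Fin N) (Fin N) TPoly :=
  Matrix.of fun k j => (qTilde N b k).coeff (j : ℤ)

/-- The matrix `Q̃(t)` at a point `t ∈ ℂ^∞`. -/
def QTildeAt (N : ℕ) (b : ℕ → ℂ) (t : ℕ+ → ℂ) : Matrix (Fin N) (Fin N) ℂ :=
  (QTilde N b).map (MvPolynomial.eval t)

/-- The rational matrix `Q̃(t) Λ Q̃(t)⁻¹`. -/
def LTilde (N : ℕ) (b : ℕ → ℂ) (t : ℕ+ → ℂ) : Matrix (Fin N) (Fin N) ℂ :=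
  QTildeAt N b t * shiftMat ℂ N * (QTildeAt N b t)⁻¹

/-! ### The diagonal matrix `D(t)` and the solution -/

/-- The points `t` at which no `τ_{2n}(t)`, `0 ≤ 2n ≤ N`, vanishes. -/
def regularSet (N : ℕ) (b : ℕ → ℂ) : Set (ℕ+ → ℂ) :=
  {t | ∀ n, 2 * n ≤ N → MvPolynomial.eval t (tau N b n) ≠ 0}

/-- The polynomial under the square root in the `n`-th block of `D(t)`: `τ_{2n} τ_{2n+2}`, and
`τ_{N-1}` for the last block when `N` is odd. -/
def radicand (N : ℕ) (b : ℕ → ℂ) (n : ℕ) : TPoly :=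
  if 2 * n + 2 ≤ N then tau N b n * tau N b (n + 1) else tau N b n

/-- `r n` is a continuous branch on `U` of the square root of `radicand N b n`, for each block. -/
def IsRootBranch (N : ℕ) (b : ℕ → ℂ) (U : Set (ℕ+ → ℂ)) (r : ℕ → (ℕ+ → ℂ) → ℂ) : Prop :=
  ∀ n, 2 * n < N → ContinuousOn (r n) U ∧
    ∀ t ∈ U, r n t ^ 2 = MvPolynomial.eval t (radicand N b n)

/-- `D(t) = diag (1/√(τ₀τ₂), 1/√(τ₀τ₂), 1/√(τ₂τ₄), 1/√(τ₂τ₄), …)`, for the branches `r`. -/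
def diagD (N : ℕ) (r : ℕ → (ℕ+ → ℂ) → ℂ) (t : ℕ+ → ℂ) : Matrix (Fin N) (Fin N) ℂ :=
  Matrix.diagonal fun k => (r ((k : ℕ) / 2) t)⁻¹

/-- The Lax matrix `L(t) = D(t) Q̃(t) Λ Q̃(t)⁻¹ D(t)⁻¹`. -/
def laxL (N : ℕ) (b : ℕ → ℂ) (r : ℕ → (ℕ+ → ℂ) → ℂ) (t : ℕ+ → ℂ) : Matrix (Fin N) (Fin N) ℂ :=
  diagD N r t * LTilde N b t * (diagD N r t)⁻¹

/-! ### Skew-orthonormal polynomials -/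

/-- The skew inner product `⟨z^i, z^j⟩ = m_{ij}`, `0 ≤ i, j < N`, extended bilinearly. -/
def skewInner {N : ℕ} (m : Matrix (Fin N) (Fin N) ℂ) (f g : Polynomial ℂ) : ℂ :=
  ∑ i : Fin N, ∑ j : Fin N, f.coeff i * m i j * g.coeff j

/-- The skew inner product given by `m_N(t)`. -/
def momentAt (N : ℕ) (b : ℕ → ℂ) (t : ℕ+ → ℂ) : Matrix (Fin N) (Fin N) ℂ :=
  (moment N N b).map (MvPolynomial.eval t)

/-- `p₀, …, p_{N-1}` is a family of polynomials, `p_k` of degree `k`, skew-orthonormal for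
`m`. -/
def IsSkewOrthonormal {N : ℕ} (m : Matrix (Fin N) (Fin N) ℂ) (p : Fin N → Polynomial ℂ) : Prop :=
  (∀ k : Fin N, (p k).degree = ((k : ℕ) : WithBot ℕ)) ∧
    ∀ i j, skewInner m (p i) (p j) = skewJ N i j

/-- The coefficient matrix has scalar `2 × 2` diagonal blocks: `p_{2n+1}` has no term in `z^{2n}`,
and `p_{2n}` and `p_{2n+1}` have the same leading coefficient. -/
def IsNormalized {N : ℕ} (p : Fin N → Polynomial ℂ) : Prop :=
  ∀ k l : Fin N, (k : ℕ) % 2 = 0 → (l : ℕ) = k + 1 →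
    (p l).coeff k = 0 ∧ (p l).leadingCoeff = (p k).leadingCoeff

/-- The polynomials `q_k(t; z) = D_k(t) q̃_k(t; z)` in `z`, at a point `t`. -/
def qPoly (N : ℕ) (b : ℕ → ℂ) (r : ℕ → (ℕ+ → ℂ) → ℂ) (t : ℕ+ → ℂ) (k : Fin N) :
    Polynomial ℂ :=
  ∑ j : Fin N, Polynomial.monomial (j : ℕ) ((r ((k : ℕ) / 2) t)⁻¹ * QTildeAt N b t k j)

end FinitePfaff

end

noncomputable section

namespace FinitePfaff

/-! ### The elementary Schur polynomials -/

/-! The Pfaff lattice is solved by a skew Cholesky factorization. Since `E = exp (∑ t_i Λ^i)`, the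
moment matrix satisfies `∂m/∂t_p = Λ^p m + m (Λ^p)ᵀ`. The matrix `Q = D Q̃` is lower triangular with
scalar 2×2 diagonal blocks and satisfies `Q m Qᵀ = J` (`qMat_mul_momentAt_mul_transpose`). Put `L =
Q Λ Q⁻¹` and `X = (∂Q/∂t_p) Q⁻¹`. Differentiating the factorization shows that `(X + L^p) J` is
symmetric. As `X` has the same triangular shape as `Q`, this forces `X = -(L^p)_𝔨` (`eq_neg_projK`),
and `∂L/∂t_p = [X, L]` is the lattice equation (`solvesPfaffAt_laxL`). For odd `N` the last 1×1
block of `J` is zero and leaves one diagonal entry of `X` undetermined; it is recovered from `tr L^p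
= 0` and a telescoping sum of logarithmic derivatives of the τ-functions.

The factorization is the skew-orthogonality of the `q̃_k`. The translation `t ↦ t - [w]` replaces
`s_k` by `s_k - w s_{k-1}`, so it multiplies the moment matrix on both sides by a bidiagonal matrix.
By the minor summation formula the coefficients of `q̃_{2n}` are then signed Pfaffian minors on the
indices `0, …, 2n`. Pairing with `z^j` gives the Pfaffian on `0, …, 2n, j`, which vanishes for `j ≤
2n` and is `τ_{2n+2}` for `j = 2n + 1`. The operator `z + ∂/∂t₁` turns this into the relations for
`q̃_{2n+1}` and removes its term in `z^{2n}`. Uniqueness holds because the quotient of two such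
factorizations preserves `J` and is triangular, hence diagonal.

The Schur expansion is the minor summation formula for the antidiagonal matrix `m_N(0)`: a column
`k` is paired only with `N - 1 - k`, and the sets of columns closed under this reflection and
avoiding its fixed point are the shifted parts of self-dual partitions. For nonvanishing, send `s_k`
to `X^{k²}`; the lowest possible exponent is then reached by exactly one partition and one
permutation (`tau_ne_zero`). -/

theorem coeff_timeSeries_succ (n : ℕ) :
    PowerSeries.coeff (n + 1) timeSeries = (X n.succPNat : TPoly) := by
  simp [timeSeries, Nat.succPNat]

theorem constantCoeff_timeSeries : PowerSeries.constantCoeff timeSeries = 0 := by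
  rw [← PowerSeries.coeff_zero_eq_constantCoeff_apply]
  simp [timeSeries]

theorem hasSubst_timeSeries : PowerSeries.HasSubst timeSeries :=
  PowerSeries.HasSubst.of_constantCoeff_zero' constantCoeff_timeSeries

theorem elemSchur_of_neg {k : ℤ} (hk : k < 0) : elemSchur k = 0 :=
  if_neg (not_le.mpr hk)

theorem elemSchur_natCast (n : ℕ) :
    elemSchur n = PowerSeries.coeff n ((PowerSeries.exp TPoly).subst timeSeries) := by
  simp [elemSchur]

theorem elemSchur_zero : elemSchur 0 = 1 := by
  have h := elemSchur_natCast 0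
  rw [Nat.cast_zero] at h
  rw [h, PowerSeries.coeff_subst' hasSubst_timeSeries, finsum_eq_single _ 0]
  · simp
  · intro d hd
    simp [constantCoeff_timeSeries, hd]

/-- This compares coefficients in `F' = T' F` for `F = exp T` and `T = ∑ t_i z^i`. All later
identities for the `s_k` are derived from this recursion. -/
theorem elemSchur_succ (n : ℕ) :
    ((n : TPoly) + 1) * elemSchur ((n : ℤ) + 1) =
      ∑ j ∈ Finset.range (n + 1),
        ((j : TPoly) + 1) * X j.succPNat * elemSchur ((n : ℤ) - j) := by
  have h := congrArg (PowerSeries.coeff n)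
    (PowerSeries.derivative_subst (f := PowerSeries.exp TPoly) hasSubst_timeSeries)
  rw [PowerSeries.derivative_exp, PowerSeries.coeff_derivative, PowerSeries.coeff_mul,
    Finset.Nat.sum_antidiagonal_eq_sum_range_succ_mk, ← Finset.sum_range_reflect] at h
  have h1 : ((n : ℤ) + 1) = ((n + 1 : ℕ) : ℤ) := by push_cast; rfl
  rw [h1, elemSchur_natCast, mul_comm, h]
  refine Finset.sum_congr rfl fun j hj => ?_
  have hj' : j ≤ n := Nat.lt_succ_iff.mp (Finset.mem_range.mp hj)
  have h4 : n.succ - 1 - j = n - j := by omega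
  have h5 : n - (n - j) = j := by omega
  simp only [h4, h5]
  rw [← Nat.cast_sub hj', elemSchur_natCast, PowerSeries.coeff_derivative,
    coeff_timeSeries_succ]
  ring

/-- The number of summands no longer depends on `k`, as the extra ones vanish; recursions for
different `k` can then be compared term by term. -/
theorem elemSchur_rec (k : ℤ) (M : ℕ) (h : k ≤ M) :
    (k : TPoly) * elemSchur k =
      ∑ j ∈ Finset.range M, ((j : TPoly) + 1) * X j.succPNat * elemSchur (k - 1 - j) := by
  by_cases hk : 0 < k
  · obtain ⟨n, rfl⟩ : ∃ n : ℕ, k = (n : ℤ) + 1 := ⟨(k - 1).toNat, by omega⟩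
    have hM : n + 1 ≤ M := by omega
    have := elemSchur_succ n
    push_cast
    rw [this, ← Finset.sum_subset (Finset.range_mono hM)]
    · refine Finset.sum_congr rfl fun j _ => ?_
      ring_nf
    · intro j _ hj
      rw [Finset.mem_range, not_lt] at hj
      rw [elemSchur_of_neg (by omega), mul_zero]
  · rw [Finset.sum_eq_zero]
    · rcases (not_lt.mp hk).lt_or_eq with h0 | h0
      · rw [elemSchur_of_neg h0, mul_zero]
      · simp [h0]
    · intro j _
      rw [elemSchur_of_neg (by omega), mul_zero]

/-- Positive integers are units in a `ℂ`-algebra, even in the presence of zero divisors. -/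
theorem natCast_succ_mul_cancel {A : Type*} [CommRing A] [Algebra ℂ A] (n : ℕ) {x y : A}
    (h : ((n : A) + 1) * x = ((n : A) + 1) * y) : x = y := by
  have hu : algebraMap ℂ A (((n : ℂ) + 1)⁻¹) * ((n : A) + 1) = 1 := by
    have : ((n : A) + 1) = algebraMap ℂ A ((n : ℂ) + 1) := by simp
    rw [this, ← map_mul, inv_mul_cancel₀ (Nat.cast_add_one_ne_zero n), map_one]
  have := congrArg (algebraMap ℂ A (((n : ℂ) + 1)⁻¹) * ·) h
  simpa only [← mul_assoc, hu, one_mul] using this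

/-- The elementary Schur polynomials are characterized by their recursion. -/
theorem map_elemSchur_eq {A : Type*} [CommRing A] [Algebra ℂ A] (φ : TPoly →ₐ[ℂ] A)
    (u : ℤ → A) (hneg : ∀ k < 0, u k = 0) (hzero : u 0 = 1)
    (hsucc : ∀ n : ℕ, ((n : A) + 1) * u ((n : ℤ) + 1) =
      ∑ j ∈ Finset.range (n + 1), ((j : A) + 1) * φ (X j.succPNat) * u ((n : ℤ) - j))
    (k : ℤ) : φ (elemSchur k) = u k := by
  have key : ∀ n : ℕ, φ (elemSchur n) = u n := by
    intro n
    induction n using Nat.strong_induction_on with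
    | _ n ih =>
      rcases n with _ | n
      · simp [elemSchur_zero, hzero]
      · push_cast
        apply natCast_succ_mul_cancel n
        rw [hsucc]
        have := congrArg φ (elemSchur_succ n)
        rw [map_mul, map_sum] at this
        simp only [map_mul, map_add, map_natCast, map_one] at this
        rw [this]
        refine Finset.sum_congr rfl fun j hj => ?_
        have hj' : j ≤ n := Nat.lt_succ_iff.mp (Finset.mem_range.mp hj)
        rw [← Nat.cast_sub hj', ih _ (by omega)]
  rcases lt_or_ge k 0 with hk | hk
  · rw [elemSchur_of_neg hk, hneg k hk, map_zero]
  · lift k to ℕ using hk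
    exact key k

/-- Differentiating the exponential by `t_i` multiplies it by `z^i`. In terms of the recursion for
`k`: the explicit factor `t_i` contributes `i s_{k-i}`, the remaining terms sum by induction to `(k
- i) s_{k-i}`, and the total is `k s_{k-i}`. -/
theorem pderiv_elemSchur (i : ℕ+) (k : ℤ) :
    pderiv i (elemSchur k) = elemSchur (k - (i : ℕ)) := by
  have hi := i.pos
  have neg : ∀ k : ℤ, k ≤ 0 → pderiv i (elemSchur k) = elemSchur (k - (i : ℕ)) := by
    intro k hk
    rw [elemSchur_of_neg (by omega : k - (i : ℕ) < 0)]
    rcases hk.lt_or_eq with h | h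
    · rw [elemSchur_of_neg h, map_zero]
    · rw [h, elemSchur_zero, pderiv_one]
  have key : ∀ n : ℕ, pderiv i (elemSchur n) = elemSchur ((n : ℤ) - (i : ℕ)) := by
    intro n
    induction n using Nat.strong_induction_on with
    | _ n ih =>
      rcases n with _ | n
      · exact neg _ (by simp)
      have ih' : ∀ m : ℤ, m ≤ n → pderiv i (elemSchur m) = elemSchur (m - (i : ℕ)) := by
        intro m hm
        rcases le_or_gt m 0 with h | h
        · exact neg m h
        · lift m to ℕ using h.le
          exact ih m (by omega)
      apply natCast_succ_mul_cancel n
      have e := congrArg (pderiv i)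
        (elemSchur_rec ((n : ℤ) + 1) (n + 1 + i) (by push_cast; omega))
      have e2 := elemSchur_rec ((n : ℤ) + 1 - (i : ℕ)) (n + 1 + i) (by push_cast; omega)
      rw [map_sum] at e
      have hc : ((((n : ℤ) + 1 : ℤ)) : TPoly) = C ((n : ℂ) + 1) := by simp
      have hterm : ∀ j : ℕ, pderiv i
          (((j : TPoly) + 1) * X j.succPNat * elemSchur ((n : ℤ) + 1 - 1 - j)) =
          (if j = (i : ℕ) - 1 then ((j : TPoly) + 1) * elemSchur ((n : ℤ) - j) else 0) +
            ((j : TPoly) + 1) * X j.succPNat *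
              elemSchur ((n : ℤ) + 1 - (i : ℕ) - 1 - j) := by
        intro j
        have hj : ((j : TPoly) + 1) = C ((j : ℂ) + 1) := by simp
        have h3 : (n : ℤ) + 1 - 1 - j = n - j := by ring
        have h4 : (n : ℤ) - j - (i : ℕ) = (n : ℤ) + 1 - (i : ℕ) - 1 - j := by ring
        rw [pderiv_mul, h3, ih' _ (by omega), h4, hj, pderiv_C_mul, pderiv_X]
        congr 1
        by_cases hji : j = (i : ℕ) - 1
        · have : j.succPNat = i := by
            apply PNat.eq; rw [Nat.succPNat_coe]; omega
          rw [if_pos hji, this]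
          simp
        · have : i ≠ j.succPNat := by
            rintro rfl; apply hji; simp
          rw [if_neg hji]
          simp [this.symm]
      rw [Finset.sum_congr rfl fun j _ => hterm j, Finset.sum_add_distrib, ← e2,
        Finset.sum_ite_eq', if_pos (Finset.mem_range.mpr (by omega)), hc, pderiv_C_mul] at e
      have h5 : (n : ℤ) - ((i : ℕ) - 1 : ℕ) = (n : ℤ) + 1 - (i : ℕ) := by omega
      have h6 : (((i : ℕ) - 1 : ℕ) : TPoly) + 1 = ((i : ℕ) : TPoly) := by
        have : (((i : ℕ) - 1 + 1 : ℕ) : TPoly) = ((i : ℕ) : TPoly) := by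
          congr 1; omega
        exact_mod_cast this
      rw [h5, h6] at e
      have h7 : ((n : TPoly) + 1) = C ((n : ℂ) + 1) := by simp
      rw [← h7] at e
      push_cast at e ⊢
      linear_combination e
  rcases lt_or_ge k 0 with hk | hk
  · exact neg k hk.le
  · lift k to ℕ using hk
    exact key k

/-- The coefficients of the logarithm of `∑ c_k z^k`, for `c₀ = 1`. -/
def logCoeff {A : Type*} [CommRing A] [Algebra ℂ A] (c : ℕ → A) : ℕ → A
  | n => c (n + 1) - algebraMap ℂ A (((n : ℂ) + 1)⁻¹) *
      ∑ j : Fin n, (((j : ℕ) : A) + 1) * logCoeff c j * c (n - j)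
decreasing_by exact j.2

/-- The elementary Schur polynomials can be given arbitrary values. -/
theorem exists_algHom_elemSchur {A : Type*} [CommRing A] [Algebra ℂ A] (c : ℕ → A)
    (h0 : c 0 = 1) : ∃ φ : TPoly →ₐ[ℂ] A, ∀ n : ℕ, φ (elemSchur n) = c n := by
  -- `logCoeff c n` is the value for `t_{n+1}`: the recursion for `c (n + 1)` is solved for its
  -- summand `j = n`, in which `c 0 = 1`.
  refine ⟨MvPolynomial.aeval fun i : ℕ+ => logCoeff c i.natPred, fun n => ?_⟩
  have := map_elemSchur_eq (MvPolynomial.aeval fun i : ℕ+ => logCoeff c i.natPred)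
    (fun k => if 0 ≤ k then c k.toNat else 0) (fun k hk => if_neg (not_le.mpr hk))
    (by simp [h0]) ?_ n
  · simpa using this
  · intro n
    have hu : algebraMap ℂ A (((n : ℂ) + 1)⁻¹) * ((n : A) + 1) = 1 := by
      have : ((n : A) + 1) = algebraMap ℂ A ((n : ℂ) + 1) := by simp
      rw [this, ← map_mul, inv_mul_cancel₀ (Nat.cast_add_one_ne_zero n), map_one]
    have e : ∀ j ∈ Finset.range (n + 1),
        ((j : A) + 1) * (MvPolynomial.aeval (fun i : ℕ+ => logCoeff c i.natPred))
          (X j.succPNat : TPoly) *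
          (if 0 ≤ (n : ℤ) - j then c ((n : ℤ) - j).toNat else 0) =
        ((j : A) + 1) * logCoeff c j * c (n - j) := by
      intro j hj
      have hj' : j ≤ n := Nat.lt_succ_iff.mp (Finset.mem_range.mp hj)
      rw [MvPolynomial.aeval_X, Nat.natPred_succPNat, ← Nat.cast_sub hj']
      simp
    rw [Finset.sum_congr rfl e, Finset.sum_range_succ]
    conv_rhs => rw [logCoeff]
    rw [← Fin.sum_univ_eq_sum_range (fun j => ((j : A) + 1) * logCoeff c j * c (n - j))]
    have h1 : (0 : ℤ) ≤ (n : ℤ) + 1 := by omega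
    have h2 : ((n : ℤ) + 1).toNat = n + 1 := by omega
    rw [if_pos h1, h2, Nat.sub_self, h0]
    linear_combination (∑ j : Fin n, (((j : ℕ) : A) + 1) * logCoeff c j * c (n - j)) * hu

/-! ### The shift matrix and its exponential -/

theorem shiftMat_pow_apply {R : Type*} [CommRing R] (N m : ℕ) (i j : Fin N) :
    (shiftMat R N ^ m) i j = if (i : ℕ) + m = j then 1 else 0 := by
  induction m generalizing j with
  | zero => simp [Matrix.one_apply, Fin.ext_iff]
  | succ m ih =>
    rw [pow_succ, Matrix.mul_apply]
    have hs : ∀ k : Fin N, shiftMat R N k j = if (k : ℕ) + 1 = j then 1 else 0 := fun k => rfl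
    simp only [ih, hs, ite_mul, one_mul, zero_mul]
    by_cases h : (i : ℕ) + m < N
    · rw [Finset.sum_eq_single ⟨(i : ℕ) + m, h⟩]
      · simp [add_assoc]
      · intro k _ hk
        rw [if_neg]
        intro h'
        exact hk (Fin.ext h'.symm)
      · simp
    · rw [Finset.sum_eq_zero, if_neg]
      · have := j.2; omega
      · intro k _
        rw [if_neg]
        have := k.2; omega

/-- The upper triangular Toeplitz matrix with the coefficients of a power series. -/
def toeplitz {R : Type*} [CommRing R] (N : ℕ) (f : PowerSeries R) : Matrix (Fin N) (Fin N) R :=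
  Matrix.of fun i j => if (i : ℕ) ≤ j then PowerSeries.coeff ((j : ℕ) - i) f else 0

theorem toeplitz_one {R : Type*} [CommRing R] (N : ℕ) :
    toeplitz N (1 : PowerSeries R) = 1 := by
  ext i j
  simp only [toeplitz, Matrix.of_apply, PowerSeries.coeff_one, Matrix.one_apply, Fin.ext_iff]
  split_ifs <;> first | rfl | omega

/-- `toeplitz N f` is `f` evaluated at the nilpotent matrix `Λ`. The entry `(i, j)` of the product
involves only the indices between `i` and `j`, so the truncation at `N` loses nothing. -/
theorem toeplitz_mul {R : Type*} [CommRing R] (N : ℕ) (f g : PowerSeries R) :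
    toeplitz N (f * g) = toeplitz N f * toeplitz N g := by
  ext i j
  rw [Matrix.mul_apply]
  simp only [toeplitz, Matrix.of_apply]
  split_ifs with hij
  · rw [PowerSeries.coeff_mul, Finset.Nat.sum_antidiagonal_eq_sum_range_succ_mk]
    symm
    rw [← Finset.sum_subset (Finset.subset_univ (Finset.Icc i j))]
    · refine Finset.sum_bij' (fun k _ => (k : ℕ) - i)
        (fun d hd => ⟨i + d, by have := j.2; have := Finset.mem_range.mp hd; omega⟩) ?_ ?_ ?_ ?_ ?_
      · intro k hk
        simp only [Finset.mem_Icc, Fin.le_def] at hk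
        exact Finset.mem_range.mpr (by omega)
      · intro d hd
        have := Finset.mem_range.mp hd
        simp only [Finset.mem_Icc, Fin.le_def]
        omega
      · intro k hk
        simp only [Finset.mem_Icc, Fin.le_def] at hk
        ext; simp only; omega
      · intro d hd
        simp
      · intro k hk
        simp only [Finset.mem_Icc, Fin.le_def] at hk
        rw [if_pos hk.1, if_pos hk.2]
        congr 3; omega
    · intro k _ hk
      simp only [Finset.mem_Icc, Fin.le_def, not_and] at hk
      by_cases h : (i : ℕ) ≤ k
      · rw [if_neg (hk h), mul_zero]
      · rw [if_neg h, zero_mul]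
  · symm
    refine Finset.sum_eq_zero fun k _ => ?_
    by_cases h : (i : ℕ) ≤ k
    · rw [if_neg (show ¬ (k : ℕ) ≤ j by omega), mul_zero]
    · rw [if_neg h, zero_mul]

theorem toeplitz_pow {R : Type*} [CommRing R] (N : ℕ) (f : PowerSeries R) (k : ℕ) :
    toeplitz N (f ^ k) = toeplitz N f ^ k := by
  induction k with
  | zero => rw [pow_zero, pow_zero, toeplitz_one]
  | succ k ih => rw [pow_succ, pow_succ, toeplitz_mul, ih]

theorem coeff_pow_timeSeries_of_lt {n d : ℕ} (h : n < d) :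
    PowerSeries.coeff n (timeSeries ^ d) = 0 := by
  apply PowerSeries.coeff_of_lt_order
  refine lt_of_lt_of_le (by exact_mod_cast h)
    (PowerSeries.le_order_pow_of_constantCoeff_eq_zero d constantCoeff_timeSeries)

theorem sum_smul_shiftMat_pow (N : ℕ) :
    ∑ i ∈ Finset.range N, (X i.succPNat : TPoly) • shiftMat TPoly N ^ (i + 1) =
      toeplitz N timeSeries := by
  ext1 i j
  rw [Matrix.sum_apply]
  simp only [Matrix.smul_apply, shiftMat_pow_apply, smul_eq_mul, mul_ite, mul_one, mul_zero,
    toeplitz, Matrix.of_apply]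
  by_cases h : (i : ℕ) < j
  · obtain ⟨d, hd⟩ : ∃ d, (j : ℕ) = i + (d + 1) := ⟨j - i - 1, by omega⟩
    have e : ∀ x : ℕ, ((i : ℕ) + (x + 1) = j) ↔ x = d := by intro x; omega
    simp only [e]
    rw [Finset.sum_ite_eq', if_pos (Finset.mem_range.mpr (by have := j.2; omega)), if_pos h.le,
      hd, Nat.add_sub_cancel_left, coeff_timeSeries_succ]
  · rw [Finset.sum_eq_zero fun x _ => if_neg (by omega)]
    split_ifs with h'
    · have : (j : ℕ) - i = 0 := by omega
      rw [this, PowerSeries.coeff_zero_eq_constantCoeff_apply, constantCoeff_timeSeries]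
    · rfl

/-- As `toeplitz N` is multiplicative, the exponential of the matrix of `∑ t_i z^i` is the matrix of
its exponential series. Both exponential sums stop before `N`, because `timeSeries` has no constant
term and only coefficients below `N` enter. -/
theorem expShift_apply (N : ℕ) (i j : Fin N) :
    expShift N i j = elemSchur ((j : ℤ) - i) := by
  have hnil : toeplitz N timeSeries ^ N = 0 := by
    rw [← toeplitz_pow]
    ext1 i j
    simp only [toeplitz, Matrix.of_apply, Matrix.zero_apply]
    split_ifs
    · exact coeff_pow_timeSeries_of_lt (by have := j.2; omega)
    · rfl
  rw [expShift, sum_smul_shiftMat_pow, IsNilpotent.exp_eq_sum hnil, Matrix.sum_apply]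
  simp only [← toeplitz_pow, Matrix.smul_apply]
  by_cases h : (i : ℕ) ≤ j
  · rw [← Nat.cast_sub h, elemSchur_natCast, PowerSeries.coeff_subst' hasSubst_timeSeries,
      finsum_eq_sum_of_support_subset (s := Finset.range N)]
    · refine Finset.sum_congr rfl fun k _ => ?_
      simp only [toeplitz, Matrix.of_apply, if_pos h, PowerSeries.coeff_exp, one_div]
      rw [algebraMap_smul]
    · intro d hd
      rw [Finset.coe_range, Set.mem_Iio]
      by_contra hN
      apply hd
      simp only
      rw [coeff_pow_timeSeries_of_lt (by have := j.2; omega), smul_zero]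
  · rw [elemSchur_of_neg (by omega)]
    simp only [toeplitz, Matrix.of_apply, if_neg h, smul_zero, Finset.sum_const_zero]

/-- The conventional zero rows fit the formula as well: for `i ≥ N` the index `j - i` is negative.
-/
theorem evolMat_apply (ℓ N : ℕ) (i : Fin ℓ) (j : Fin N) :
    evolMat ℓ N i j = elemSchur ((j : ℤ) - (i : ℕ)) := by
  simp only [evolMat, Matrix.of_apply]
  split_ifs with h
  · rw [expShift_apply]
  · rw [elemSchur_of_neg]
    have := j.2; omega

/-! ### Pfaffians -/

theorem det_submatrix_eq_zero_of_not_injective {A m ι : Type*} [CommRing A] [Fintype m]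
    [DecidableEq m] (E : Matrix m ι A) {f : m → ι} (hf : ¬ Function.Injective f) :
    (E.submatrix id f).det = 0 := by
  rw [Function.Injective] at hf
  push Not at hf
  obtain ⟨a, b, h, hab⟩ := hf
  exact Matrix.det_zero_of_column_eq hab fun i => by simp [h]

section Pfaffian

variable {A : Type*} [CommRing A]

/-- The first index of the `i`-th pair in `0, 1, …, 2n - 1`. -/
def pairFst {n : ℕ} (i : Fin n) : Fin (2 * n) := ⟨2 * i, by omega⟩

/-- The second index of the `i`-th pair in `0, 1, …, 2n - 1`. -/
def pairSnd {n : ℕ} (i : Fin n) : Fin (2 * n) := ⟨2 * i + 1, by omega⟩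

/-- The indices `0, 1, …, 2n - 1`, arranged in pairs. -/
def pairEquiv (n : ℕ) : Fin n × Fin 2 ≃ Fin (2 * n) where
  toFun p := ⟨2 * p.1 + p.2, by omega⟩
  invFun k := (⟨k / 2, by omega⟩, ⟨k % 2, by omega⟩)
  left_inv p := by
    obtain ⟨i, j⟩ := p
    ext <;> simp only <;> omega
  right_inv k := by
    ext; simp only; omega

theorem pairEquiv_zero {n : ℕ} (i : Fin n) : pairEquiv n (i, 0) = pairFst i := rfl

theorem pairEquiv_one {n : ℕ} (i : Fin n) : pairEquiv n (i, 1) = pairSnd i := rfl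

theorem prod_pairs {M : Type*} [CommMonoid M] {n : ℕ} (F : Fin (2 * n) → M) :
    ∏ j, F j = ∏ i, F (pairFst i) * F (pairSnd i) := by
  rw [← (pairEquiv n).prod_comp, Fintype.prod_prod_type]
  refine Finset.prod_congr rfl fun i _ => ?_
  rw [Fin.prod_univ_two, pairEquiv_zero, pairEquiv_one]

/-- Families indexed by `0, 1, …, 2n - 1` as families of pairs. -/
def pairFunEquiv (n : ℕ) (ι : Type*) : (Fin (2 * n) → ι) ≃ (Fin n → ι × ι) where
  toFun f i := (f (pairFst i), f (pairSnd i))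
  invFun g k := if (k : ℕ) % 2 = 0 then (g ⟨k / 2, by omega⟩).1 else (g ⟨k / 2, by omega⟩).2
  left_inv f := by
    funext k
    simp only
    split_ifs with h
    · congr 1; ext; simp only [pairFst]; omega
    · congr 1; ext; simp only [pairSnd]; omega
  right_inv g := by
    funext i
    have h1 : (2 * (i : ℕ) + 1) / 2 = i := by omega
    have h2 : (2 * (i : ℕ) + 1) % 2 = 1 := by omega
    simp [pairFst, pairSnd, h1, h2]

/-- The permutation of `0, 1, …, 2n - 1` that permutes each pair. -/
def flipPerm {n : ℕ} (ε : Fin n → Equiv.Perm (Fin 2)) : Equiv.Perm (Fin (2 * n)) :=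
  (pairEquiv n).permCongr (Equiv.prodCongrRight ε)

/-- The permutation of `0, 1, …, 2n - 1` that permutes the pairs. -/
def slotPerm {n : ℕ} (τ : Equiv.Perm (Fin n)) : Equiv.Perm (Fin (2 * n)) :=
  (pairEquiv n).permCongr (Equiv.prodCongrLeft fun _ => τ)

theorem flipPerm_pairFst {n : ℕ} (ε : Fin n → Equiv.Perm (Fin 2)) (i : Fin n) :
    flipPerm ε (pairFst i) = pairEquiv n (i, ε i 0) := by
  rw [← pairEquiv_zero]
  simp [flipPerm, Equiv.permCongr_apply]

theorem flipPerm_pairSnd {n : ℕ} (ε : Fin n → Equiv.Perm (Fin 2)) (i : Fin n) :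
    flipPerm ε (pairSnd i) = pairEquiv n (i, ε i 1) := by
  rw [← pairEquiv_one]
  simp [flipPerm, Equiv.permCongr_apply]

theorem slotPerm_pairFst {n : ℕ} (τ : Equiv.Perm (Fin n)) (i : Fin n) :
    slotPerm τ (pairFst i) = pairFst (τ i) := by
  rw [← pairEquiv_zero, ← pairEquiv_zero]
  simp [slotPerm, Equiv.permCongr_apply]

theorem slotPerm_pairSnd {n : ℕ} (τ : Equiv.Perm (Fin n)) (i : Fin n) :
    slotPerm τ (pairSnd i) = pairSnd (τ i) := by
  rw [← pairEquiv_one, ← pairEquiv_one]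
  simp [slotPerm, Equiv.permCongr_apply]

theorem sign_flipPerm {n : ℕ} (ε : Fin n → Equiv.Perm (Fin 2)) :
    Equiv.Perm.sign (flipPerm ε) = ∏ i, Equiv.Perm.sign (ε i) := by
  rw [flipPerm, Equiv.Perm.sign_permCongr, Equiv.Perm.sign_prodCongrRight]

/-- The first and the second members of the pairs are permuted alike, so the sign of `τ` occurs
squared. -/
theorem sign_slotPerm {n : ℕ} (τ : Equiv.Perm (Fin n)) :
    Equiv.Perm.sign (slotPerm τ) = 1 := by
  rw [slotPerm, Equiv.Perm.sign_permCongr, Equiv.Perm.sign_prodCongrLeft, Fin.prod_univ_two,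
    Int.units_mul_self]

/-- The normalizing constant `1 / (2ⁿ n!)` of the Pfaffian. -/
def pfConst (n : ℕ) : ℂ := 1 / (2 ^ n * (n.factorial : ℂ))

/-- The Pfaffian of a matrix of even size over a commutative `ℂ`-algebra. -/
def pfaffian [Algebra ℂ A] {n : ℕ} (M : Matrix (Fin (2 * n)) (Fin (2 * n)) A) : A :=
  pfConst n • ∑ σ : Equiv.Perm (Fin (2 * n)), (Equiv.Perm.sign σ : ℤ) •
    ∏ i : Fin n, M (σ (pairFst i)) (σ (pairSnd i))

theorem pf_eq_pfaffian {n : ℕ} (M : Matrix (Fin (2 * n)) (Fin (2 * n)) TPoly) :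
    pf M = pfaffian M := rfl

theorem map_pfaffian [Algebra ℂ A] {B : Type*} [CommRing B] [Algebra ℂ B] (φ : A →ₐ[ℂ] B) {n : ℕ}
    (M : Matrix (Fin (2 * n)) (Fin (2 * n)) A) : φ (pfaffian M) = pfaffian (M.map φ) := by
  simp [pfaffian, map_sum, map_prod, Matrix.map_apply]

theorem pfaffian_zero [Algebra ℂ A] (M : Matrix (Fin (2 * 0)) (Fin (2 * 0)) A) : pfaffian M = 1 := by
  simp [pfaffian, pfConst]

theorem pfaffian_submatrix_perm [Algebra ℂ A] {n : ℕ}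
    (M : Matrix (Fin (2 * n)) (Fin (2 * n)) A)
    (ρ : Equiv.Perm (Fin (2 * n))) :
    pfaffian (M.submatrix ρ ρ) = (Equiv.Perm.sign ρ : ℤ) • pfaffian M := by
  rw [pfaffian, pfaffian, smul_comm (Equiv.Perm.sign ρ : ℤ) (pfConst n),
    Finset.smul_sum (r := (Equiv.Perm.sign ρ : ℤ)), ← Equiv.sum_comp (Equiv.mulLeft ρ) fun σ : Equiv.Perm (Fin (2 * n)) =>
      (Equiv.Perm.sign ρ : ℤ) • (Equiv.Perm.sign σ : ℤ) •
        ∏ i : Fin n, M (σ (pairFst i)) (σ (pairSnd i))]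
  congr 1
  refine Finset.sum_congr rfl fun σ _ => ?_
  rw [Equiv.coe_mulLeft, smul_smul, Equiv.Perm.sign_mul, Units.val_mul, ← mul_assoc,
    ← Units.val_mul, Int.units_mul_self, Units.val_one, one_mul]
  rfl

theorem self_eq_zero_of_eq_neg [Algebra ℂ A] {x : A} (h : x = -x) : x = 0 := by
  apply natCast_succ_mul_cancel 1
  push_cast
  linear_combination h

/-- A Pfaffian with a repeated index vanishes. -/
theorem pfaffian_submatrix_eq_zero [Algebra ℂ A] {n : ℕ} {ι : Type*} (M : Matrix ι ι A) (x : Fin (2 * n) → ι)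
    {a b : Fin (2 * n)} (hab : a ≠ b) (h : x a = x b) : pfaffian (M.submatrix x x) = 0 := by
  -- Exchanging the two equal indices fixes the matrix but changes the sign of the Pfaffian.
  have hx : x ∘ Equiv.swap a b = x := by
    funext c
    rw [Function.comp_apply, Equiv.swap_apply_def]
    split_ifs with h1 h2
    · rw [h1, h]
    · rw [h2, h]
    · rfl
  have := pfaffian_submatrix_perm (M.submatrix x x) (Equiv.swap a b)
  rw [Matrix.submatrix_submatrix, hx, Equiv.Perm.sign_swap hab] at this
  apply self_eq_zero_of_eq_neg
  simpa using this

/-- The contribution of a family of indices to the Pfaffian of `E M Eᵀ`. -/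
def pairTerm {n : ℕ} {ι : Type*} (M : Matrix ι ι A) (E : Matrix (Fin (2 * n)) ι A)
    (f : Fin (2 * n) → ι) : A :=
  (∏ i, M (f (pairFst i)) (f (pairSnd i))) * (E.submatrix id f).det

/-- The minor summation formula. -/
theorem pfaffian_conj [Algebra ℂ A] {n : ℕ} {ι : Type*} [Fintype ι] (M : Matrix ι ι A)
    (E : Matrix (Fin (2 * n)) ι A) :
    pfaffian (E * M * E.transpose) = pfConst n • ∑ f : Fin (2 * n) → ι, pairTerm M E f := by
  classical
  rw [pfaffian]
  congr 1
  have h1 : ∀ σ : Equiv.Perm (Fin (2 * n)),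
      ∏ i, (E * M * E.transpose) (σ (pairFst i)) (σ (pairSnd i)) =
        ∑ f : Fin (2 * n) → ι, (∏ i, M (f (pairFst i)) (f (pairSnd i))) *
          ∏ j, E (σ j) (f j) := by
    intro σ
    have h2 : ∀ i : Fin n, (E * M * E.transpose) (σ (pairFst i)) (σ (pairSnd i)) =
        ∑ p : ι × ι, M p.1 p.2 * (E (σ (pairFst i)) p.1 * E (σ (pairSnd i)) p.2) := by
      intro i
      rw [Matrix.mul_apply, Fintype.sum_prod_type_right]
      refine Finset.sum_congr rfl fun l _ => ?_
      rw [Matrix.mul_apply, Finset.sum_mul]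
      refine Finset.sum_congr rfl fun k _ => ?_
      rw [Matrix.transpose_apply]
      ring
    simp only [h2]
    -- Expanding the product chooses one pair of columns for each `i`, that is, a family `f` on the
    -- `2n` slots. After exchanging the sums, the signed sum over `σ` is the determinant of `E` on
    -- the columns `f`.
    rw [Finset.prod_univ_sum, Fintype.piFinset_univ, ← (pairFunEquiv n ι).sum_comp]
    refine Finset.sum_congr rfl fun f _ => ?_
    rw [prod_pairs fun j => E (σ j) (f j), ← Finset.prod_mul_distrib]
    rfl
  simp only [h1, Finset.smul_sum]
  rw [Finset.sum_comm]
  refine Finset.sum_congr rfl fun f _ => ?_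
  rw [pairTerm, Matrix.det_apply, Finset.mul_sum]
  refine Finset.sum_congr rfl fun σ _ => ?_
  rw [Units.smul_def, mul_smul_comm]
  rfl

/-- The factors of the product are only reordered, and the columns of the determinant undergo an
even permutation. -/
theorem pairTerm_comp_slotPerm {n : ℕ} {ι : Type*} (M : Matrix ι ι A)
    (E : Matrix (Fin (2 * n)) ι A) (f : Fin (2 * n) → ι) (τ : Equiv.Perm (Fin n)) :
    pairTerm M E (f ∘ slotPerm τ) = pairTerm M E f := by
  have h : (E.submatrix id (f ∘ slotPerm τ)).det = (E.submatrix id f).det := by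
    have := Matrix.det_permute' (slotPerm τ) (E.submatrix id f)
    rwa [sign_slotPerm, Units.val_one, Int.cast_one, one_mul] at this
  rw [pairTerm, pairTerm, h]
  congr 1
  simp only [Function.comp_apply, slotPerm_pairFst, slotPerm_pairSnd]
  exact Equiv.prod_comp τ fun i => M (f (pairFst i)) (f (pairSnd i))

/-- Each flipped pair changes the sign of one entry of `M` and exchanges two columns of the
determinant; the two signs cancel. -/
theorem pairTerm_comp_flipPerm {n : ℕ} {ι : Type*} {M : Matrix ι ι A}
    (hM : ∀ i j, M j i = -M i j)
    (E : Matrix (Fin (2 * n)) ι A) (f : Fin (2 * n) → ι) (ε : Fin n → Equiv.Perm (Fin 2)) :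
    pairTerm M E (f ∘ flipPerm ε) = pairTerm M E f := by
  have h : (E.submatrix id (f ∘ flipPerm ε)).det =
      (∏ i, ((Equiv.Perm.sign (ε i) : ℤ) : A)) * (E.submatrix id f).det := by
    have := Matrix.det_permute' (flipPerm ε) (E.submatrix id f)
    rw [sign_flipPerm, Units.coe_prod, Int.cast_prod] at this
    exact this
  rw [pairTerm, pairTerm, h, ← mul_assoc, ← Finset.prod_mul_distrib]
  congr 1
  refine Finset.prod_congr rfl fun i _ => ?_
  simp only [Function.comp_apply, flipPerm_pairFst, flipPerm_pairSnd]
  generalize ε i = s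
  obtain rfl | rfl : s = 1 ∨ s = Equiv.swap 0 1 := by revert s; decide
  · simp [pairEquiv_zero, pairEquiv_one]
  · simp [pairEquiv_zero, pairEquiv_one, hM (f (pairFst i))]

end Pfaffian

/-! ### Expansions of Pfaffians -/

section PfaffianExpansion

variable {A : Type*} [CommRing A]

theorem det_of_last_column_single {m : ℕ} (B : Matrix (Fin (m + 1)) (Fin (m + 1)) A)
    (k : Fin (m + 1)) (h : ∀ i, B i (Fin.last m) = if i = k then 1 else 0) :
    B.det = (-1) ^ ((k : ℕ) + m) * (B.submatrix k.succAbove Fin.castSucc).det := by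
  rw [Matrix.det_succ_column B (Fin.last m), Finset.sum_eq_single k]
  · rw [h k, if_pos rfl, mul_one, Fin.val_last, Fin.succAbove_last]
  · intro i _ hi
    rw [h i, if_neg hi, mul_zero, zero_mul]
  · simp

/-- Permutations of the pairs together with flips act transitively on the slots: the flip selects
the member `j` of the last pair, and the slot permutation moves that pair to place `i`. -/
theorem exists_perm_pairTerm_invariant {n : ℕ} {ι : Type*} {M : Matrix ι ι A}
    (hM : ∀ i j, M j i = -M i j) (E : Matrix (Fin (2 * (n + 1))) ι A)
    (p : Fin (2 * (n + 1))) :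
    ∃ π : Equiv.Perm (Fin (2 * (n + 1))), π (pairSnd (Fin.last n)) = p ∧
      ∀ f, pairTerm M E (f ∘ π) = pairTerm M E f := by
  obtain ⟨⟨i, j⟩, rfl⟩ := (pairEquiv (n + 1)).surjective p
  refine ⟨slotPerm (Equiv.swap (Fin.last n) i) * flipPerm fun _ => Equiv.swap 1 j, ?_, ?_⟩
  · rw [Equiv.Perm.mul_apply, flipPerm_pairSnd, Equiv.swap_apply_left]
    simp [slotPerm, Equiv.permCongr_apply]
  · intro f
    rw [Equiv.Perm.coe_mul, ← Function.comp_assoc, pairTerm_comp_flipPerm hM,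
      pairTerm_comp_slotPerm]

/-- Only injective `f` contribute, and these take the last index at exactly one of the `2(n + 1)`
slots. By transitivity every slot contributes the same amount, so the last slot may be taken. -/
theorem sum_pairTerm_eq_card_mul {n : ℕ} {M : Matrix (Fin (2 * n + 1 + 1)) (Fin (2 * n + 1 + 1)) A}
    (hM : ∀ i j, M j i = -M i j) :
    ∑ f : Fin (2 * (n + 1)) → Fin (2 * n + 1 + 1), pairTerm (n := n + 1) M 1 f =
      (2 * ((n : A) + 1)) * ∑ f : Fin (2 * n + 1 + 1) → Fin (2 * n + 1 + 1),
        if f (Fin.last _) = Fin.last _ then pairTerm (n := n + 1) M 1 f else 0 := by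
  have h1 : ∀ f : Fin (2 * (n + 1)) → Fin (2 * n + 1 + 1), pairTerm (n := n + 1) M 1 f =
      ∑ p, if f p = Fin.last _ then pairTerm (n := n + 1) M 1 f else 0 := by
    intro f
    by_cases hf : Function.Injective f
    · obtain ⟨p, hp⟩ := (Finite.injective_iff_surjective.mp hf) (Fin.last _)
      rw [Finset.sum_eq_single p]
      · exact (if_pos hp).symm
      · intro q _ hq
        rw [if_neg]
        intro h
        exact hq (hf (h.trans hp.symm))
      · simp
    · have : pairTerm (n := n + 1) M 1 f = 0 := by
        rw [pairTerm, det_submatrix_eq_zero_of_not_injective _ hf, mul_zero]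
      simp [this]
  rw [Finset.sum_congr rfl fun f _ => h1 f, Finset.sum_comm]
  have h2 : ∀ p : Fin (2 * (n + 1)), (∑ f : Fin (2 * (n + 1)) → Fin (2 * n + 1 + 1),
      if f p = Fin.last _ then pairTerm (n := n + 1) M 1 f else 0) =
      ∑ f : Fin (2 * n + 1 + 1) → Fin (2 * n + 1 + 1),
        if f (Fin.last _) = Fin.last _ then pairTerm (n := n + 1) M 1 f else 0 := by
    intro p
    obtain ⟨π, hp, hπ⟩ := exists_perm_pairTerm_invariant (n := n) hM 1 p
    refine Fintype.sum_equiv (Equiv.arrowCongr π.symm (Equiv.refl _)) _ _ fun f => ?_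
    have e : (Equiv.arrowCongr π.symm (Equiv.refl (Fin (2 * n + 1 + 1)))) f = f ∘ π := rfl
    have hl : π (Fin.last (2 * n + 1)) = p := hp
    rw [e, hπ, Function.comp_apply, hl]
  rw [Finset.sum_congr rfl fun p _ => h2 p, Finset.sum_const, Finset.card_univ, Fintype.card_fin,
    nsmul_eq_mul]
  push_cast
  ring

/-- The last two columns of the determinant are unit vectors. Expanding along them in turn gives the
signs `(-1)^{2(2n+1)} = 1` and `(-1)^{k+2n} = (-1)^k`. -/
theorem pairTerm_snoc_snoc {n : ℕ} (M : Matrix (Fin (2 * n + 1 + 1)) (Fin (2 * n + 1 + 1)) A)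
    (f : Fin (2 * n) → Fin (2 * n + 1 + 1)) (k : Fin (2 * n + 1)) :
    pairTerm (n := n + 1) M 1
      (Fin.snoc (α := fun _ => Fin (2 * n + 1 + 1))
        (Fin.snoc (α := fun _ => Fin (2 * n + 1 + 1)) f k.castSucc) (Fin.last _)) =
      (-1) ^ (k : ℕ) * M k.castSucc (Fin.last _) *
        pairTerm M ((1 : Matrix (Fin (2 * n + 1 + 1)) (Fin (2 * n + 1 + 1)) A).submatrix
          (fun a => (k.succAbove a).castSucc) id) f := by
  set g : Fin (2 * n + 1) → Fin (2 * n + 1 + 1) :=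
    Fin.snoc (α := fun _ => Fin (2 * n + 1 + 1)) f k.castSucc with hg
  set F : Fin (2 * n + 1 + 1) → Fin (2 * n + 1 + 1) :=
    Fin.snoc (α := fun _ => Fin (2 * n + 1 + 1)) g (Fin.last _) with hF
  have hFl : F (Fin.last _) = Fin.last _ := by simp [hF]
  have hFc : ∀ i, F (Fin.castSucc i) = g i := fun i => by simp [hF]
  have hgl : g (Fin.last _) = k.castSucc := by simp [hg]
  have hgc : ∀ i, g (Fin.castSucc i) = f i := fun i => by simp [hg]
  have hdet : ((1 : Matrix (Fin (2 * n + 1 + 1)) (Fin (2 * n + 1 + 1)) A).submatrix id F).det =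
      (-1) ^ (k : ℕ) * (((1 : Matrix (Fin (2 * n + 1 + 1)) (Fin (2 * n + 1 + 1)) A).submatrix
          (fun a => (k.succAbove a).castSucc) id).submatrix id f).det := by
    rw [det_of_last_column_single _ (Fin.last _), det_of_last_column_single _ k]
    · rw [Fin.val_last, ← two_mul, pow_mul, neg_one_sq, one_pow, one_mul, pow_add, pow_mul,
        neg_one_sq, one_pow, mul_one]
      congr 2
      ext a b
      change (1 : Matrix (Fin (2 * n + 1 + 1)) (Fin (2 * n + 1 + 1)) A) _
        (F (Fin.castSucc (Fin.castSucc b))) = _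
      rw [hFc, hgc, Fin.succAbove_last]
      rfl
    · intro i
      simp [hFc, hgl, Matrix.one_apply, Fin.succAbove_last]
    · intro i
      simp [hFl, Matrix.one_apply]
  rw [pairTerm, pairTerm]
  refine (congrArg (_ * ·) hdet).trans ?_
  rw [Fin.prod_univ_castSucc]
  have e1 : ∀ i : Fin n, F (pairFst (Fin.castSucc i)) = f (pairFst i) := by
    intro i
    rw [← hgc, ← hFc]
    rfl
  have e2 : ∀ i : Fin n, F (pairSnd (Fin.castSucc i)) = f (pairSnd i) := by
    intro i
    rw [← hgc, ← hFc]
    rfl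
  have e3 : F (pairFst (Fin.last n)) = k.castSucc := by
    rw [← hgl, ← hFc]
    rfl
  have e4 : F (pairSnd (Fin.last n)) = Fin.last _ := by
    rw [← hFl]
    rfl
  simp only [e1, e2, e3, e4]
  ring

/-- The expansion of a Pfaffian along its last column. -/
theorem pfaffian_expand_last [Algebra ℂ A] {n : ℕ}
    {M : Matrix (Fin (2 * n + 1 + 1)) (Fin (2 * n + 1 + 1)) A} (hM : ∀ i j, M j i = -M i j) :
    pfaffian (n := n + 1) M =
      ∑ k : Fin (2 * n + 1), (-1) ^ (k : ℕ) * M k.castSucc (Fin.last _) *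
        pfaffian (M.submatrix (fun a => (k.succAbove a).castSucc)
          (fun a => (k.succAbove a).castSucc)) := by
  have h0 : pfaffian (n := n + 1) M = pfConst (n + 1) •
      ∑ f : Fin (2 * (n + 1)) → Fin (2 * n + 1 + 1), pairTerm (n := n + 1) M 1 f := by
    rw [← pfaffian_conj (n := n + 1) M (1 : Matrix (Fin (2 * n + 1 + 1)) (Fin (2 * n + 1 + 1)) A)]
    congr 1
    rw [Matrix.transpose_one, Matrix.mul_one]
    exact (Matrix.one_mul M).symm
  have h1 : ∀ k : Fin (2 * n + 1),
      pfaffian (M.submatrix (fun a => (k.succAbove a).castSucc)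
          (fun a => (k.succAbove a).castSucc)) =
        pfConst n • ∑ f : Fin (2 * n) → Fin (2 * n + 1 + 1),
          pairTerm M ((1 : Matrix (Fin (2 * n + 1 + 1)) (Fin (2 * n + 1 + 1)) A).submatrix
            (fun a => (k.succAbove a).castSucc) id) f := by
    intro k
    rw [← pfaffian_conj]
    congr 1
    ext a b
    simp [Matrix.mul_apply, Matrix.one_apply]
  have h2 : (∑ f : Fin (2 * n + 1 + 1) → Fin (2 * n + 1 + 1),
        if f (Fin.last _) = Fin.last _ then pairTerm (n := n + 1) M 1 f else 0) =
      ∑ k : Fin (2 * n + 1), ∑ f : Fin (2 * n) → Fin (2 * n + 1 + 1),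
        (-1) ^ (k : ℕ) * M k.castSucc (Fin.last _) *
        pairTerm M ((1 : Matrix (Fin (2 * n + 1 + 1)) (Fin (2 * n + 1 + 1)) A).submatrix
          (fun a => (k.succAbove a).castSucc) id) f := by
    rw [← (Fin.snocEquiv fun _ => Fin (2 * n + 1 + 1)).sum_comp, Fintype.sum_prod_type,
      Finset.sum_eq_single (Fin.last _)]
    · simp only [Fin.snocEquiv, Equiv.coe_fn_mk, Fin.snoc_last, if_true]
      rw [← (Fin.snocEquiv fun _ => Fin (2 * n + 1 + 1)).sum_comp, Fintype.sum_prod_type,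
        Fin.sum_univ_castSucc]
      simp only [Fin.snocEquiv, Equiv.coe_fn_mk]
      refine (congrArg₂ (· + ·) (Finset.sum_congr rfl fun k _ => Finset.sum_congr rfl fun f _ =>
          pairTerm_snoc_snoc M f k) (Finset.sum_eq_zero ?_)).trans (add_zero _)
      · intro f _
        rw [pairTerm, det_submatrix_eq_zero_of_not_injective, mul_zero]
        intro hf
        have := @hf (Fin.last _) (Fin.castSucc (Fin.last _)) (by simp)
        simp [Fin.ext_iff] at this
    · intro k _ hk
      refine Finset.sum_eq_zero fun f _ => ?_
      simp [Fin.snocEquiv, hk]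
    · simp
  -- The number `2(n + 1)` of slots is the quotient of the normalizations `2^{n+1} (n+1)!` and `2^n
  -- n!`.
  have hc : algebraMap ℂ A (pfConst (n + 1)) * (2 * ((n : A) + 1)) =
      algebraMap ℂ A (pfConst n) := by
    have e : (2 * ((n : A) + 1)) = algebraMap ℂ A (2 * ((n : ℂ) + 1)) := by
      rw [map_mul, map_add, map_natCast, map_one, map_ofNat]
    rw [e, ← map_mul]
    congr 1
    have hn : ((n : ℂ) + 1) ≠ 0 := Nat.cast_add_one_ne_zero n
    have hf : ((n.factorial : ℕ) : ℂ) ≠ 0 := by exact_mod_cast n.factorial_ne_zero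
    simp only [pfConst, Nat.factorial_succ]
    push_cast
    field_simp
    ring
  rw [h0, sum_pairTerm_eq_card_mul hM, h2, Algebra.smul_def, ← mul_assoc, hc, Finset.mul_sum]
  refine Finset.sum_congr rfl fun k _ => ?_
  rw [h1, Algebra.smul_def, ← Finset.mul_sum]
  ring

theorem exists_eq_succAbove_comp_perm {m : ℕ} {f : Fin m → Fin (m + 1)}
    (hf : Function.Injective f) :
    ∃ (k : Fin (m + 1)) (σ : Equiv.Perm (Fin m)), f = k.succAbove ∘ σ := by
  have : ¬ Function.Surjective f := by
    intro hs
    have := Fintype.card_le_of_surjective f hs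
    simp at this
  rw [Function.Surjective] at this
  push Not at this
  obtain ⟨k, hk⟩ := this
  have h : ∀ a, ∃ b, k.succAbove b = f a := fun a => Fin.exists_succAbove_eq (hk a)
  choose g hg using h
  have hinj : Function.Injective g := by
    intro a b hab
    apply hf
    rw [← hg, ← hg, hab]
  exact ⟨k, Equiv.ofBijective g (Finite.injective_iff_bijective.mp hinj),
    funext fun a => (hg a).symm⟩

/-- An injective `f` misses exactly one index, and only the summand with this `k` survives; its
second determinant is the sign of the permutation that sorts `f`. -/
theorem det_submatrix_eq_sum_succAbove {m : ℕ} (P : Matrix (Fin m) (Fin (m + 1)) A)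
    (f : Fin m → Fin (m + 1)) :
    (P.submatrix id f).det = ∑ k : Fin (m + 1), (P.submatrix id k.succAbove).det *
      ((1 : Matrix (Fin (m + 1)) (Fin (m + 1)) A).submatrix k.succAbove f).det := by
  by_cases hf : Function.Injective f
  · obtain ⟨k, σ, rfl⟩ := exists_eq_succAbove_comp_perm hf
    rw [Finset.sum_eq_single k]
    · have h1 := Matrix.det_permute' σ (P.submatrix id k.succAbove)
      have h2 := Matrix.det_permute' σ
        ((1 : Matrix (Fin (m + 1)) (Fin (m + 1)) A).submatrix k.succAbove k.succAbove)
      rw [Matrix.submatrix_one _ Fin.succAbove_right_injective, Matrix.det_one, mul_one] at h2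
      rw [Matrix.submatrix_submatrix] at h1
      have h3 : ((1 : Matrix (Fin (m + 1)) (Fin (m + 1)) A).submatrix k.succAbove
          (k.succAbove ∘ σ)) = (1 : Matrix (Fin m) (Fin m) A).submatrix id σ := by
        rw [← Matrix.submatrix_one k.succAbove Fin.succAbove_right_injective,
          Matrix.submatrix_submatrix]
        rfl
      rw [h3, h2, mul_comm]
      exact h1
    · intro l _ hl
      obtain ⟨a, ha⟩ := Fin.exists_succAbove_eq (x := k) (y := l) hl.symm
      refine (congrArg (_ * ·) (Matrix.det_eq_zero_of_row_eq_zero a ?_)).trans (mul_zero _)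
      intro b
      simp [ha, (Fin.succAbove_ne k (σ b)).symm]
    · simp
  · rw [det_submatrix_eq_zero_of_not_injective _ hf, Finset.sum_eq_zero]
    intro k _
    have : ((1 : Matrix (Fin (m + 1)) (Fin (m + 1)) A).submatrix k.succAbove f).det = 0 :=
      det_submatrix_eq_zero_of_not_injective
        ((1 : Matrix (Fin (m + 1)) (Fin (m + 1)) A).submatrix k.succAbove id) hf
    rw [this, mul_zero]

/-- The minor summation formula for matrices with one column more than rows. -/
theorem pfaffian_conj_succ [Algebra ℂ A] {n : ℕ} (M : Matrix (Fin (2 * n + 1)) (Fin (2 * n + 1)) A)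
    (P : Matrix (Fin (2 * n)) (Fin (2 * n + 1)) A) :
    pfaffian (P * M * P.transpose) = ∑ k : Fin (2 * n + 1),
      (P.submatrix id k.succAbove).det * pfaffian (M.submatrix k.succAbove k.succAbove) := by
  have h1 : ∀ k : Fin (2 * n + 1), pfaffian (M.submatrix k.succAbove k.succAbove) =
      pfConst n • ∑ f : Fin (2 * n) → Fin (2 * n + 1),
        pairTerm M ((1 : Matrix (Fin (2 * n + 1)) (Fin (2 * n + 1)) A).submatrix
          k.succAbove id) f := by
    intro k
    rw [← pfaffian_conj]
    congr 1
    ext a b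
    simp [Matrix.mul_apply, Matrix.one_apply]
  simp only [h1, pfaffian_conj, Algebra.smul_def, Finset.mul_sum]
  rw [Finset.sum_comm]
  refine Finset.sum_congr rfl fun f _ => ?_
  rw [pairTerm, det_submatrix_eq_sum_succAbove, Finset.mul_sum, Finset.mul_sum]
  refine Finset.sum_congr rfl fun k _ => ?_
  rw [pairTerm, Matrix.submatrix_submatrix]
  simp only [Function.comp_id, Function.id_comp]
  ring

/-- The bidiagonal `m × (m + 1)` matrix with rows `e_a + w e_{a+1}`. -/
def bidiag (m : ℕ) (w : A) : Matrix (Fin m) (Fin (m + 1)) A :=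
  Matrix.of fun a b => if (b : ℕ) = a then 1 else if (b : ℕ) = a + 1 then w else 0

/-- Omitting column `k` leaves a block triangular matrix: the columns before `k` give an upper
triangular block with diagonal `1`, the `m - k` columns after it a lower triangular block with
diagonal `w`. -/
theorem det_bidiag_succAbove {m : ℕ} (w : A) (k : Fin (m + 1)) :
    ((bidiag m w).submatrix id k.succAbove).det = w ^ (m - (k : ℕ)) := by
  set B := (bidiag m w).submatrix id k.succAbove with hB
  have hlt : ∀ a b : Fin m, (b : ℕ) < k →
      B a b = if (b : ℕ) = a then 1 else if (b : ℕ) = a + 1 then w else 0 := by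
    intro a b hb
    have : k.succAbove b = b.castSucc := Fin.succAbove_of_castSucc_lt _ _ hb
    simp [hB, bidiag, this]
  have hge : ∀ a b : Fin m, ¬ (b : ℕ) < k →
      B a b = if (b : ℕ) + 1 = a then 1 else if (b : ℕ) = a then w else 0 := by
    intro a b hb
    have : k.succAbove b = b.succ := Fin.succAbove_of_le_castSucc _ _ (not_lt.mp hb)
    simp [hB, bidiag, this]
  rw [Matrix.twoBlockTriangular_det B fun a => (a : ℕ) < k, Matrix.det_of_isUpperTriangular,
    Matrix.det_of_isLowerTriangular]
  · have h1 : ∀ a : {a : Fin m // (a : ℕ) < k},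
        B.toSquareBlockProp (fun a => (a : ℕ) < k) a a = 1 := by
      rintro ⟨a, ha⟩
      rw [Matrix.toSquareBlockProp_def]
      simp [hlt a a ha]
    have h2 : ∀ a : {a : Fin m // ¬ (a : ℕ) < k},
        B.toSquareBlockProp (fun a => ¬ (a : ℕ) < k) a a = w := by
      rintro ⟨a, ha⟩
      rw [Matrix.toSquareBlockProp_def]
      simp [hge a a ha]
    rw [Finset.prod_congr rfl fun a _ => h1 a, Finset.prod_congr rfl fun a _ => h2 a,
      Finset.prod_const_one, one_mul, Finset.prod_const, Finset.card_univ,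
      Fintype.card_subtype_compl, Fintype.card_fin]
    congr 1
    have : Fintype.card {a : Fin m // (a : ℕ) < k} = Fintype.card (Fin k) := by
      refine Fintype.card_congr ⟨fun a => ⟨a.1, a.2⟩, fun a => ⟨⟨a, by omega⟩, a.2⟩, ?_, ?_⟩
      · intro a; rfl
      · intro a; rfl
    rw [this, Fintype.card_fin]
  · rintro ⟨a, ha⟩ ⟨b, hb⟩ hab
    have hab' : (a : ℕ) < b := hab
    rw [Matrix.toSquareBlockProp_def]
    simp only [Matrix.of_apply]
    rw [hge a b hb, if_neg (by omega), if_neg (by omega)]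
  · rintro ⟨a, ha⟩ ⟨b, hb⟩ hab
    have hab' : (b : ℕ) < a := hab
    rw [Matrix.toSquareBlockProp_def]
    simp only [Matrix.of_apply]
    rw [hlt a b hb, if_neg (by omega), if_neg (by omega)]
  · intro a ha b hb
    rw [hlt a b hb, if_neg (by omega), if_neg (by omega)]

end PfaffianExpansion

/-! ### The moments -/

theorem initMat_skew (N : ℕ) (b : ℕ → ℂ) (i j : Fin N) : initMat N b j i = -initMat N b i j := by
  simp only [initMat, Matrix.of_apply]
  split_ifs <;> first | omega | simp

/-- The moments `m_{ij}(t)`, for all `i, j ≥ 0`; they vanish for `i ≥ N` or `j ≥ N`. -/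
def momentInf (N : ℕ) (b : ℕ → ℂ) : Matrix ℕ ℕ TPoly :=
  Matrix.of fun i j => ∑ k : Fin N, ∑ l : Fin N,
    elemSchur ((k : ℤ) - i) * C (initMat N b k l) * elemSchur ((l : ℤ) - j)

theorem moment_apply (ℓ N : ℕ) (b : ℕ → ℂ) (i j : Fin ℓ) :
    moment ℓ N b i j = momentInf N b i j := by
  rw [moment, Matrix.mul_apply, momentInf, Matrix.of_apply, Finset.sum_comm]
  refine Finset.sum_congr rfl fun l _ => ?_
  rw [Matrix.mul_apply, Finset.sum_mul]
  simp [evolMat_apply]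

theorem momentInf_skew (N : ℕ) (b : ℕ → ℂ) (i j : ℕ) :
    momentInf N b j i = -momentInf N b i j := by
  simp only [momentInf, Matrix.of_apply]
  rw [Finset.sum_comm, ← Finset.sum_neg_distrib]
  refine Finset.sum_congr rfl fun l _ => ?_
  rw [← Finset.sum_neg_distrib]
  refine Finset.sum_congr rfl fun k _ => ?_
  rw [initMat_skew N b l k, C_neg]
  ring

/-- Index shifts in the infinite moment matrix therefore restrict to multiplication by `Λ` on the `N
× N` corner. -/
theorem momentInf_of_le {N : ℕ} (b : ℕ → ℂ) {i : ℕ} (h : N ≤ i) (j : ℕ) :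
    momentInf N b i j = 0 := by
  rw [momentInf, Matrix.of_apply]
  refine Finset.sum_eq_zero fun k _ => Finset.sum_eq_zero fun l _ => ?_
  rw [elemSchur_of_neg (by have := k.2; omega), zero_mul, zero_mul]

/-- Entrywise form of `∂m/∂t_p = Λ^p m + m (Λ^p)ᵀ`, the linear evolution behind the whole theorem.
-/
theorem pderiv_momentInf (N : ℕ) (b : ℕ → ℂ) (p : ℕ+) (i j : ℕ) :
    pderiv p (momentInf N b i j) = momentInf N b (i + p) j + momentInf N b i (j + p) := by
  simp only [momentInf, Matrix.of_apply, map_sum]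
  rw [← Finset.sum_add_distrib]
  refine Finset.sum_congr rfl fun k _ => ?_
  rw [← Finset.sum_add_distrib]
  refine Finset.sum_congr rfl fun l _ => ?_
  rw [pderiv_mul, mul_comm (elemSchur _) (C _), pderiv_C_mul, pderiv_elemSchur, pderiv_elemSchur]
  have h1 : (k : ℤ) - i - (p : ℕ) = (k : ℤ) - ((i + p : ℕ) : ℤ) := by push_cast; ring
  have h2 : (l : ℤ) - j - (p : ℕ) = (l : ℤ) - ((j + p : ℕ) : ℤ) := by push_cast; ring
  rw [h1, h2]
  ring

theorem tau_eq_pfaffian (N : ℕ) (b : ℕ → ℂ) (n : ℕ) :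
    tau N b n = pfaffian ((momentInf N b).submatrix
      (fun a : Fin (2 * n) => (a : ℕ)) (fun a : Fin (2 * n) => (a : ℕ))) := by
  rw [tau, pf_eq_pfaffian]
  congr 1
  ext1 i j
  exact moment_apply _ _ _ _ _

theorem tau_zero (N : ℕ) (b : ℕ → ℂ) : tau N b 0 = 1 := by
  rw [tau_eq_pfaffian]
  exact pfaffian_zero _

/-! ### The vertex operator -/

/-- The substitution `t_i ↦ t_i - w^i / i`. -/
def vertexPoly : TPoly →ₐ[ℂ] Polynomial TPoly :=
  MvPolynomial.aeval fun i : ℕ+ =>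
    Polynomial.C (X i : TPoly) - Polynomial.C (C (1 / ((i : ℕ) : ℂ)) : TPoly) *
      Polynomial.X ^ (i : ℕ)

theorem vertexPoly_X (i : ℕ+) : vertexPoly (X i) =
    Polynomial.C (X i : TPoly) - Polynomial.C (C (1 / ((i : ℕ) : ℂ)) : TPoly) *
      Polynomial.X ^ (i : ℕ) := MvPolynomial.aeval_X _ _

theorem vertexPoly_C (c : ℂ) : vertexPoly (C c) = Polynomial.C (C c : TPoly) :=
  vertexPoly.commutes c

/-- The substitution multiplies `exp (∑ t_i z^i)` by `exp (-∑ (wz)^i / i) = 1 - wz`. The proof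
checks that the right-hand side obeys the recursion with the translated times. -/
theorem vertexPoly_elemSchur (k : ℤ) : vertexPoly (elemSchur k) =
    Polynomial.C (elemSchur k) - Polynomial.X * Polynomial.C (elemSchur (k - 1)) := by
  refine map_elemSchur_eq vertexPoly (fun k =>
    Polynomial.C (elemSchur k) - Polynomial.X * Polynomial.C (elemSchur (k - 1))) ?_ ?_ ?_ k
  · intro k hk
    simp [elemSchur_of_neg hk, elemSchur_of_neg (show k - 1 < 0 by omega)]
  · simp [elemSchur_zero, elemSchur_of_neg (show (-1 : ℤ) < 0 by omega)]
  · intro n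
    have h1 : ∀ j : ℕ, ((j : Polynomial TPoly) + 1) * vertexPoly (X j.succPNat) =
        ((j : Polynomial TPoly) + 1) * Polynomial.C (X j.succPNat : TPoly) -
          Polynomial.X ^ (j + 1) := by
      intro j
      rw [vertexPoly_X, mul_sub, ← mul_assoc, Nat.succPNat_coe]
      have : ((j : Polynomial TPoly) + 1) *
          Polynomial.C (C (1 / ((j.succ : ℕ) : ℂ)) : TPoly) = 1 := by
        have e : ((j : Polynomial TPoly) + 1) = Polynomial.C (C ((j : ℂ) + 1)) := by simp
        rw [e, ← Polynomial.C_mul, ← C_mul, Nat.cast_succ,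
          mul_one_div_cancel (Nat.cast_add_one_ne_zero j), C_1, Polynomial.C_1]
      rw [this, one_mul]
    -- The contribution of the translations `-w^{j+1}/(j+1)` telescopes to the single term `w s_n`.
    have h2 : ∑ j ∈ Finset.range (n + 1), Polynomial.X ^ (j + 1) *
        (Polynomial.C (elemSchur ((n : ℤ) - j)) -
          Polynomial.X * Polynomial.C (elemSchur ((n : ℤ) - j - 1))) =
        Polynomial.X * Polynomial.C (elemSchur n) := by
      have := Finset.sum_range_sub' (fun j : ℕ => (Polynomial.X : Polynomial TPoly) ^ (j + 1) *
        Polynomial.C (elemSchur ((n : ℤ) - j))) (n + 1)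
      rw [elemSchur_of_neg (show (n : ℤ) - ((n + 1 : ℕ) : ℤ) < 0 by omega)] at this
      simp only [map_zero, mul_zero, sub_zero, zero_add, pow_one, Nat.cast_zero] at this
      rw [← this]
      refine Finset.sum_congr rfl fun j _ => ?_
      have : (n : ℤ) - j - 1 = n - ((j + 1 : ℕ) : ℤ) := by push_cast; ring
      rw [this]
      ring
    have h3 : ((n : Polynomial TPoly) + 1) * Polynomial.C (elemSchur ((n : ℤ) + 1)) =
        ∑ j ∈ Finset.range (n + 1), ((j : Polynomial TPoly) + 1) *
          Polynomial.C (X j.succPNat : TPoly) * Polynomial.C (elemSchur ((n : ℤ) - j)) := by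
      have := congrArg Polynomial.C (elemSchur_succ n)
      simpa only [map_mul, map_sum, map_add, map_natCast, map_one] using this
    have h4 : (n : Polynomial TPoly) * Polynomial.C (elemSchur (n : ℤ)) =
        ∑ j ∈ Finset.range (n + 1), ((j : Polynomial TPoly) + 1) *
          Polynomial.C (X j.succPNat : TPoly) * Polynomial.C (elemSchur ((n : ℤ) - j - 1)) := by
      have := congrArg Polynomial.C (elemSchur_rec n (n + 1) (by push_cast; omega))
      simp only [map_mul, map_sum, map_add, map_natCast, map_one, Int.cast_natCast] at this
      rw [this]
      refine Finset.sum_congr rfl fun j _ => ?_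
      rw [sub_right_comm]
    have h5 : (n : ℤ) + 1 - 1 = n := by ring
    simp only [h1, h5, sub_mul, Finset.sum_sub_distrib]
    rw [h2]
    simp only [mul_sub, Finset.sum_sub_distrib]
    rw [← h3]
    have h6 : ∑ j ∈ Finset.range (n + 1), ((j : Polynomial TPoly) + 1) *
          Polynomial.C (X j.succPNat : TPoly) *
          (Polynomial.X * Polynomial.C (elemSchur ((n : ℤ) - j - 1))) =
        Polynomial.X * ((n : Polynomial TPoly) * Polynomial.C (elemSchur (n : ℤ))) := by
      rw [h4, Finset.mul_sum]
      refine Finset.sum_congr rfl fun j _ => ?_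
      ring
    rw [h6]
    ring

theorem vertexPoly_momentInf (N : ℕ) (b : ℕ → ℂ) (i j : ℕ) :
    vertexPoly (momentInf N b i j) =
      Polynomial.C (momentInf N b i j) -
        Polynomial.X * Polynomial.C (momentInf N b (i + 1) j) -
        Polynomial.X * Polynomial.C (momentInf N b i (j + 1)) +
        Polynomial.X ^ 2 * Polynomial.C (momentInf N b (i + 1) (j + 1)) := by
  simp only [momentInf, Matrix.of_apply, map_sum, Finset.mul_sum]
  rw [← Finset.sum_sub_distrib, ← Finset.sum_sub_distrib, ← Finset.sum_add_distrib]
  refine Finset.sum_congr rfl fun k _ => ?_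
  rw [← Finset.sum_sub_distrib, ← Finset.sum_sub_distrib, ← Finset.sum_add_distrib]
  refine Finset.sum_congr rfl fun l _ => ?_
  have h1 : (k : ℤ) - ((i + 1 : ℕ) : ℤ) = k - i - 1 := by push_cast; ring
  have h2 : (l : ℤ) - ((j + 1 : ℕ) : ℤ) = l - j - 1 := by push_cast; ring
  rw [h1, h2]
  simp only [map_mul, vertexPoly_elemSchur, vertexPoly_C]
  ring

theorem sum_bidiag_mul {A : Type*} [CommRing A] {m : ℕ} (w : A) (a : Fin m)
    (F : Fin (m + 1) → A) :
    ∑ k, bidiag m w a k * F k = F a.castSucc + w * F a.succ := by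
  rw [Finset.sum_eq_add a.castSucc a.succ]
  · simp [bidiag]
  · simp [Fin.ext_iff]
  · intro c _ hc
    simp only [ne_eq, Fin.ext_iff, Fin.val_castSucc, Fin.val_succ] at hc
    simp [bidiag, hc.1, hc.2]
  · simp
  · simp

/-- The Pfaffian of the moments with indices `0, …, 2n`, except `k`. -/
def pfMinor (N : ℕ) (b : ℕ → ℂ) (n : ℕ) (k : Fin (2 * n + 1)) : TPoly :=
  pfaffian ((momentInf N b).submatrix (fun a : Fin (2 * n) => ((k.succAbove a : Fin _) : ℕ))
    (fun a : Fin (2 * n) => ((k.succAbove a : Fin _) : ℕ)))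

/-- Translated moments are `P M Pᵀ`, with `M` the moments for the indices `0, …, 2n` and `P`
bidiagonal with entries `1, -w`. As `P` has one column more than rows, the minor summation formula
has one summand for each omitted index. -/
theorem vertexPoly_tau (N : ℕ) (b : ℕ → ℂ) (n : ℕ) :
    vertexPoly (tau N b n) = ∑ k : Fin (2 * n + 1),
      (-Polynomial.X) ^ (2 * n - (k : ℕ)) * Polynomial.C (pfMinor N b n k) := by
  set M : Matrix (Fin (2 * n + 1)) (Fin (2 * n + 1)) (Polynomial TPoly) :=
    Matrix.of fun a c => Polynomial.C (momentInf N b a c) with hM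
  set P : Matrix (Fin (2 * n)) (Fin (2 * n + 1)) (Polynomial TPoly) :=
    bidiag (2 * n) (-Polynomial.X) with hP
  have h1 : ((momentInf N b).submatrix
      (fun a : Fin (2 * n) => (a : ℕ)) (fun a : Fin (2 * n) => (a : ℕ))).map vertexPoly =
      P * M * P.transpose := by
    ext1 a c
    rw [hP, Matrix.mul_apply]
    simp only [Matrix.transpose_apply, mul_comm _ (bidiag _ _ c _), sum_bidiag_mul,
      Matrix.mul_apply, Matrix.map_apply, Matrix.submatrix_apply, vertexPoly_momentInf, hM,
      Matrix.of_apply, Fin.val_castSucc, Fin.val_succ]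
    ring
  have h2 : ∀ k : Fin (2 * n + 1), pfaffian (M.submatrix k.succAbove k.succAbove) =
      Polynomial.C (pfMinor N b n k) := by
    intro k
    exact (map_pfaffian (Polynomial.CAlgHom : TPoly →ₐ[ℂ] Polynomial TPoly) _).symm
  rw [tau_eq_pfaffian, map_pfaffian, h1, pfaffian_conj_succ]
  refine Finset.sum_congr rfl fun k _ => ?_
  rw [det_bidiag_succAbove, h2]

/-- The coefficients of `q̃_{2n}`. -/
def evenCoeff (N : ℕ) (b : ℕ → ℂ) (n k : ℕ) : TPoly :=
  if h : k < 2 * n + 1 then (-1) ^ k * pfMinor N b n ⟨k, h⟩ else 0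

theorem evenCoeff_of_lt {N : ℕ} (b : ℕ → ℂ) {n k : ℕ} (h : 2 * n < k) :
    evenCoeff N b n k = 0 := dif_neg (by omega)

theorem vertexPoly_tau_eq_sum (N : ℕ) (b : ℕ → ℂ) (n : ℕ) :
    vertexPoly (tau N b n) = ∑ k ∈ Finset.range (2 * n + 1),
      Polynomial.C (evenCoeff N b n k) * Polynomial.X ^ (2 * n - k) := by
  rw [vertexPoly_tau, Finset.sum_range]
  refine Finset.sum_congr rfl fun k _ => ?_
  have h : (-1 : Polynomial TPoly) ^ (2 * n - (k : ℕ)) = (-1) ^ (k : ℕ) := by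
    have := k.2
    rw [neg_one_pow_eq_pow_mod_two, neg_one_pow_eq_pow_mod_two (n := (k : ℕ))]
    congr 1
    omega
  have h' := neg_pow (Polynomial.X : Polynomial TPoly) (2 * n - (k : ℕ))
  rw [h', h, evenCoeff, dif_pos k.2]
  simp only [map_mul, map_pow, map_neg, map_one]
  ring

theorem coeff_vertexPoly_tau {N : ℕ} (b : ℕ → ℂ) {n k : ℕ} (hk : k ≤ 2 * n) :
    (vertexPoly (tau N b n)).coeff (2 * n - k) = evenCoeff N b n k := by
  rw [vertexPoly_tau_eq_sum, Polynomial.finsetSum_coeff, Finset.sum_eq_single k]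
  · rw [Polynomial.coeff_C_mul_X_pow, if_pos rfl]
  · intro l hl hlk
    have := Finset.mem_range.mp hl
    rw [Polynomial.coeff_C_mul_X_pow, if_neg (by omega)]
  · intro h
    exact absurd (Finset.mem_range.mpr (by omega)) h

theorem coeff_vertexPoly_zero (p : TPoly) : (vertexPoly p).coeff 0 = p := by
  induction p using MvPolynomial.induction_on with
  | C a => rw [vertexPoly_C, Polynomial.coeff_C_zero]
  | add p q hp hq => rw [map_add, Polynomial.coeff_add, hp, hq]
  | mul_X p i hp =>
    rw [map_mul, Polynomial.mul_coeff_zero, hp, vertexPoly_X, Polynomial.coeff_sub,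
      Polynomial.coeff_C_zero, Polynomial.coeff_C_mul_X_pow, if_neg i.ne_zero.symm, sub_zero]

/-- To first order in `w` only the time `t₁` is moved, by `-w`. -/
theorem coeff_vertexPoly_one (p : TPoly) : (vertexPoly p).coeff 1 = -pderiv 1 p := by
  induction p using MvPolynomial.induction_on with
  | C a => rw [vertexPoly_C, Polynomial.coeff_C_succ, pderiv_C, neg_zero]
  | add p q hp hq => rw [map_add, Polynomial.coeff_add, hp, hq, map_add, neg_add]
  | mul_X p i hp =>
    rw [map_mul, Polynomial.mul_coeff_one, hp, coeff_vertexPoly_zero, coeff_vertexPoly_zero,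
      vertexPoly_X, Polynomial.coeff_sub, Polynomial.coeff_C_succ, Polynomial.coeff_C_mul_X_pow,
      pderiv_mul, pderiv_X]
    by_cases h : i = 1
    · subst h
      simp
    · have h' : ¬ 1 = (i : ℕ) := fun e => h (PNat.eq e.symm)
      rw [if_neg h', Pi.single_eq_of_ne h]
      ring

/-- A translation of the times commutes with the partial derivatives. -/
theorem coeff_vertexPoly_pderiv (i : ℕ+) (p : TPoly) (m : ℕ) :
    (vertexPoly (pderiv i p)).coeff m = pderiv i ((vertexPoly p).coeff m) := by
  induction p using MvPolynomial.induction_on generalizing m with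
  | C a =>
    rw [vertexPoly_C, pderiv_C, map_zero, Polynomial.coeff_zero, Polynomial.coeff_C]
    split_ifs
    · rw [pderiv_C]
    · rw [map_zero]
  | add p q hp hq => simp only [map_add, Polynomial.coeff_add, hp, hq]
  | mul_X p j hp =>
    have h1 : ∀ f : Polynomial TPoly, (f * vertexPoly (X j)).coeff m = f.coeff m * X j -
        if (j : ℕ) ≤ m then C (1 / ((j : ℕ) : ℂ)) * f.coeff (m - j) else 0 := by
      intro f
      rw [vertexPoly_X, mul_sub, Polynomial.coeff_sub, Polynomial.coeff_mul_C, ← mul_assoc,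
        Polynomial.coeff_mul_X_pow']
      simp only [Polynomial.coeff_mul_C, mul_comm]
    have h2 : vertexPoly (pderiv i (X j : TPoly)) = Polynomial.C (pderiv i (X j : TPoly)) := by
      rw [pderiv_X]
      by_cases h : j = i
      · subst h; simp
      · rw [Pi.single_eq_of_ne h, map_zero, map_zero]
    rw [pderiv_mul, map_add, map_mul, map_mul, map_mul, Polynomial.coeff_add, h1, h1, h2,
      Polynomial.coeff_mul_C, hp, map_sub, pderiv_mul]
    split_ifs with h
    · rw [pderiv_C_mul, hp]
      ring
    · rw [map_zero]
      ring

theorem vertexShift_eq (p : TPoly) : vertexShift p =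
    Polynomial.eval₂ LaurentPolynomial.C (LaurentPolynomial.T (-1)) (vertexPoly p) := by
  induction p using MvPolynomial.induction_on with
  | C a =>
    rw [vertexPoly_C, Polynomial.eval₂_C]
    exact vertexShift.commutes a
  | add p q hp hq => rw [map_add, map_add, Polynomial.eval₂_add, hp, hq]
  | mul_X p i hp =>
    rw [map_mul, map_mul, Polynomial.eval₂_mul, hp]
    congr 1
    rw [vertexPoly_X, vertexShift, MvPolynomial.aeval_X]
    simp [Polynomial.eval₂_sub]

/-- With `w = z⁻¹` the factor `z^m` turns `w^{m-k}` into `z^k`, so no negative powers remain. -/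
theorem T_mul_vertexShift {p : TPoly} {m : ℕ} {c : ℕ → TPoly}
    (h : vertexPoly p = ∑ k ∈ Finset.range (m + 1), Polynomial.C (c k) * Polynomial.X ^ (m - k)) :
    LaurentPolynomial.T (m : ℤ) * vertexShift p =
      ∑ k ∈ Finset.range (m + 1), LaurentPolynomial.C (c k) * LaurentPolynomial.T (k : ℤ) := by
  rw [vertexShift_eq, h, Polynomial.eval₂_finsetSum, Finset.mul_sum]
  refine Finset.sum_congr rfl fun k hk => ?_
  have hk' : k ≤ m := Nat.lt_succ_iff.mp (Finset.mem_range.mp hk)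
  rw [Polynomial.eval₂_mul, Polynomial.eval₂_C, Polynomial.eval₂_X_pow, LaurentPolynomial.T_pow,
    mul_left_comm, ← LaurentPolynomial.T_add]
  congr 2
  push_cast [hk']
  ring

/-! ### The coefficients of the `q̃_k` -/

/-- The coefficients of `q̃_k`. -/
def qCoeff (N : ℕ) (b : ℕ → ℂ) (k j : ℕ) : TPoly :=
  if k % 2 = 0 then evenCoeff N b (k / 2) j
  else (if j = 0 then 0 else evenCoeff N b (k / 2) (j - 1)) + pderiv 1 (evenCoeff N b (k / 2) j)

theorem qCoeff_even (N : ℕ) (b : ℕ → ℂ) (n j : ℕ) :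
    qCoeff N b (2 * n) j = evenCoeff N b n j := by
  have h : 2 * n / 2 = n := by omega
  rw [qCoeff, if_pos (by omega), h]

theorem qCoeff_odd_zero (N : ℕ) (b : ℕ → ℂ) (n : ℕ) :
    qCoeff N b (2 * n + 1) 0 = pderiv 1 (evenCoeff N b n 0) := by
  have h : (2 * n + 1) / 2 = n := by omega
  rw [qCoeff, if_neg (by omega), if_pos rfl, h, zero_add]

theorem qCoeff_odd_succ (N : ℕ) (b : ℕ → ℂ) (n j : ℕ) :
    qCoeff N b (2 * n + 1) (j + 1) =
      evenCoeff N b n j + pderiv 1 (evenCoeff N b n (j + 1)) := by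
  have h : (2 * n + 1) / 2 = n := by omega
  rw [qCoeff, if_neg (by omega), if_neg (by omega), h, Nat.add_sub_cancel]

theorem qCoeff_of_lt {N : ℕ} (b : ℕ → ℂ) {k j : ℕ} (h : k < j) : qCoeff N b k j = 0 := by
  rcases Nat.even_or_odd' k with ⟨n, rfl | rfl⟩
  · rw [qCoeff_even, evenCoeff_of_lt b h]
  · obtain ⟨j, rfl⟩ : ∃ i, j = i + 1 := ⟨j - 1, by omega⟩
    rw [qCoeff_odd_succ, evenCoeff_of_lt b (by omega), evenCoeff_of_lt b (by omega), map_zero,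
      add_zero]

/-- Sums against the coefficients of `q̃_{2n+1}`, in terms of those of `q̃_{2n}`. -/
theorem sum_qCoeff_odd {M : Type*} [AddCommGroup M] (N : ℕ) (b : ℕ → ℂ) (n : ℕ)
    (F : ℕ → TPoly →+ M) :
    ∑ j ∈ Finset.range (2 * n + 1 + 1), F j (qCoeff N b (2 * n + 1) j) =
      ∑ j ∈ Finset.range (2 * n + 1), F (j + 1) (evenCoeff N b n j) +
        ∑ j ∈ Finset.range (2 * n + 1), F j (pderiv 1 (evenCoeff N b n j)) := by
  have h : ∑ j ∈ Finset.range (2 * n + 1), F j (pderiv 1 (evenCoeff N b n j)) =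
      ∑ j ∈ Finset.range (2 * n + 1 + 1), F j (pderiv 1 (evenCoeff N b n j)) := by
    rw [Finset.sum_range_succ _ (2 * n + 1), evenCoeff_of_lt b (by omega), map_zero, map_zero,
      add_zero]
  rw [h, Finset.sum_range_succ' (fun j => F j (qCoeff N b (2 * n + 1) j)) (2 * n + 1),
    Finset.sum_range_succ' (fun j => F j (pderiv 1 (evenCoeff N b n j))) (2 * n + 1),
    qCoeff_odd_zero, ← add_assoc, ← Finset.sum_add_distrib]
  congr 1
  refine Finset.sum_congr rfl fun j _ => ?_
  rw [qCoeff_odd_succ, map_add]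

theorem vertexPoly_pderiv_tau (N : ℕ) (b : ℕ → ℂ) (n : ℕ) (i : ℕ+) :
    vertexPoly (pderiv i (tau N b n)) = ∑ k ∈ Finset.range (2 * n + 1),
      Polynomial.C (pderiv i (evenCoeff N b n k)) * Polynomial.X ^ (2 * n - k) := by
  ext1 m
  rw [coeff_vertexPoly_pderiv, vertexPoly_tau_eq_sum, Polynomial.finsetSum_coeff, map_sum,
    Polynomial.finsetSum_coeff]
  refine Finset.sum_congr rfl fun k _ => ?_
  rw [Polynomial.coeff_C_mul_X_pow, Polynomial.coeff_C_mul_X_pow]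
  split_ifs
  · rfl
  · rw [map_zero]

theorem qTilde_eq_sum (N : ℕ) (b : ℕ → ℂ) (k : ℕ) :
    qTilde N b k = ∑ j ∈ Finset.range (k + 1),
      LaurentPolynomial.C (qCoeff N b k j) * LaurentPolynomial.T (j : ℤ) := by
  rcases Nat.even_or_odd' k with ⟨n, rfl | rfl⟩
  · have h : 2 * n / 2 = n := by omega
    rw [qTilde, if_pos (by omega), h, T_mul_vertexShift (vertexPoly_tau_eq_sum N b n)]
    simp only [qCoeff_even]
  · have h : (2 * n + 1) / 2 = n := by omega
    have h2 : (((2 * n + 1 : ℕ) : ℤ) - 1) = ((2 * n : ℕ) : ℤ) := by push_cast; ring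
    rw [qTilde, if_neg (by omega), h, h2, mul_add,
      T_mul_vertexShift (vertexPoly_pderiv_tau N b n 1), mul_left_comm,
      T_mul_vertexShift (vertexPoly_tau_eq_sum N b n)]
    have := sum_qCoeff_odd N b n fun j =>
      (AddMonoidHom.mulRight (LaurentPolynomial.T (j : ℤ) : LaurentPolynomial TPoly)).comp
        (LaurentPolynomial.C : TPoly →+* LaurentPolynomial TPoly).toAddMonoidHom
    simp only [AddMonoidHom.coe_comp, Function.comp_apply, AddMonoidHom.coe_mulRight,
      RingHom.toAddMonoidHom_eq_coe, AddMonoidHom.coe_coe] at this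
    rw [this, Finset.mul_sum]
    congr 1
    refine Finset.sum_congr rfl fun j _ => ?_
    rw [mul_left_comm, ← LaurentPolynomial.T_add]
    congr 2
    push_cast
    ring

theorem QTilde_apply {N : ℕ} (b : ℕ → ℂ) (k j : Fin N) : QTilde N b k j = qCoeff N b k j := by
  rw [QTilde, Matrix.of_apply, qTilde_eq_sum, AddMonoidAlgebra.coeff_sum, Finset.sum_apply']
  simp only [← LaurentPolynomial.single_eq_C_mul_T, AddMonoidAlgebra.coeff_single,
    Finsupp.single_apply, Nat.cast_inj]
  rw [Finset.sum_ite_eq' (Finset.range ((k : ℕ) + 1)) (j : ℕ)]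
  split_ifs with h
  · rfl
  · rw [qCoeff_of_lt b]
    simpa using h

theorem QTilde_of_lt {N : ℕ} (b : ℕ → ℂ) {k j : Fin N} (h : k < j) : QTilde N b k j = 0 := by
  rw [QTilde_apply, qCoeff_of_lt b h]

theorem sum_fin_eq_sum_range_of_lt {M : Type*} [AddCommMonoid M] {N k : ℕ} (hk : k < N)
    {f : ℕ → M} (hf : ∀ j, k < j → f j = 0) :
    ∑ j : Fin N, f j = ∑ j ∈ Finset.range (k + 1), f j := by
  rw [Fin.sum_univ_eq_sum_range f N]
  symm
  apply Finset.sum_subset (Finset.range_mono hk)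
  intro j _ hj
  exact hf j (by simpa using hj)

theorem qTilde_eq_sum_fin {N : ℕ} (b : ℕ → ℂ) (k : Fin N) : qTilde N b k =
    ∑ j : Fin N, LaurentPolynomial.C (QTilde N b k j) * LaurentPolynomial.T ((j : ℕ) : ℤ) := by
  simp only [QTilde_apply]
  rw [sum_fin_eq_sum_range_of_lt (f := fun j : ℕ =>
    LaurentPolynomial.C (qCoeff N b k j) * LaurentPolynomial.T (j : ℤ)) k.2, qTilde_eq_sum]
  intro j hj
  rw [qCoeff_of_lt b hj, map_zero, zero_mul]

theorem evenCoeff_top (N : ℕ) (b : ℕ → ℂ) (n : ℕ) : evenCoeff N b n (2 * n) = tau N b n := by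
  rw [← coeff_vertexPoly_zero (tau N b n), ← coeff_vertexPoly_tau b le_rfl, Nat.sub_self]

/-- The coefficient just below the leading one is the first-order Taylor coefficient of the
translated τ-function. -/
theorem evenCoeff_pred (N : ℕ) (b : ℕ → ℂ) (n : ℕ) :
    evenCoeff N b (n + 1) (2 * n + 1) = -pderiv 1 (tau N b (n + 1)) := by
  have h : 2 * (n + 1) - (2 * n + 1) = 1 := by omega
  rw [← coeff_vertexPoly_one, ← coeff_vertexPoly_tau b (by omega), h]

theorem qCoeff_self (N : ℕ) (b : ℕ → ℂ) (k : ℕ) : qCoeff N b k k = tau N b (k / 2) := by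
  rcases Nat.even_or_odd' k with ⟨n, rfl | rfl⟩
  · have h : 2 * n / 2 = n := by omega
    rw [qCoeff_even, evenCoeff_top, h]
  · have h : (2 * n + 1) / 2 = n := by omega
    rw [qCoeff_odd_succ, evenCoeff_top, evenCoeff_of_lt b (by omega), map_zero, add_zero, h]

/-- In `(z + ∂/∂t₁) q̃_{2n}` the factor `z` contributes `-∂τ_{2n}/∂t₁` at `z^{2n}`, and the
derivative contributes `+∂τ_{2n}/∂t₁`. This cancellation gives `Q̃` its scalar diagonal blocks. -/
theorem qCoeff_odd_pred (N : ℕ) (b : ℕ → ℂ) (n : ℕ) : qCoeff N b (2 * n + 1) (2 * n) = 0 := by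
  rcases n with _ | n
  · have := evenCoeff_top N b 0
    rw [tau_zero] at this
    rw [Nat.mul_zero] at this ⊢
    rw [qCoeff_odd_zero N b 0, this, pderiv_one]
  · have := qCoeff_odd_succ N b (n + 1) (2 * n + 1)
    rw [evenCoeff_pred, show 2 * n + 1 + 1 = 2 * (n + 1) by ring, evenCoeff_top] at this
    rw [this, neg_add_cancel]

/-! ### Skew-orthogonality of the `q̃_k` -/

/-- The coefficients of `q̃_{2n}` are the cofactors in the expansion of the Pfaffian with indices
`0, …, 2n, j` along its last column. -/
theorem sum_evenCoeff_mul_moment (N : ℕ) (b : ℕ → ℂ) (n j : ℕ) :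
    ∑ k ∈ Finset.range (2 * n + 1), evenCoeff N b n k * momentInf N b k j =
      pfaffian (n := n + 1) ((momentInf N b).submatrix
        (fun a : Fin (2 * n + 1 + 1) => if (a : ℕ) < 2 * n + 1 then (a : ℕ) else j)
        (fun a : Fin (2 * n + 1 + 1) => if (a : ℕ) < 2 * n + 1 then (a : ℕ) else j)) := by
  rw [pfaffian_expand_last, Finset.sum_range]
  · refine Finset.sum_congr rfl fun k _ => ?_
    have h : ((momentInf N b).submatrix
          (fun a : Fin (2 * n + 1 + 1) => if (a : ℕ) < 2 * n + 1 then (a : ℕ) else j)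
          (fun a : Fin (2 * n + 1 + 1) => if (a : ℕ) < 2 * n + 1 then (a : ℕ) else j)).submatrix
            (fun a => (k.succAbove a).castSucc) (fun a => (k.succAbove a).castSucc) =
        (momentInf N b).submatrix (fun a : Fin (2 * n) => ((k.succAbove a : Fin _) : ℕ))
          (fun a : Fin (2 * n) => ((k.succAbove a : Fin _) : ℕ)) := by
      ext1 a c
      simp only [Matrix.submatrix_apply, Fin.val_castSucc, Fin.is_lt, if_true]
    rw [h, evenCoeff, dif_pos k.2]
    simp only [Matrix.submatrix_apply, Fin.val_castSucc, Fin.is_lt, if_true, Fin.val_last,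
      lt_irrefl, if_false, pfMinor]
    ring
  · intro a c
    exact momentInf_skew N b _ _

theorem sum_evenCoeff_mul_moment_eq_zero (N : ℕ) (b : ℕ → ℂ) {n j : ℕ} (hj : j ≤ 2 * n) :
    ∑ k ∈ Finset.range (2 * n + 1), evenCoeff N b n k * momentInf N b k j = 0 := by
  rw [sum_evenCoeff_mul_moment]
  refine pfaffian_submatrix_eq_zero (n := n + 1) (momentInf N b) _
    (a := (⟨j, by omega⟩ : Fin (2 * n + 1 + 1))) (b := Fin.last (2 * n + 1)) ?_ ?_
  · intro h
    have := congrArg Fin.val h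
    simp only [Fin.val_last] at this
    omega
  · simp [show j < 2 * n + 1 by omega]

theorem sum_evenCoeff_mul_moment_eq_tau (N : ℕ) (b : ℕ → ℂ) (n : ℕ) :
    ∑ k ∈ Finset.range (2 * n + 1), evenCoeff N b n k * momentInf N b k (2 * n + 1) =
      tau N b (n + 1) := by
  rw [sum_evenCoeff_mul_moment, tau_eq_pfaffian]
  have h : (fun a : Fin (2 * n + 1 + 1) => if (a : ℕ) < 2 * n + 1 then (a : ℕ) else 2 * n + 1) =
      fun a : Fin (2 * n + 1 + 1) => (a : ℕ) := by
    funext a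
    split_ifs
    · rfl
    · have := a.2; omega
  rw [h]
  rfl

/-- Product rule: by `∂m_{kj}/∂t₁ = m_{k+1,j} + m_{k,j+1}`, applying `z + ∂/∂t₁` to the first
argument amounts to differentiating the pairing and subtracting the shift of the second argument. -/
theorem sum_qCoeff_odd_mul_moment (N : ℕ) (b : ℕ → ℂ) (n j : ℕ) :
    ∑ k ∈ Finset.range (2 * n + 1 + 1), qCoeff N b (2 * n + 1) k * momentInf N b k j =
      pderiv 1 (∑ k ∈ Finset.range (2 * n + 1), evenCoeff N b n k * momentInf N b k j) -
        ∑ k ∈ Finset.range (2 * n + 1), evenCoeff N b n k * momentInf N b k (j + 1) := by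
  have := sum_qCoeff_odd N b n fun k => AddMonoidHom.mulRight (momentInf N b k j)
  simp only [AddMonoidHom.coe_mulRight] at this
  rw [this, map_sum, ← Finset.sum_add_distrib, ← Finset.sum_sub_distrib]
  refine Finset.sum_congr rfl fun k _ => ?_
  rw [pderiv_mul, pderiv_momentInf]
  simp only [PNat.val_ofNat]
  ring

/-- The skew inner product of `q̃_k` and `z^j`. -/
def qMoment (N : ℕ) (b : ℕ → ℂ) (k j : ℕ) : TPoly :=
  ∑ i ∈ Finset.range (k + 1), qCoeff N b k i * momentInf N b i j

theorem qMoment_even (N : ℕ) (b : ℕ → ℂ) {n j : ℕ} (hj : j ≤ 2 * n) :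
    qMoment N b (2 * n) j = 0 := by
  rw [qMoment]
  simp only [qCoeff_even]
  exact sum_evenCoeff_mul_moment_eq_zero N b hj

theorem qMoment_odd_of_lt (N : ℕ) (b : ℕ → ℂ) {n j : ℕ} (hj : j < 2 * n) :
    qMoment N b (2 * n + 1) j = 0 := by
  rw [qMoment, sum_qCoeff_odd_mul_moment, sum_evenCoeff_mul_moment_eq_zero N b (by omega),
    sum_evenCoeff_mul_moment_eq_zero N b (by omega), map_zero, sub_zero]

theorem qMoment_odd_eq (N : ℕ) (b : ℕ → ℂ) (n : ℕ) :
    qMoment N b (2 * n + 1) (2 * n) = -tau N b (n + 1) := by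
  rw [qMoment, sum_qCoeff_odd_mul_moment, sum_evenCoeff_mul_moment_eq_zero N b le_rfl,
    sum_evenCoeff_mul_moment_eq_tau, map_zero, zero_sub]

/-- The skew inner product of `q̃_k` and `q̃_l`. -/
def qPairing (N : ℕ) (b : ℕ → ℂ) (k l : ℕ) : TPoly :=
  ∑ j ∈ Finset.range (l + 1), qMoment N b k j * qCoeff N b l j

theorem qPairing_skew (N : ℕ) (b : ℕ → ℂ) (k l : ℕ) : qPairing N b l k = -qPairing N b k l := by
  simp only [qPairing, qMoment, Finset.sum_mul]
  rw [Finset.sum_comm, ← Finset.sum_neg_distrib]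
  refine Finset.sum_congr rfl fun i _ => ?_
  rw [← Finset.sum_neg_distrib]
  refine Finset.sum_congr rfl fun j _ => ?_
  rw [momentInf_skew N b j i]
  ring

theorem qPairing_odd_even (N : ℕ) (b : ℕ → ℂ) (n : ℕ) :
    qPairing N b (2 * n + 1) (2 * n) = -(tau N b n * tau N b (n + 1)) := by
  have h : 2 * n / 2 = n := by omega
  rw [qPairing, Finset.sum_range_succ, Finset.sum_eq_zero, qMoment_odd_eq, qCoeff_self, h]
  · ring
  · intro j hj
    rw [qMoment_odd_of_lt N b (Finset.mem_range.mp hj), zero_mul]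

/-- Each `q̃_k` is orthogonal to all sufficiently low powers of `z`. This settles everything except
`k = l` odd, where skew-symmetry suffices. -/
theorem qPairing_of_le (N : ℕ) (b : ℕ → ℂ) {k l : ℕ} (hlk : l ≤ k)
    (h : ¬ (l % 2 = 0 ∧ k = l + 1)) : qPairing N b k l = 0 := by
  rcases Nat.even_or_odd' k with ⟨n, rfl | rfl⟩
  · refine Finset.sum_eq_zero fun j hj => ?_
    rw [qMoment_even N b (by have := Finset.mem_range.mp hj; omega), zero_mul]
  · rcases hlk.lt_or_eq with hlt | rfl
    · refine Finset.sum_eq_zero fun j hj => ?_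
      rw [qMoment_odd_of_lt N b (by have := Finset.mem_range.mp hj; omega), zero_mul]
    · exact self_eq_zero_of_eq_neg (qPairing_skew N b _ _)

theorem qPairing_eq (N : ℕ) (b : ℕ → ℂ) (k l : ℕ) :
    qPairing N b k l =
      if k % 2 = 0 ∧ l = k + 1 then tau N b (k / 2) * tau N b (k / 2 + 1)
      else if l % 2 = 0 ∧ k = l + 1 then -(tau N b (l / 2) * tau N b (l / 2 + 1)) else 0 := by
  split_ifs with h1 h2
  · obtain ⟨h, rfl⟩ := h1
    obtain ⟨n, rfl⟩ : ∃ n, k = 2 * n := ⟨k / 2, by omega⟩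
    have h' : 2 * n / 2 = n := by omega
    rw [qPairing_skew, qPairing_odd_even, h', neg_neg]
  · obtain ⟨h, rfl⟩ := h2
    obtain ⟨n, rfl⟩ : ∃ n, l = 2 * n := ⟨l / 2, by omega⟩
    have h' : 2 * n / 2 = n := by omega
    rw [qPairing_odd_even, h']
  · rcases le_total l k with h | h
    · exact qPairing_of_le N b h h2
    · rw [qPairing_skew, qPairing_of_le N b h h1, neg_zero]

theorem QTilde_mul_moment_mul_transpose {N : ℕ} (b : ℕ → ℂ) (k l : Fin N) :
    (QTilde N b * moment N N b * (QTilde N b).transpose) k l = qPairing N b k l := by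
  rw [Matrix.mul_apply, qPairing]
  have h1 : ∀ j : Fin N, (QTilde N b * moment N N b) k j = qMoment N b k j := by
    intro j
    rw [Matrix.mul_apply, qMoment]
    simp only [QTilde_apply, moment_apply]
    exact sum_fin_eq_sum_range_of_lt (f := fun i => qCoeff N b k i * momentInf N b i j) k.2
      fun i hi => by rw [qCoeff_of_lt b hi, zero_mul]
  simp only [h1, Matrix.transpose_apply, QTilde_apply]
  exact sum_fin_eq_sum_range_of_lt (f := fun j => qMoment N b k j * qCoeff N b l j) l.2
    fun j hj => by rw [qCoeff_of_lt b hj, mul_zero]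

/-! ### The τ-functions as sums of Schur polynomials -/

/-- The family `g₀, N - 1 - g₀, g₁, N - 1 - g₁, …`. -/
def dualPairs {n N : ℕ} (g : Fin n → Fin N) : Fin (2 * n) → Fin N :=
  (pairFunEquiv n (Fin N)).symm fun i => (g i, (g i).rev)

theorem dualPairs_pairFst {n N : ℕ} (g : Fin n → Fin N) (i : Fin n) :
    dualPairs g (pairFst i) = g i :=
  congrArg Prod.fst (congrFun ((pairFunEquiv n (Fin N)).apply_symm_apply
    fun i => (g i, (g i).rev)) i)

theorem dualPairs_pairSnd {n N : ℕ} (g : Fin n → Fin N) (i : Fin n) :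
    dualPairs g (pairSnd i) = (g i).rev :=
  congrArg Prod.snd (congrFun ((pairFunEquiv n (Fin N)).apply_symm_apply
    fun i => (g i, (g i).rev)) i)

theorem funext_pairs {n : ℕ} {ι : Type*} {f g : Fin (2 * n) → ι}
    (h1 : ∀ i, f (pairFst i) = g (pairFst i)) (h2 : ∀ i, f (pairSnd i) = g (pairSnd i)) :
    f = g := by
  apply (pairFunEquiv n ι).injective
  funext i
  exact Prod.ext (h1 i) (h2 i)

theorem dualPairs_comp {n N : ℕ} (g : Fin n → Fin N) (τ : Equiv.Perm (Fin n)) :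
    dualPairs (g ∘ τ) = dualPairs g ∘ slotPerm τ := by
  apply funext_pairs
  · intro i
    rw [Function.comp_apply, slotPerm_pairFst, dualPairs_pairFst, dualPairs_pairFst]
    rfl
  · intro i
    rw [Function.comp_apply, slotPerm_pairSnd, dualPairs_pairSnd, dualPairs_pairSnd]
    rfl

/-- Reflect the entries of `g` at the places where `ε` is not the identity. -/
def reflect {n N : ℕ} (ε : Fin n → Equiv.Perm (Fin 2)) (g : Fin n → Fin N) (i : Fin n) : Fin N :=
  if ε i = 1 then g i else (g i).rev

theorem perm_fin_two (s : Equiv.Perm (Fin 2)) : s = 1 ∨ s = Equiv.swap 0 1 := by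
  revert s; decide

theorem dualPairs_reflect {n N : ℕ} (g : Fin n → Fin N) (ε : Fin n → Equiv.Perm (Fin 2)) :
    dualPairs (reflect ε g) = dualPairs g ∘ flipPerm ε := by
  have hne : Equiv.swap (0 : Fin 2) 1 ≠ 1 := by decide
  apply funext_pairs
  · intro i
    rw [Function.comp_apply, flipPerm_pairFst, dualPairs_pairFst, reflect]
    rcases perm_fin_two (ε i) with h | h
    · rw [h, if_pos rfl, Equiv.Perm.one_apply, pairEquiv_zero, dualPairs_pairFst]
    · rw [h, if_neg hne, Equiv.swap_apply_left, pairEquiv_one, dualPairs_pairSnd]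
  · intro i
    rw [Function.comp_apply, flipPerm_pairSnd, dualPairs_pairSnd, reflect]
    rcases perm_fin_two (ε i) with h | h
    · rw [h, if_pos rfl, Equiv.Perm.one_apply, pairEquiv_one, dualPairs_pairSnd]
    · rw [h, if_neg hne, Equiv.swap_apply_right, pairEquiv_zero, dualPairs_pairFst, Fin.rev_rev]

theorem max_rev_reflect {n N : ℕ} (g : Fin n → Fin N) (ε : Fin n → Equiv.Perm (Fin 2))
    (hg : ∀ i, (g i).rev < g i) (i : Fin n) :
    max (reflect ε g i) (reflect ε g i).rev = g i := by
  rw [reflect]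
  split_ifs
  · exact max_eq_left (hg i).le
  · rw [Fin.rev_rev]
    exact max_eq_right (hg i).le

/-- The strictly decreasing families in the upper half of `0, …, N - 1`. -/
def upperFamilies (n N : ℕ) : Finset (Fin n → Fin N) :=
  open Classical in Finset.univ.filter fun h => StrictAnti h ∧ ∀ i, (h i).rev < h i

theorem mem_upperFamilies {n N : ℕ} {h : Fin n → Fin N} :
    h ∈ upperFamilies n N ↔ StrictAnti h ∧ ∀ i, (h i).rev < h i := by
  simp [upperFamilies]

/-- Permutations and reflections act freely on the families with injective `dualPairs`. Each orbit
has `2^n n!` elements and meets `upperFamilies` exactly once. -/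
theorem sum_dualPairs_invariant {A : Type*} [CommRing A] {n N : ℕ} (T : (Fin n → Fin N) → A)
    (hperm : ∀ g (τ : Equiv.Perm (Fin n)), T (g ∘ τ) = T g)
    (hrefl : ∀ g ε, T (reflect ε g) = T g)
    (hzero : ∀ g, ¬ Function.Injective (dualPairs g) → T g = 0) :
    ∑ g, T g = (2 ^ n * (n.factorial : A)) * ∑ h ∈ upperFamilies n N, T h := by
  classical
  have hfst : ∀ {g : Fin n → Fin N}, Function.Injective (dualPairs g) →
      ∀ i, g i ≠ (g i).rev := by
    intro g hg i h
    have := congrArg Fin.val (@hg (pairFst i) (pairSnd i)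
      (by rw [dualPairs_pairFst, dualPairs_pairSnd, ← h]))
    simp [pairFst, pairSnd] at this
  have h1 : ∑ g, T g = ∑ g ∈ Finset.univ.filter
      (fun g : Fin n → Fin N => Function.Injective (dualPairs g)), T g := by
    symm
    apply Finset.sum_subset (Finset.filter_subset _ _)
    intro g _ hg
    exact hzero g (by simpa using hg)
  have h2 : ∑ g ∈ Finset.univ.filter
      (fun g : Fin n → Fin N => Function.Injective (dualPairs g)), T g =
      ∑ p ∈ upperFamilies n N ×ˢ (Finset.univ : Finset (Equiv.Perm (Fin n) ×
        (Fin n → Equiv.Perm (Fin 2)))), T p.1 := by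
    symm
    refine Finset.sum_bij (fun p _ => reflect p.2.2 (p.1 ∘ p.2.1)) ?_ ?_ ?_ ?_
    · rintro ⟨h, σ, ε⟩ hp
      obtain ⟨ha, hu⟩ := mem_upperFamilies.mp (Finset.mem_product.mp hp).1
      simp only [Finset.mem_filter, Finset.mem_univ, true_and]
      rw [dualPairs_reflect, dualPairs_comp]
      refine Function.Injective.comp (Function.Injective.comp ?_ (Equiv.injective _))
        (Equiv.injective _)
      intro a c hac
      obtain ⟨⟨i, x⟩, rfl⟩ := (pairEquiv n).surjective a
      obtain ⟨⟨j, y⟩, rfl⟩ := (pairEquiv n).surjective c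
      have hij := hu i
      have hij' := hu j
      simp only [Fin.lt_def, Fin.val_rev] at hij hij'
      fin_cases x <;> fin_cases y <;>
        simp only [Fin.zero_eta, Fin.mk_one, pairEquiv_zero, pairEquiv_one, dualPairs_pairFst,
          dualPairs_pairSnd] at hac ⊢
      · rw [ha.injective hac]
      · simp only [Fin.ext_iff, Fin.val_rev] at hac; omega
      · simp only [Fin.ext_iff, Fin.val_rev] at hac; omega
      · rw [ha.injective (Fin.rev_injective hac)]
    · rintro ⟨h, σ, ε⟩ hp ⟨h', σ', ε'⟩ hp' heq
      obtain ⟨ha, hu⟩ := mem_upperFamilies.mp (Finset.mem_product.mp hp).1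
      obtain ⟨ha', hu'⟩ := mem_upperFamilies.mp (Finset.mem_product.mp hp').1
      simp only at heq ha ha' hu hu'
      -- The maximum of an entry and its reflection does not depend on the reflections `ε`, `ε'`.
      have e1 : h ∘ σ = h' ∘ σ' := by
        funext i
        rw [← max_rev_reflect (h ∘ σ) ε (fun i => hu _) i, heq,
          max_rev_reflect (h' ∘ σ') ε' (fun i => hu' _) i]
      have e2 : h ∘ (σ * σ'⁻¹ : Equiv.Perm (Fin n)) = h' := by
        rw [Equiv.Perm.coe_mul, ← Function.comp_assoc, e1, Function.comp_assoc,
          ← Equiv.Perm.coe_mul, mul_inv_cancel, Equiv.Perm.coe_one, Function.comp_id]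
      have e3 : h = h' := by
        rw [← e2]
        refine Tuple.unique_antitone (f := h) (σ := 1) ?_ ?_
        · simpa using ha.antitone
        · rw [e2]; exact ha'.antitone
      subst e3
      have e4 : σ = σ' := by
        ext1 i
        exact ha.injective (congrFun e1 i)
      subst e4
      have e5 : ε = ε' := by
        funext i
        have := congrFun heq i
        have hi := hu (σ i)
        simp only [reflect, Function.comp_apply] at this
        rcases perm_fin_two (ε i) with h1 | h1 <;> rcases perm_fin_two (ε' i) with h2 | h2 <;>
          rw [h1, h2] at this ⊢
        · rw [if_pos rfl, if_neg (by decide)] at this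
          exact absurd this.symm hi.ne
        · rw [if_pos rfl, if_neg (by decide)] at this
          exact absurd this hi.ne
      rw [e5]
    · intro g hg
      have hinj : Function.Injective (dualPairs g) := by simpa using hg
      have hne := hfst hinj
      -- The representative of the orbit of `g`: move all entries to the upper half, then sort them
      -- in decreasing order.
      set m : Fin n → Fin N := fun i => max (g i) (g i).rev with hm
      have hmu : ∀ i, (m i).rev < m i := by
        intro i
        have := hne i
        simp only [hm]
        rcases le_total (g i) (g i).rev with h | h
        · rw [max_eq_right h, Fin.rev_rev]; exact lt_of_le_of_ne h this
        · rw [max_eq_left h]; exact lt_of_le_of_ne h this.symm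
      have hmg : ∀ i, g i = m i ∨ g i = (m i).rev := by
        intro i
        simp only [hm]
        rcases le_total (g i) (g i).rev with h | h
        · rw [max_eq_right h, Fin.rev_rev]; exact Or.inr rfl
        · rw [max_eq_left h]; exact Or.inl rfl
      have hminj : Function.Injective m := by
        intro i j hij
        have key : ∀ a c : Fin (2 * n), dualPairs g a = dualPairs g c → (a : ℕ) / 2 = (c : ℕ) / 2 :=
          fun a c hac => by rw [hinj hac]
        have hv : ∀ i : Fin n, (pairFst i : ℕ) / 2 = i ∧ (pairSnd i : ℕ) / 2 = i := by
          intro i; constructor <;> simp only [pairFst, pairSnd] <;> omega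
        apply Fin.ext
        rcases hmg i with h1 | h1 <;> rcases hmg j with h2 | h2
        · have := key (pairFst i) (pairFst j)
            (by rw [dualPairs_pairFst, dualPairs_pairFst, h1, h2, hij])
          rwa [(hv i).1, (hv j).1] at this
        · have := key (pairFst i) (pairSnd j)
            (by rw [dualPairs_pairFst, dualPairs_pairSnd, h1, h2, hij, Fin.rev_rev])
          rwa [(hv i).1, (hv j).2] at this
        · have := key (pairSnd i) (pairFst j)
            (by rw [dualPairs_pairFst, dualPairs_pairSnd, h1, h2, hij, Fin.rev_rev])
          rwa [(hv i).2, (hv j).1] at this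
        · have := key (pairFst i) (pairFst j)
            (by rw [dualPairs_pairFst, dualPairs_pairFst, h1, h2, hij])
          rwa [(hv i).1, (hv j).1] at this
      set s : Equiv.Perm (Fin n) := Tuple.sort m * Fin.revPerm with hs
      have hsa : StrictAnti (m ∘ s) := by
        refine Antitone.strictAnti_of_injective ?_ (hminj.comp s.injective)
        intro i j hij
        exact Tuple.monotone_sort m (Fin.rev_le_rev.mpr hij)
      refine ⟨(m ∘ s, s⁻¹, fun i => if g i = m i then 1 else Equiv.swap 0 1), ?_, ?_⟩
      · rw [Finset.mem_product]
        exact ⟨mem_upperFamilies.mpr ⟨hsa, fun i => hmu _⟩, Finset.mem_univ _⟩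
      · funext i
        have hsi : s (s⁻¹ i) = i := s.apply_symm_apply i
        simp only [reflect, Function.comp_apply, hsi]
        by_cases h : g i = m i
        · rw [if_pos h, if_pos rfl, h]
        · rw [if_neg h, if_neg (by decide)]
          exact ((hmg i).resolve_left h).symm
    · rintro ⟨h, σ, ε⟩ _
      rw [hrefl, hperm]
  have hcard : (Finset.univ : Finset (Equiv.Perm (Fin n) × (Fin n → Equiv.Perm (Fin 2)))).card =
      n.factorial * 2 ^ n := by
    rw [Finset.card_univ, Fintype.card_prod, Fintype.card_perm, Fintype.card_fun,
      Fintype.card_perm, Fintype.card_fin, Fintype.card_fin, Nat.factorial_two]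
  rw [h1, h2, Finset.sum_product]
  simp only [Finset.sum_const, hcard, nsmul_eq_mul]
  rw [← Finset.mul_sum]
  push_cast
  ring

theorem initMat_eq_zero {N : ℕ} (b : ℕ → ℂ) {k l : Fin N} (h : l ≠ k.rev) :
    initMat N b k l = 0 := by
  rw [initMat, Matrix.of_apply, if_neg]
  intro h'
  apply h
  rw [Fin.ext_iff, Fin.val_rev]
  omega

/-- For `k` in the upper half the entry lies below the main diagonal, whence the sign; its distance
from the centre is `N/2 - 1 - (N - 1 - k) = k - (N + 1)/2`, with rounded quotients. -/
theorem initMat_rev {N : ℕ} (b : ℕ → ℂ) {k : Fin N} (h : k.rev < k) :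
    initMat N b k k.rev = -b ((k : ℕ) - (N + 1) / 2) := by
  have h' := Fin.lt_def.mp h
  rw [Fin.val_rev] at h'
  rw [initMat, Matrix.of_apply, if_pos, if_neg, if_pos]
  · rw [Fin.val_rev]
    congr 2
    omega
  · exact h
  · exact not_lt.mpr h.le
  · rw [Fin.val_rev]; omega

/-- The contribution of `g` to the minor summation formula for the τ-function. -/
def tauTerm {N : ℕ} (b : ℕ → ℂ) {n : ℕ} (g : Fin n → Fin N) : TPoly :=
  pairTerm ((initMat N b).map (C : ℂ →+* TPoly)) (evolMat (2 * n) N) (dualPairs g)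

/-- As `m_N(0)` is antidiagonal, only families pairing each `k` with `N - 1 - k` survive in the
minor summation formula. The size `2^n n!` of the orbits cancels the normalization of the Pfaffian.
-/
theorem tau_eq_sum_tauTerm (N : ℕ) (b : ℕ → ℂ) (n : ℕ) :
    tau N b n = ∑ h ∈ upperFamilies n N, tauTerm b h := by
  have hskew : ∀ i j, (initMat N b).map (C : ℂ →+* TPoly) j i =
      -(initMat N b).map (C : ℂ →+* TPoly) i j := by
    intro i j
    rw [Matrix.map_apply, initMat_skew, map_neg, Matrix.map_apply]
  have h1 : tau N b n = pfConst n • ∑ g : Fin n → Fin N, tauTerm b g := by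
    rw [tau, pf_eq_pfaffian, moment, pfaffian_conj]
    congr 1
    symm
    refine Fintype.sum_of_injective (dualPairs : (Fin n → Fin N) → _) ?_ _ _ ?_ fun g => rfl
    · intro g g' h
      funext i
      rw [← dualPairs_pairFst g, h, dualPairs_pairFst]
    · intro f hf
      by_cases h : ∀ i, f (pairSnd i) = (f (pairFst i)).rev
      · exfalso
        apply hf
        refine ⟨fun i => f (pairFst i), funext_pairs (fun i => ?_) fun i => ?_⟩
        · rw [dualPairs_pairFst]
        · rw [dualPairs_pairSnd, h]
      · push Not at h
        obtain ⟨i, hi⟩ := h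
        rw [pairTerm, Finset.prod_eq_zero (Finset.mem_univ i), zero_mul]
        rw [Matrix.map_apply, initMat_eq_zero b hi, map_zero]
  rw [h1, sum_dualPairs_invariant (tauTerm b), Algebra.smul_def, ← mul_assoc]
  · have : algebraMap ℂ TPoly (pfConst n) * (2 ^ n * (n.factorial : TPoly)) = 1 := by
      have e : (2 ^ n * (n.factorial : TPoly)) =
          algebraMap ℂ TPoly (2 ^ n * (n.factorial : ℂ)) := by
        rw [map_mul, map_pow, map_natCast, map_ofNat]
      rw [e, ← map_mul, pfConst, one_div_mul_cancel, map_one]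
      exact mul_ne_zero (pow_ne_zero _ two_ne_zero) (by exact_mod_cast n.factorial_ne_zero)
    rw [this, one_mul]
  · intro g τ
    rw [tauTerm, dualPairs_comp, pairTerm_comp_slotPerm, tauTerm]
  · intro g ε
    rw [tauTerm, dualPairs_reflect, pairTerm_comp_flipPerm hskew, tauTerm]
  · intro g hg
    rw [tauTerm, pairTerm, det_submatrix_eq_zero_of_not_injective _ hg, mul_zero]

/-- The permutation with values `0, 2n - 1, 1, 2n - 2, …`. -/
def rifflePerm (n : ℕ) : Equiv.Perm (Fin (2 * n)) where
  toFun k := if (k : ℕ) % 2 = 0 then ⟨k / 2, by omega⟩ else ⟨2 * n - 1 - k / 2, by omega⟩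
  invFun j := if h : (j : ℕ) < n then ⟨2 * j, by omega⟩ else ⟨2 * (2 * n - 1 - j) + 1, by omega⟩
  left_inv k := by
    ext
    beta_reduce
    by_cases h : (k : ℕ) % 2 = 0
    · rw [if_pos h, dif_pos (show (k : ℕ) / 2 < n by omega)]
      simp only; omega
    · rw [if_neg h, dif_neg (show ¬ 2 * n - 1 - (k : ℕ) / 2 < n by omega)]
      simp only; omega
  right_inv j := by
    ext
    beta_reduce
    by_cases h : (j : ℕ) < n
    · rw [dif_pos h, if_pos (show 2 * (j : ℕ) % 2 = 0 by omega)]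
      simp only; omega
    · rw [dif_neg h, if_neg (show ¬ (2 * (2 * n - 1 - (j : ℕ)) + 1) % 2 = 0 by omega)]
      simp only; omega

theorem rifflePerm_val {n : ℕ} (k : Fin (2 * n)) : (rifflePerm n k : ℕ) =
    if (k : ℕ) % 2 = 0 then (k : ℕ) / 2 else 2 * n - 1 - (k : ℕ) / 2 := by
  rw [rifflePerm, Equiv.coe_fn_mk]
  split_ifs <;> rfl

/-- The value at an even place is below all later ones, and the value at an odd place is above all
later ones. An odd place is followed by an even number of places, so the number of inversions is
even. -/
theorem sign_rifflePerm (n : ℕ) : Equiv.Perm.sign (rifflePerm n) = 1 := by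
  rw [Equiv.Perm.sign_eq_prod_prod_Ioi]
  refine Finset.prod_eq_one fun i _ => ?_
  by_cases hi : (i : ℕ) % 2 = 0
  · refine Finset.prod_eq_one fun j hj => if_pos ?_
    have hij := Fin.lt_def.mp (Finset.mem_Ioi.mp hj)
    rw [Fin.lt_def, rifflePerm_val, rifflePerm_val, if_pos hi]
    split_ifs <;> omega
  · rw [Finset.prod_congr rfl (g := fun _ => -1), Finset.prod_const, Fin.card_Ioi]
    · apply Even.neg_one_pow
      rw [Nat.even_iff]
      omega
    · intro j hj
      have hij := Fin.lt_def.mp (Finset.mem_Ioi.mp hj)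
      rw [if_neg]
      rw [Fin.lt_def, rifflePerm_val, rifflePerm_val, if_neg hi]
      split_ifs <;> omega

theorem rifflePerm_pairFst {n : ℕ} (i : Fin n) : (rifflePerm n (pairFst i) : ℕ) = i := by
  rw [rifflePerm_val, pairFst, if_pos (by simp)]
  simp

theorem rifflePerm_pairSnd {n : ℕ} (i : Fin n) :
    (rifflePerm n (pairSnd i) : ℕ) = 2 * n - 1 - i := by
  rw [rifflePerm_val, pairSnd, if_neg (by simp only; omega)]
  simp only; omega

/-- The riffle conjugates the reversal into the product of the `n` flips of pairs. -/
theorem sign_revPerm_two_mul (n : ℕ) :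
    Equiv.Perm.sign (Fin.revPerm : Equiv.Perm (Fin (2 * n))) = (-1) ^ n := by
  have h : (Fin.revPerm : Equiv.Perm (Fin (2 * n))) * rifflePerm n =
      rifflePerm n * flipPerm fun _ => Equiv.swap 0 1 := by
    apply Equiv.ext
    refine congrFun (funext_pairs (fun i => ?_) fun i => ?_)
    · rw [Equiv.Perm.mul_apply, Equiv.Perm.mul_apply, flipPerm_pairFst, Equiv.swap_apply_left,
        pairEquiv_one, Fin.revPerm_apply]
      ext
      rw [Fin.val_rev, rifflePerm_pairFst, rifflePerm_pairSnd]
      omega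
    · rw [Equiv.Perm.mul_apply, Equiv.Perm.mul_apply, flipPerm_pairSnd, Equiv.swap_apply_right,
        pairEquiv_zero, Fin.revPerm_apply]
      ext
      rw [Fin.val_rev, rifflePerm_pairFst, rifflePerm_pairSnd]
      omega
  have := congrArg Equiv.Perm.sign h
  rw [Equiv.Perm.sign_mul, Equiv.Perm.sign_mul, sign_rifflePerm, mul_one, one_mul,
    sign_flipPerm] at this
  rw [this]
  simp

/-- The decreasing family `h₀, …, h_{n-1}, N - 1 - h_{n-1}, …, N - 1 - h₀`. -/
def mirror {n N : ℕ} (h : Fin n → Fin N) (j : Fin (2 * n)) : Fin N :=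
  if hj : (j : ℕ) < n then h ⟨j, hj⟩ else (h ⟨2 * n - 1 - j, by omega⟩).rev

theorem mirror_of_lt {n N : ℕ} (h : Fin n → Fin N) {j : Fin (2 * n)} (hj : (j : ℕ) < n) :
    mirror h j = h ⟨j, hj⟩ := dif_pos hj

theorem mirror_rev {n N : ℕ} (h : Fin n → Fin N) (j : Fin (2 * n)) :
    mirror h j.rev = (mirror h j).rev := by
  have hr := Fin.val_rev j
  by_cases hj : (j : ℕ) < n
  · rw [mirror_of_lt h hj, mirror, dif_neg (by omega)]
    congr 2
    ext
    simp only
    omega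
  · rw [mirror_of_lt h (show (j.rev : ℕ) < n by omega), mirror, dif_neg hj, Fin.rev_rev]
    congr 1
    ext
    simp only
    omega

theorem mirror_comp_rifflePerm {n N : ℕ} (h : Fin n → Fin N) :
    mirror h ∘ rifflePerm n = dualPairs h := by
  have h1 : ∀ i, mirror h (rifflePerm n (pairFst i)) = h i := by
    intro i
    rw [mirror_of_lt h (by rw [rifflePerm_pairFst]; exact i.2)]
    congr 1
    ext
    exact rifflePerm_pairFst i
  refine funext_pairs (fun i => ?_) fun i => ?_
  · rw [Function.comp_apply, h1, dualPairs_pairFst]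
  · rw [dualPairs_pairSnd, ← h1 i, ← mirror_rev, Function.comp_apply]
    congr 1
    ext
    rw [Fin.val_rev, rifflePerm_pairFst, rifflePerm_pairSnd]
    omega

theorem strictAnti_mirror {n N : ℕ} {h : Fin n → Fin N} (hh : h ∈ upperFamilies n N) :
    StrictAnti (mirror h) := by
  obtain ⟨ha, hu⟩ := mem_upperFamilies.mp hh
  simp only [Fin.lt_def, Fin.val_rev] at hu
  intro i j hij
  have hij' := Fin.lt_def.mp hij
  simp only [mirror]
  split_ifs with h1 h2 h2
  · exact ha hij
  · omega
  · rw [Fin.lt_def, Fin.val_rev]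
    have h3 := hu ⟨i, h2⟩
    have h4 := hu ⟨2 * n - 1 - j, by omega⟩
    omega
  · exact Fin.rev_lt_rev.mpr (ha (Fin.lt_def.mpr (by simp only; omega)))

/-- A strictly decreasing family has room for the values that follow. Hence the natural subtraction
in `mirrorPartition` is never truncated. -/
theorem le_of_strictAnti {m N : ℕ} {H : Fin m → Fin N} (hH : StrictAnti H) (d : ℕ) :
    ∀ i : Fin m, (i : ℕ) + d < m → d ≤ H i := by
  induction d with
  | zero => intro i _; exact Nat.zero_le _
  | succ d ih =>
    intro i hi
    have h1 := ih ⟨i + 1, by omega⟩ (by simp only; omega)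
    have h2 : i < ⟨i + 1, by omega⟩ := Fin.lt_def.mpr (Nat.lt_succ_self _)
    have h3 := Fin.lt_def.mp (hH h2)
    omega

/-- The partition with the shifted parts `mirror h`. -/
def mirrorPartition {n N : ℕ} (h : Fin n → Fin N) (j : Fin (2 * n)) : ℕ :=
  (mirror h j : ℕ) - (2 * n - 1 - j)

theorem mirrorPartition_add {n N : ℕ} {h : Fin n → Fin N} (hh : h ∈ upperFamilies n N)
    (j : Fin (2 * n)) : mirrorPartition h j + (2 * n - 1 - j) = mirror h j := by
  have := le_of_strictAnti (strictAnti_mirror hh) (2 * n - 1 - j) j (by omega)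
  rw [mirrorPartition]
  omega

/-- With `H_i = μ_i + (2n - 1 - i)` one has `μ_i - i + j = H_i - (2n - 1 - j)`. So the Schur
determinant is a minor of `E`, transposed and with its rows in reverse order. -/
theorem schur_mirrorPartition {n N : ℕ} {h : Fin n → Fin N} (hh : h ∈ upperFamilies n N) :
    schur (mirrorPartition h) = (-1) ^ n * ((evolMat (2 * n) N).submatrix id (mirror h)).det := by
  have h1 := Matrix.det_permute Fin.revPerm ((evolMat (2 * n) N).submatrix id (mirror h))
  rw [sign_revPerm_two_mul] at h1
  rw [Units.val_pow_eq_pow_val, Units.val_neg, Units.val_one, Int.cast_pow, Int.cast_neg,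
    Int.cast_one] at h1
  rw [← h1, schur, ← Matrix.det_transpose]
  congr 1
  ext1 i j
  rw [Matrix.transpose_apply, Matrix.of_apply, Matrix.submatrix_submatrix, Matrix.submatrix_apply,
    evolMat_apply]
  have := mirrorPartition_add hh j
  congr 1
  simp only [Function.comp_apply, id_eq, Fin.revPerm_apply, Fin.val_rev]
  omega

/-- The `n` entries below the diagonal contribute `(-1)^n`, which cancels the `(-1)^n` of the row
reversal; passing from the paired order to the decreasing order is even. -/
theorem tauTerm_eq_smul_schur {N : ℕ} (b : ℕ → ℂ) {n : ℕ} {h : Fin n → Fin N}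
    (hh : h ∈ upperFamilies n N) :
    tauTerm b h = (∏ i, b ((h i : ℕ) - (N + 1) / 2)) • schur (mirrorPartition h) := by
  obtain ⟨ha, hu⟩ := mem_upperFamilies.mp hh
  have h1 := Matrix.det_permute' (rifflePerm n) ((evolMat (2 * n) N).submatrix id (mirror h))
  rw [sign_rifflePerm, Units.val_one, Int.cast_one, one_mul, Matrix.submatrix_submatrix,
    mirror_comp_rifflePerm] at h1
  have h2 : ∀ i, (initMat N b).map (C : ℂ →+* TPoly) (dualPairs h (pairFst i))
      (dualPairs h (pairSnd i)) = -1 * C (b ((h i : ℕ) - (N + 1) / 2)) := by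
    intro i
    rw [dualPairs_pairFst, dualPairs_pairSnd, Matrix.map_apply, initMat_rev b (hu i)]
    simp
  rw [tauTerm, pairTerm, Finset.prod_congr rfl fun i _ => h2 i, Finset.prod_mul_distrib,
    schur_mirrorPartition hh, smul_eq_C_mul, map_prod]
  rw [Function.id_comp] at h1
  rw [h1]
  simp only [Finset.prod_const, Finset.card_univ, Fintype.card_fin]
  ring

/-! ### Self-dual partitions and their shifted parts -/

theorem selfDual_add_rev {n N : ℕ} {μ : Fin (2 * n) → ℕ}
    (hμ : μ ∈ selfDual (2 * n) (2 * n * (N - 2 * n) / 2)) (i : Fin (2 * n)) :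
    μ i + μ i.rev = N - 2 * n := by
  have h := (mem_selfDual.mp hμ).2.2 i
  have hn : 0 < 2 * n := i.pos
  have h' : 2 * n * (N - 2 * n) / 2 = n * (N - 2 * n) := by
    rw [mul_assoc, Nat.mul_div_cancel_left _ two_pos]
  rw [h', ← mul_assoc] at h
  exact Nat.eq_of_mul_eq_mul_left hn h

theorem fin_lt_two_mul {n : ℕ} (i : Fin n) : (i : ℕ) < 2 * n :=
  i.2.trans_le (Nat.le_mul_of_pos_left n two_pos)

/-- The upper half of the shifted parts of a self-dual partition. -/
def upperParts {n N : ℕ} (hN : 0 < N) (μ : Fin (2 * n) → ℕ) (i : Fin n) : Fin N :=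
  -- The reduction modulo `N` only provides the bound; by `upperParts_val` it changes nothing for
  -- the partitions considered.
  ⟨(μ ⟨i, fin_lt_two_mul i⟩ + (2 * n - 1 - i)) % N, Nat.mod_lt _ hN⟩

theorem upperParts_val {n N : ℕ} (hN : 0 < N) (h2 : 2 * n ≤ N) {μ : Fin (2 * n) → ℕ}
    (hμ : μ ∈ selfDual (2 * n) (2 * n * (N - 2 * n) / 2)) (i : Fin n) :
    (upperParts hN μ i : ℕ) = μ ⟨i, fin_lt_two_mul i⟩ + (2 * n - 1 - i) := by
  have := selfDual_add_rev hμ ⟨i, fin_lt_two_mul i⟩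
  exact Nat.mod_eq_of_lt (by omega)

theorem upperParts_mem {n N : ℕ} (hN : 0 < N) (h2 : 2 * n ≤ N) {μ : Fin (2 * n) → ℕ}
    (hμ : μ ∈ selfDual (2 * n) (2 * n * (N - 2 * n) / 2)) :
    upperParts hN μ ∈ upperFamilies n N := by
  have ha := (mem_selfDual.mp hμ).1
  refine mem_upperFamilies.mpr ⟨fun i j hij => ?_, fun i => ?_⟩
  · have hij' := Fin.lt_def.mp hij
    have := @ha ⟨i, by omega⟩ ⟨j, by omega⟩ (Fin.le_def.mpr hij'.le)
    rw [Fin.lt_def, upperParts_val hN h2 hμ, upperParts_val hN h2 hμ]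
    omega
  · have h3 := selfDual_add_rev hμ ⟨i, fin_lt_two_mul i⟩
    have h4 := @ha ⟨i, by omega⟩ (Fin.rev ⟨i, by omega⟩)
      (Fin.le_def.mpr (by rw [Fin.val_rev]; simp only; omega))
    rw [Fin.lt_def, Fin.val_rev, upperParts_val hN h2 hμ]
    omega

theorem mirrorPartition_mem {n N : ℕ} {h : Fin n → Fin N} (h2 : 2 * n ≤ N)
    (hh : h ∈ upperFamilies n N) :
    mirrorPartition h ∈ selfDual (2 * n) (2 * n * (N - 2 * n) / 2) := by
  have hadd : ∀ i, mirrorPartition h i + mirrorPartition h i.rev = N - 2 * n := by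
    intro i
    have h3 := mirrorPartition_add hh i
    have h4 := mirrorPartition_add hh i.rev
    rw [mirror_rev, Fin.val_rev, Fin.val_rev] at h4
    have := (mirror h i).2
    omega
  rw [mul_assoc, Nat.mul_div_cancel_left _ two_pos]
  refine mem_selfDual.mpr ⟨?_, ?_, ?_⟩
  · intro i j hij
    rcases hij.lt_or_eq with h5 | rfl
    · have h3 := mirrorPartition_add hh i
      have h4 := mirrorPartition_add hh j
      have hH : ∀ d : ℕ, ∀ j : Fin (2 * n), (j : ℕ) = i + d →
          (mirror h j : ℕ) + d ≤ mirror h i := by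
        intro d
        induction d with
        | zero =>
          intro j hj
          have : j = i := Fin.ext hj
          rw [this]; omega
        | succ d ih =>
          intro j hj
          have h6 := ih ⟨i + d, by omega⟩ rfl
          have h7 := Fin.lt_def.mp (strictAnti_mirror hh
            (show (⟨i + d, by omega⟩ : Fin (2 * n)) < j from
              Fin.lt_def.mpr (by simp only; omega)))
          omega
      have h8 := hH (j - i) j (by have := Fin.lt_def.mp h5; omega)
      have := Fin.lt_def.mp h5
      omega
    · exact le_rfl
  · have h3 : ∑ i : Fin (2 * n), mirrorPartition h i.rev = ∑ i, mirrorPartition h i :=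
      Equiv.sum_comp Fin.revPerm (mirrorPartition h)
    have h4 : ∑ i : Fin (2 * n), (mirrorPartition h i + mirrorPartition h i.rev) =
        2 * n * (N - 2 * n) := by
      rw [Finset.sum_congr rfl fun i _ => hadd i]
      simp
    rw [Finset.sum_add_distrib, h3] at h4
    have h5 : 2 * n * (N - 2 * n) = 2 * (n * (N - 2 * n)) := by ring
    omega
  · intro i
    rw [hadd]
    ring

/-- Self-duality `μ_i + μ_{rev i} = N - 2n` says that the shifted parts are symmetric under `k ↦ N -
1 - k`, so their larger half determines the partition and is an arbitrary upper family. -/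
theorem tau_eq_sum_schur {N : ℕ} (hN : 0 < N) (b : ℕ → ℂ) {n : ℕ} (h2 : 2 * n ≤ N) :
    tau N b n = ∑ μ ∈ selfDual (2 * n) (2 * n * (N - 2 * n) / 2),
      (∏ i : Fin n, b (μ ⟨i, fin_lt_two_mul i⟩ + 2 * n - ((i : ℕ) + 1) - (N + 1) / 2)) • schur μ := by
  rw [tau_eq_sum_tauTerm]
  symm
  have hright : ∀ μ ∈ selfDual (2 * n) (2 * n * (N - 2 * n) / 2),
      mirrorPartition (upperParts hN μ) = μ := by
    intro μ hμ
    funext j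
    by_cases hj : (j : ℕ) < n
    · rw [mirrorPartition, mirror_of_lt _ hj, upperParts_val hN h2 hμ]
      simp
    · have h3 := selfDual_add_rev hμ j
      have h4 : mirror (upperParts hN μ) j = (upperParts hN μ ⟨2 * n - 1 - j, by omega⟩).rev :=
        dif_neg hj
      have h5 : (⟨2 * n - 1 - (j : ℕ), by omega⟩ : Fin (2 * n)) = j.rev := by
        ext
        rw [Fin.val_rev]
        simp only
        omega
      rw [mirrorPartition, h4, Fin.val_rev, upperParts_val hN h2 hμ]
      simp only [h5]
      omega
  refine Finset.sum_bij' (fun μ _ => upperParts hN μ) (fun h _ => mirrorPartition h)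
    (fun μ hμ => upperParts_mem hN h2 hμ) (fun h hh => mirrorPartition_mem h2 hh) hright ?_ ?_
  · intro h hh
    funext i
    ext
    rw [upperParts_val hN h2 (mirrorPartition_mem h2 hh)]
    have := mirrorPartition_add hh ⟨i, fin_lt_two_mul i⟩
    rw [mirror_of_lt h (show ((⟨i, fin_lt_two_mul i⟩ : Fin (2 * n)) : ℕ) < n from i.2)] at this
    exact this
  · intro μ hμ
    rw [tauTerm_eq_smul_schur b (upperParts_mem hN h2 hμ), hright μ hμ]
    congr 1
    refine Finset.prod_congr rfl fun i _ => ?_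
    rw [upperParts_val hN h2 hμ]
    congr 2
    omega

theorem tau_mem_schurSpan {N : ℕ} (hN : 0 < N) (b : ℕ → ℂ) {n : ℕ} (h2 : 2 * n ≤ N) :
    tau N b n ∈ schurSpan (2 * n) (2 * n * (N - 2 * n) / 2) := by
  rw [tau_eq_sum_schur hN b h2]
  exact Submodule.sum_mem _ fun μ hμ =>
    Submodule.smul_mem _ _ (Submodule.subset_span ⟨μ, hμ, rfl⟩)

/-! ### Nonvanishing of the τ-functions -/

/-- For integers of fixed sum, `∑ κ_i² - E = ∑ (κ_i - a)(κ_i - a - 1)` is a sum of nonnegative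
terms, each vanishing only for `κ_i ∈ {a, a + 1}`. -/
theorem coeff_prod_sq_powers {m a E : ℕ} {S : ℤ} {κ : Fin m → ℤ} (hS : ∑ i, κ i = S)
    (hE : (E : ℤ) = (2 * a + 1) * S - m * (a * (a + 1))) :
    (∏ i, if 0 ≤ κ i then (Polynomial.X : Polynomial ℂ) ^ (κ i).toNat ^ 2 else 0).coeff E =
      if ∀ i, κ i = a ∨ κ i = a + 1 then 1 else 0 := by
  by_cases hneg : ∃ i, κ i < 0
  · obtain ⟨i, hi⟩ := hneg
    rw [Finset.prod_eq_zero (Finset.mem_univ i) (if_neg (not_le.mpr hi)), Polynomial.coeff_zero,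
      if_neg]
    intro h
    rcases h i with h | h <;> omega
  · push Not at hneg
    rw [Finset.prod_congr rfl fun i _ => if_pos (hneg i), Finset.prod_pow_eq_pow_sum,
      Polynomial.coeff_X_pow]
    have hsum : ((∑ i, (κ i).toNat ^ 2 : ℕ) : ℤ) - E = ∑ i, (κ i - a) * (κ i - a - 1) := by
      have h1 : ((∑ i, (κ i).toNat ^ 2 : ℕ) : ℤ) = ∑ i, κ i ^ 2 := by
        push_cast
        refine Finset.sum_congr rfl fun i _ => ?_
        rw [Int.toNat_of_nonneg (hneg i)]
      have h2 : ∀ i, (κ i - a) * (κ i - a - 1) =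
          κ i ^ 2 - (2 * a + 1) * κ i + a * (a + 1) := fun i => by ring
      simp only [h2, Finset.sum_add_distrib, Finset.sum_sub_distrib]
      rw [h1, hE, ← Finset.mul_sum, hS]
      simp
      ring
    have hnn : ∀ i ∈ Finset.univ, 0 ≤ (κ i - a) * (κ i - a - 1) := by
      intro i _
      rcases le_or_gt (κ i) a with h | h
      · exact mul_nonneg_of_nonpos_of_nonpos (by omega) (by omega)
      · exact mul_nonneg (by omega) (by omega)
    have hiff : (E = ∑ i, (κ i).toNat ^ 2) ↔ ∀ i, κ i = a ∨ κ i = a + 1 := by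
      have h3 := Finset.sum_eq_zero_iff_of_nonneg hnn
      rw [← hsum] at h3
      constructor
      · intro h i
        have := h3.mp (by rw [← h]; ring) i (Finset.mem_univ i)
        rcases mul_eq_zero.mp this with h | h <;> omega
      · intro h
        have := h3.mpr fun i _ => by
          rcases h i with h | h <;> rw [h] <;> ring
        omega
    exact if_congr hiff rfl rfl

/-- The self-dual partition whose parts are as equal as possible. -/
def balanced (n k : ℕ) (i : Fin (2 * n)) : ℕ := if (i : ℕ) < n then k - k / 2 else k / 2

theorem balanced_mem (n k : ℕ) : balanced n k ∈ selfDual (2 * n) (2 * n * k / 2) := by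
  have hadd : ∀ i, balanced n k i + balanced n k i.rev = k := by
    intro i
    simp only [balanced, Fin.val_rev]
    split_ifs <;> omega
  rw [mul_assoc, Nat.mul_div_cancel_left _ two_pos]
  refine mem_selfDual.mpr ⟨?_, ?_, ?_⟩
  · intro i j hij
    have := Fin.le_def.mp hij
    simp only [balanced]
    split_ifs <;> omega
  · have h3 : ∑ i : Fin (2 * n), balanced n k i.rev = ∑ i, balanced n k i :=
      Equiv.sum_comp Fin.revPerm (balanced n k)
    have h4 : ∑ i : Fin (2 * n), (balanced n k i + balanced n k i.rev) = 2 * n * k := by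
      rw [Finset.sum_congr rfl fun i _ => hadd i]
      simp
    rw [Finset.sum_add_distrib, h3] at h4
    have h5 : 2 * n * k = 2 * (n * k) := by ring
    omega
  · intro i
    rw [hadd]
    ring

theorem eq_balanced {n N : ℕ} {μ : Fin (2 * n) → ℕ}
    (hμ : μ ∈ selfDual (2 * n) (2 * n * (N - 2 * n) / 2))
    (h : ∀ i, μ i = (N - 2 * n) / 2 ∨ μ i = (N - 2 * n) / 2 + 1) : μ = balanced n (N - 2 * n) := by
  funext i
  have h1 := selfDual_add_rev hμ i
  have h2 := h i
  have h3 := h i.rev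
  have hr := Fin.val_rev i
  rw [balanced]
  split_ifs with hi
  · have := (mem_selfDual.mp hμ).1 (show i ≤ i.rev from Fin.le_def.mpr (by omega))
    omega
  · have := (mem_selfDual.mp hμ).1 (show i.rev ≤ i from Fin.le_def.mpr (by omega))
    omega

/-- For `i < j` the gap `j - i ≥ 1` and `μ_j ≤ μ_i` absorb the tolerance of `1`, so `σ i ≤ σ j`; a
monotone permutation is the identity. -/
theorem perm_eq_one_of_close {m : ℕ} {a : ℤ} {μ : Fin m → ℕ} (hμ : Antitone μ)
    {σ : Equiv.Perm (Fin m)}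
    (h : ∀ i, (μ i : ℤ) - (i : ℕ) + (σ i : ℕ) = a ∨ (μ i : ℤ) - (i : ℕ) + (σ i : ℕ) = a + 1) :
    σ = 1 := by
  rw [← Equiv.Perm.monotone_iff]
  intro i j hij
  rcases hij.lt_or_eq with hlt | rfl
  · have h1 := h i
    have h2 := h j
    have h3 := hμ hij
    have h4 := Fin.lt_def.mp hlt
    rw [Fin.le_def]
    omega
  · exact le_rfl

/-- Under `s_k ↦ X^{k²}` every term of a Schur determinant becomes a signed power of `X` or zero,
and the index sum is the same for all terms and all partitions of the given size. The least exponent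
`E` requires all indices to be `a` or `a + 1`, which leaves only the balanced partition and the
identity permutation. The coefficient of `X^E` is thus a product of values of `b`. -/
theorem tau_ne_zero {N : ℕ} (hN : 0 < N) {b : ℕ → ℂ} (hb : ∀ i, i < N / 2 → b i ≠ 0) {n : ℕ}
    (h2 : 2 * n ≤ N) : tau N b n ≠ 0 := by
  classical
  obtain ⟨φ, hφ⟩ := exists_algHom_elemSchur (A := Polynomial ℂ)
    (fun k => Polynomial.X ^ k ^ 2) (by simp)
  have hφ' : ∀ k : ℤ, φ (elemSchur k) =
      if 0 ≤ k then (Polynomial.X : Polynomial ℂ) ^ k.toNat ^ 2 else 0 := by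
    intro k
    split_ifs with hk
    · lift k to ℕ using hk
      rw [hφ, Int.toNat_natCast]
    · rw [elemSchur_of_neg (not_le.mp hk), map_zero]
  set Y := selfDual (2 * n) (2 * n * (N - 2 * n) / 2) with hY
  set a := (N - 2 * n) / 2 with ha
  set E := ∑ i, balanced n (N - 2 * n) i ^ 2 with hEdef
  set β : (Fin (2 * n) → ℕ) → ℂ := fun μ =>
    ∏ i : Fin n, b (μ ⟨i, fin_lt_two_mul i⟩ + 2 * n - ((i : ℕ) + 1) - (N + 1) / 2) with hβ
  have hmem : balanced n (N - 2 * n) ∈ Y := balanced_mem n (N - 2 * n)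
  have hclose : ∀ i, balanced n (N - 2 * n) i = a ∨ balanced n (N - 2 * n) i = a + 1 := by
    intro i
    simp only [balanced]
    split_ifs <;> omega
  have hE : (E : ℤ) = (2 * a + 1) * ((2 * n * (N - 2 * n) / 2 : ℕ) : ℤ) -
      (2 * n : ℕ) * (a * (a + 1)) := by
    have h1 : ∀ i, ((balanced n (N - 2 * n) i : ℕ) : ℤ) ^ 2 =
        (2 * a + 1) * (balanced n (N - 2 * n) i : ℕ) - a * (a + 1) := by
      intro i
      rcases hclose i with h | h <;> rw [h] <;> push_cast <;> ring
    rw [← (mem_selfDual.mp hmem).2.1, hEdef]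
    push_cast
    rw [Finset.sum_congr rfl fun i _ => h1 i, Finset.sum_sub_distrib, Finset.mul_sum]
    simp
  have hcoeff : ∀ μ ∈ Y, (φ (schur μ)).coeff E = ∑ σ : Equiv.Perm (Fin (2 * n)),
      ((Equiv.Perm.sign σ : ℤ) : ℂ) *
        if ∀ i, (μ i : ℤ) - (i : ℕ) + (σ i : ℕ) = a ∨ (μ i : ℤ) - (i : ℕ) + (σ i : ℕ) = a + 1
        then 1 else 0 := by
    intro μ hμ
    rw [schur, ← Matrix.det_transpose, Matrix.det_apply', map_sum, Polynomial.finsetSum_coeff]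
    refine Finset.sum_congr rfl fun σ _ => ?_
    have hS : ∑ i, ((μ i : ℤ) - (i : ℕ) + (σ i : ℕ)) = ((2 * n * (N - 2 * n) / 2 : ℕ) : ℤ) := by
      rw [Finset.sum_add_distrib, Finset.sum_sub_distrib,
        Equiv.sum_comp σ (fun i : Fin (2 * n) => ((i : ℕ) : ℤ)), sub_add_cancel,
        ← (mem_selfDual.mp hμ).2.1]
      push_cast
      rfl
    rw [← coeff_prod_sq_powers hS hE, map_mul, map_intCast, map_prod, Polynomial.coeff_intCast_mul]
    simp only [Matrix.transpose_apply, Matrix.of_apply, hφ']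
  have hone : ∀ μ ∈ Y, (φ (schur μ)).coeff E = if μ = balanced n (N - 2 * n) then 1 else 0 := by
    intro μ hμ
    rw [hcoeff μ hμ, Finset.sum_eq_single 1]
    · rw [Equiv.Perm.sign_one, Units.val_one, Int.cast_one, one_mul]
      refine if_congr ⟨fun h => eq_balanced hμ fun i => ?_, fun h i => ?_⟩ rfl rfl
      · have := h i
        rw [Equiv.Perm.one_apply] at this
        omega
      · have := hclose i
        rw [Equiv.Perm.one_apply, h]
        omega
    · intro σ _ hσ
      rw [if_neg, mul_zero]
      intro h
      exact hσ (perm_eq_one_of_close (mem_selfDual.mp hμ).1 h)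
    · simp
  intro h0
  have h3 := congrArg (fun p => (φ p).coeff E) (tau_eq_sum_schur hN b h2)
  simp only [h0, map_zero, map_sum, map_smul, Polynomial.coeff_zero, Polynomial.finsetSum_coeff,
    Polynomial.coeff_smul, smul_eq_mul] at h3
  rw [Finset.sum_congr rfl fun μ hμ => by rw [hone μ hμ], Finset.sum_eq_single_of_mem _ hmem,
    if_pos rfl, mul_one] at h3
  -- For the balanced partition the index of `b` in the factor `i` is `n - 1 - i`.
  · refine Finset.prod_ne_zero_iff.mpr (fun i _ => hb _ ?_) h3.symm
    have : balanced n (N - 2 * n) ⟨i, fin_lt_two_mul i⟩ = N - 2 * n - (N - 2 * n) / 2 :=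
      if_pos i.2
    rw [this]
    omega
  · intro μ _ hμ
    rw [if_neg hμ, mul_zero]

/-- The product of these finitely many τ-functions is a nonzero polynomial over an infinite field,
so it has a nonzero value. -/
theorem regularSet_nonempty {N : ℕ} (hN : 0 < N) {b : ℕ → ℂ} (hb : ∀ i, i < N / 2 → b i ≠ 0) :
    (regularSet N b).Nonempty := by
  have h : ∏ n ∈ Finset.range (N / 2 + 1), tau N b n ≠ 0 :=
    Finset.prod_ne_zero_iff.mpr fun n hn =>
      tau_ne_zero hN hb (by have := Finset.mem_range.mp hn; omega)
  by_contra hne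
  apply h
  apply MvPolynomial.funext
  intro t
  rw [map_zero, map_prod]
  by_contra ht
  apply hne
  refine ⟨t, fun n hn => ?_⟩
  exact Finset.prod_ne_zero_iff.mp ht n (Finset.mem_range.mpr (by omega))

/-! ### Lower triangular matrices with scalar `2 × 2` diagonal blocks -/

section LinearAlgebra

variable {N : ℕ}

/-- Lower triangular matrices with scalar `2 × 2` diagonal blocks. -/
structure IsScalarBlockLower (a : Matrix (Fin N) (Fin N) ℂ) : Prop where
  lower : ∀ i j : Fin N, (i : ℕ) < j → a i j = 0
  sub : ∀ i j : Fin N, (j : ℕ) % 2 = 0 → (i : ℕ) = j + 1 → a i j = 0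
  diag : ∀ i j : Fin N, (i : ℕ) % 2 = 0 → (j : ℕ) = i + 1 → a i i = a j j

theorem mul_apply_diag_of_lower {a c : Matrix (Fin N) (Fin N) ℂ}
    (ha : ∀ i j : Fin N, (i : ℕ) < j → a i j = 0) (hc : ∀ i j : Fin N, (i : ℕ) < j → c i j = 0)
    (i : Fin N) : (a * c) i i = a i i * c i i := by
  rw [Matrix.mul_apply, Finset.sum_eq_single i]
  · intro k _ hk
    rcases lt_or_gt_of_ne (fun h => hk (Fin.ext h) : (k : ℕ) ≠ i) with h | h
    · rw [hc k i h, mul_zero]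
    · rw [ha i k h, zero_mul]
  · simp

theorem mul_apply_sub_of_lower {a c : Matrix (Fin N) (Fin N) ℂ}
    (ha : ∀ i j : Fin N, (i : ℕ) < j → a i j = 0) (hc : ∀ i j : Fin N, (i : ℕ) < j → c i j = 0)
    {i j : Fin N} (hij : (i : ℕ) = j + 1) : (a * c) i j = a i i * c i j + a i j * c j j := by
  rw [Matrix.mul_apply, Finset.sum_eq_add i j]
  · intro h; rw [h] at hij; omega
  · intro k _ hk
    have h1 : (k : ℕ) ≠ i := fun h => hk.1 (Fin.ext h)
    have h2 : (k : ℕ) ≠ j := fun h => hk.2 (Fin.ext h)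
    rcases lt_or_gt_of_ne h1 with h | h
    · rw [hc k j (by omega), mul_zero]
    · rw [ha i k h, zero_mul]
  · simp
  · simp

theorem mul_lower {a c : Matrix (Fin N) (Fin N) ℂ}
    (ha : ∀ i j : Fin N, (i : ℕ) < j → a i j = 0) (hc : ∀ i j : Fin N, (i : ℕ) < j → c i j = 0)
    (i j : Fin N) (hij : (i : ℕ) < j) : (a * c) i j = 0 := by
  rw [Matrix.mul_apply]
  refine Finset.sum_eq_zero fun k _ => ?_
  rcases lt_or_ge (i : ℕ) k with h | h
  · rw [ha i k h, zero_mul]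
  · rw [hc k j (by omega), mul_zero]

theorem inv_lower {a : Matrix (Fin N) (Fin N) ℂ} (hdet : IsUnit a.det)
    (ha : ∀ i j : Fin N, (i : ℕ) < j → a i j = 0) (i j : Fin N) (hij : (i : ℕ) < j) :
    a⁻¹ i j = 0 := by
  let := Matrix.invertibleOfIsUnitDet a hdet
  have h : Matrix.BlockTriangular a OrderDual.toDual := fun i j hij => ha i j hij
  exact Matrix.blockTriangular_inv_of_blockTriangular h hij

theorem IsScalarBlockLower.mul {a c : Matrix (Fin N) (Fin N) ℂ} (ha : IsScalarBlockLower a)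
    (hc : IsScalarBlockLower c) : IsScalarBlockLower (a * c) where
  lower := mul_lower ha.lower hc.lower
  sub i j hj hij := by
    rw [mul_apply_sub_of_lower ha.lower hc.lower hij, ha.sub i j hj hij, hc.sub i j hj hij]
    ring
  diag i j hi hij := by
    rw [mul_apply_diag_of_lower ha.lower hc.lower, mul_apply_diag_of_lower ha.lower hc.lower,
      ha.diag i j hi hij, hc.diag i j hi hij]

theorem diag_mul_inv_diag {a : Matrix (Fin N) (Fin N) ℂ} (hdet : IsUnit a.det)
    (ha : ∀ i j : Fin N, (i : ℕ) < j → a i j = 0) (i : Fin N) : a i i * a⁻¹ i i = 1 := by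
  rw [← mul_apply_diag_of_lower ha (inv_lower hdet ha), Matrix.mul_nonsing_inv _ hdet,
    Matrix.one_apply_eq]

theorem sub_mul_inv_sub {a : Matrix (Fin N) (Fin N) ℂ} (hdet : IsUnit a.det)
    (ha : ∀ i j : Fin N, (i : ℕ) < j → a i j = 0) {i j : Fin N} (hij : (i : ℕ) = j + 1) :
    a i i * a⁻¹ i j + a i j * a⁻¹ j j = 0 := by
  rw [← mul_apply_sub_of_lower ha (inv_lower hdet ha) hij, Matrix.mul_nonsing_inv _ hdet,
    Matrix.one_apply_ne]
  intro h; rw [h] at hij; omega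

theorem IsScalarBlockLower.inv {a : Matrix (Fin N) (Fin N) ℂ} (ha : IsScalarBlockLower a)
    (hdet : IsUnit a.det) : IsScalarBlockLower a⁻¹ where
  lower := inv_lower hdet ha.lower
  sub i j hj hij := by
    have h1 := sub_mul_inv_sub hdet ha.lower hij
    have h2 := diag_mul_inv_diag hdet ha.lower i
    rw [ha.sub i j hj hij, zero_mul, add_zero] at h1
    exact (mul_eq_zero.mp h1).resolve_left (left_ne_zero_of_mul_eq_one h2)
  diag i j hi hij := by
    have h1 := diag_mul_inv_diag hdet ha.lower i
    have h2 := diag_mul_inv_diag hdet ha.lower j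
    rw [ha.diag i j hi hij] at h1
    exact mul_left_cancel₀ (left_ne_zero_of_mul_eq_one h2) (h1.trans h2.symm)

/-! ### Multiplication by `J` -/

theorem mul_skewJ_even (Y : Matrix (Fin N) (Fin N) ℂ) (i : Fin N) {j j' : Fin N}
    (hj : (j : ℕ) % 2 = 0) (hj' : (j' : ℕ) = j + 1) : (Y * skewJ N) i j = -Y i j' := by
  rw [Matrix.mul_apply, Finset.sum_eq_single j']
  · rw [skewJ, Matrix.of_apply, if_neg (by omega), if_pos ⟨hj, hj'⟩, mul_neg_one]
  · intro k _ hk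
    have h1 : (k : ℕ) ≠ j' := fun h => hk (Fin.ext h)
    rw [skewJ, Matrix.of_apply, if_neg (by omega), if_neg (by omega), mul_zero]
  · simp

theorem mul_skewJ_odd (Y : Matrix (Fin N) (Fin N) ℂ) (i : Fin N) {j j' : Fin N}
    (hj : (j : ℕ) % 2 = 0) (hj' : (j' : ℕ) = j + 1) : (Y * skewJ N) i j' = Y i j := by
  rw [Matrix.mul_apply, Finset.sum_eq_single j]
  · rw [skewJ, Matrix.of_apply, if_pos ⟨hj, hj'⟩, mul_one]
  · intro k _ hk
    have h1 : (k : ℕ) ≠ j := fun h => hk (Fin.ext h)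
    rw [skewJ, Matrix.of_apply, if_neg (by omega), if_neg (by omega), mul_zero]
  · simp

theorem mul_skewJ_last (Y : Matrix (Fin N) (Fin N) ℂ) (i : Fin N) {j : Fin N}
    (hj : (j : ℕ) % 2 = 0) (hj' : (j : ℕ) + 1 = N) : (Y * skewJ N) i j = 0 := by
  rw [Matrix.mul_apply]
  refine Finset.sum_eq_zero fun k _ => ?_
  have := k.2
  rw [skewJ, Matrix.of_apply, if_neg (by omega), if_neg (by omega), mul_zero]

theorem skewJ_transpose (N : ℕ) : (skewJ N).transpose = -skewJ N := by
  ext i j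
  simp only [skewJ, Matrix.transpose_apply, Matrix.of_apply, Matrix.neg_apply]
  split_ifs <;> first | omega | simp

theorem skewJ_mul_eq (Y : Matrix (Fin N) (Fin N) ℂ) (i j : Fin N) :
    (skewJ N * Y) i j = -(Y.transpose * skewJ N) j i := by
  have h : (Y.transpose * skewJ N).transpose = -(skewJ N * Y) := by
    rw [Matrix.transpose_mul, skewJ_transpose, Matrix.transpose_transpose, Matrix.neg_mul]
  have := congrFun (congrFun h i) j
  rw [Matrix.transpose_apply, Matrix.neg_apply] at this
  rw [this, neg_neg]

theorem skewJ_mul_even (Y : Matrix (Fin N) (Fin N) ℂ) (j : Fin N) {i i' : Fin N}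
    (hi : (i : ℕ) % 2 = 0) (hi' : (i' : ℕ) = i + 1) : (skewJ N * Y) i j = Y i' j := by
  rw [skewJ_mul_eq, mul_skewJ_even _ _ hi hi', neg_neg, Matrix.transpose_apply]

theorem skewJ_mul_odd (Y : Matrix (Fin N) (Fin N) ℂ) (j : Fin N) {i i' : Fin N}
    (hi : (i : ℕ) % 2 = 0) (hi' : (i' : ℕ) = i + 1) : (skewJ N * Y) i' j = -Y i j := by
  rw [skewJ_mul_eq, mul_skewJ_odd _ _ hi hi', Matrix.transpose_apply]

theorem skewJ_mul_last (Y : Matrix (Fin N) (Fin N) ℂ) (j : Fin N) {i : Fin N}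
    (hi : (i : ℕ) % 2 = 0) (hi' : (i : ℕ) + 1 = N) : (skewJ N * Y) i j = 0 := by
  rw [skewJ_mul_eq, mul_skewJ_last _ _ hi hi', neg_zero]

theorem block_cases (i : Fin N) :
    (∃ i' : Fin N, (i : ℕ) % 2 = 0 ∧ (i' : ℕ) = i + 1) ∨
      (∃ i' : Fin N, (i' : ℕ) % 2 = 0 ∧ (i : ℕ) = i' + 1) ∨
        ((i : ℕ) % 2 = 0 ∧ (i : ℕ) + 1 = N) := by
  by_cases h : (i : ℕ) % 2 = 0
  · by_cases h' : (i : ℕ) + 1 = N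
    · exact Or.inr (Or.inr ⟨h, h'⟩)
    · exact Or.inl ⟨⟨i + 1, by omega⟩, h, rfl⟩
  · exact Or.inr (Or.inl ⟨⟨i - 1, by omega⟩, by simp only; omega, by simp only; omega⟩)

/-- A matrix of scalar block lower triangular form is determined by the skew symmetry of its sum
with a given matrix. -/
theorem eq_neg_projK {X Z : Matrix (Fin N) (Fin N) ℂ} (hX : IsScalarBlockLower X)
    (hsym : ∀ i j, ((X + Z) * skewJ N) i j = ((X + Z) * skewJ N) j i)
    (hlast : ∀ i : Fin N, (i : ℕ) % 2 = 0 → (i : ℕ) + 1 = N → X i i = -(1 / 2) * Z i i) :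
    X = -projK Z := by
  ext i j
  simp only [projK, Matrix.neg_apply, Matrix.add_apply, Matrix.sub_apply, Matrix.smul_apply,
    smul_eq_mul]
  have hlow := hX.lower
  -- Each index is the first or the second of a 2×2 block or forms the last 1×1 block. Below the
  -- blocks, the symmetry relates the entry `(i, j)` to one above them (or to `0` from the last
  -- row), where `X` vanishes. In a 2×2 block, it makes the trace of `X + Z` zero and thus fixes the
  -- scalar.
  rcases block_cases i with ⟨i', hi, hi'⟩ | ⟨i', hi, hi'⟩ | ⟨hi, hi'⟩ <;>
    rcases block_cases j with ⟨j', hj, hj'⟩ | ⟨j', hj, hj'⟩ | ⟨hj, hj'⟩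
  · rw [mul_skewJ_even _ _ hj hj', mul_skewJ_even _ _ hj hj', skewJ_mul_even _ _ hi hi',
      skewJ_mul_even _ _ hi hi']
    simp only [Matrix.transpose_apply, lowerPart, upperPart, blockPart, Matrix.of_apply]
    have hs := hsym i j'
    rw [mul_skewJ_odd _ _ hj hj', mul_skewJ_even _ _ hi hi', Matrix.add_apply,
      Matrix.add_apply] at hs
    rcases lt_trichotomy ((i : ℕ) / 2) ((j : ℕ) / 2) with h | h | h
    · rw [if_neg (by omega), if_neg (by omega), if_neg (by omega), if_neg (by omega),
        hlow i j (by omega)]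
      ring
    · obtain rfl : i = j := Fin.ext (by omega)
      obtain rfl : i' = j' := Fin.ext (by omega)
      rw [if_neg (by omega), if_neg (by omega), if_pos rfl, if_pos rfl]
      rw [← hX.diag i i' hi hi'] at hs
      linear_combination hs / 2
    · rw [if_pos (by omega), if_pos (by omega), if_neg (by omega), if_neg (by omega)]
      rw [hlow j' i' (by omega)] at hs
      linear_combination hs
  · rw [mul_skewJ_odd _ _ hj hj', mul_skewJ_odd _ _ hj hj', skewJ_mul_even _ _ hi hi',
      skewJ_mul_even _ _ hi hi']
    simp only [Matrix.transpose_apply, lowerPart, upperPart, blockPart, Matrix.of_apply]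
    have hs := hsym i j'
    rw [mul_skewJ_even _ _ hj hj', mul_skewJ_even _ _ hi hi', Matrix.add_apply,
      Matrix.add_apply] at hs
    rcases lt_trichotomy ((i : ℕ) / 2) ((j : ℕ) / 2) with h | h | h
    · rw [if_neg (by omega), if_neg (by omega), if_neg (by omega), if_neg (by omega),
        hlow i j (by omega)]
      ring
    · obtain rfl : i = j' := Fin.ext (by omega)
      obtain rfl : i' = j := Fin.ext (by omega)
      rw [if_neg (by omega), if_neg (by omega), if_pos h, hlow i i' (by omega)]
      ring
    · rw [if_pos (by omega), if_pos (by omega), if_neg (by omega), if_neg (by omega)]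
      rw [hlow j' i' (by omega)] at hs
      linear_combination -hs
  · rw [mul_skewJ_last _ _ hj hj', mul_skewJ_last _ _ hj hj']
    simp only [lowerPart, blockPart, Matrix.of_apply]
    rw [if_neg (by omega), if_neg (by omega), hlow i j (by omega)]
    ring
  · rw [mul_skewJ_even _ _ hj hj', mul_skewJ_even _ _ hj hj', skewJ_mul_odd _ _ hi hi',
      skewJ_mul_odd _ _ hi hi']
    simp only [Matrix.transpose_apply, lowerPart, upperPart, blockPart, Matrix.of_apply]
    have hs := hsym i j'
    rw [mul_skewJ_odd _ _ hj hj', mul_skewJ_odd _ _ hi hi', Matrix.add_apply,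
      Matrix.add_apply] at hs
    rcases lt_trichotomy ((i : ℕ) / 2) ((j : ℕ) / 2) with h | h | h
    · rw [if_neg (by omega), if_neg (by omega), if_neg (by omega), if_neg (by omega),
        hlow i j (by omega)]
      ring
    · obtain rfl : i' = j := Fin.ext (by omega)
      obtain rfl : i = j' := Fin.ext (by omega)
      rw [if_neg (by omega), if_neg (by omega), if_pos h, hX.sub i i' hi hi']
      ring
    · rw [if_pos (by omega), if_pos (by omega), if_neg (by omega), if_neg (by omega)]
      rw [hlow j' i' (by omega)] at hs
      linear_combination hs
  · rw [mul_skewJ_odd _ _ hj hj', mul_skewJ_odd _ _ hj hj', skewJ_mul_odd _ _ hi hi',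
      skewJ_mul_odd _ _ hi hi']
    simp only [Matrix.transpose_apply, lowerPart, upperPart, blockPart, Matrix.of_apply]
    have hs := hsym i j'
    rw [mul_skewJ_even _ _ hj hj', mul_skewJ_odd _ _ hi hi', Matrix.add_apply,
      Matrix.add_apply] at hs
    rcases lt_trichotomy ((i : ℕ) / 2) ((j : ℕ) / 2) with h | h | h
    · rw [if_neg (by omega), if_neg (by omega), if_neg (by omega), if_neg (by omega),
        hlow i j (by omega)]
      ring
    · obtain rfl : i = j := Fin.ext (by omega)
      obtain rfl : i' = j' := Fin.ext (by omega)
      rw [if_neg (by omega), if_neg (by omega), if_pos rfl, if_pos rfl]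
      rw [hX.diag i' i hi hi'] at hs
      linear_combination -hs / 2
    · rw [if_pos (by omega), if_pos (by omega), if_neg (by omega), if_neg (by omega)]
      rw [hlow j' i' (by omega)] at hs
      linear_combination -hs
  · rw [mul_skewJ_last _ _ hj hj', mul_skewJ_last _ _ hj hj']
    simp only [lowerPart, blockPart, Matrix.of_apply]
    rw [if_neg (by omega), if_neg (by omega), hlow i j (by omega)]
    ring
  · rw [Matrix.mul_assoc, Matrix.mul_assoc, skewJ_mul_last _ _ hi hi', skewJ_mul_last _ _ hi hi']
    simp only [lowerPart, blockPart, Matrix.of_apply]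
    have hs := hsym i j'
    rw [mul_skewJ_odd _ _ hj hj', mul_skewJ_last _ _ hi hi', Matrix.add_apply] at hs
    rw [if_pos (by omega), if_neg (by omega)]
    linear_combination hs
  · rw [Matrix.mul_assoc, Matrix.mul_assoc, skewJ_mul_last _ _ hi hi', skewJ_mul_last _ _ hi hi']
    simp only [lowerPart, blockPart, Matrix.of_apply]
    have hs := hsym i j'
    rw [mul_skewJ_even _ _ hj hj', mul_skewJ_last _ _ hi hi', Matrix.add_apply] at hs
    rw [if_pos (by omega), if_neg (by omega)]
    linear_combination -hs
  -- `J` vanishes on the last 1×1 block, so the symmetry is silent here and `hlast` supplies the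
  -- value.
  · obtain rfl : i = j := Fin.ext (by omega)
    rw [mul_skewJ_last _ _ hj hj', mul_skewJ_last _ _ hj hj', hlast i hi hi']
    simp only [lowerPart, blockPart, Matrix.of_apply]
    rw [if_neg (by omega), if_pos trivial]
    ring

/-- A scalar block lower triangular matrix that preserves `J` is diagonal. -/
theorem eq_zero_of_mul_skewJ_mul_transpose {R : Matrix (Fin N) (Fin N) ℂ}
    (hR : IsScalarBlockLower R) (hdet : IsUnit R.det)
    (h : R * skewJ N * R.transpose = skewJ N) {i j : Fin N} (hij : i ≠ j) : R i j = 0 := by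
  have hinv := hR.inv hdet
  -- The left side is block lower triangular and the right side block upper triangular, so nothing
  -- survives off the blocks.
  have hRJ : R * skewJ N = skewJ N * R⁻¹.transpose := by
    have hT : R.transpose * R⁻¹.transpose = 1 := by
      rw [← Matrix.transpose_mul, Matrix.nonsing_inv_mul _ hdet, Matrix.transpose_one]
    conv_rhs => rw [← h]
    rw [Matrix.mul_assoc, hT, Matrix.mul_one]
  rcases lt_or_ge (i : ℕ) j with hlt | hge
  · exact hR.lower i j hlt
  have hne : (i : ℕ) ≠ j := fun e => hij (Fin.ext e)
  rcases block_cases j with ⟨j', hj, hj'⟩ | ⟨j', hj, hj'⟩ | ⟨hj, hj'⟩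
  · by_cases hb : (i : ℕ) = j + 1
    · exact hR.sub i j hj hb
    have hs := congrFun (congrFun hRJ i) j'
    rw [mul_skewJ_odd _ _ hj hj'] at hs
    rcases block_cases i with ⟨i', hi, hi'⟩ | ⟨i', hi, hi'⟩ | ⟨hi, hi'⟩
    · rw [hs, skewJ_mul_even _ _ hi hi', Matrix.transpose_apply, hinv.lower j' i' (by omega)]
    · rw [hs, skewJ_mul_odd _ _ hi hi', Matrix.transpose_apply, hinv.lower j' i' (by omega),
        neg_zero]
    · rw [hs, skewJ_mul_last _ _ hi hi']
  · have hs := congrFun (congrFun hRJ i) j'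
    rw [mul_skewJ_even _ _ hj hj'] at hs
    rcases block_cases i with ⟨i', hi, hi'⟩ | ⟨i', hi, hi'⟩ | ⟨hi, hi'⟩
    · rw [skewJ_mul_even _ _ hi hi', Matrix.transpose_apply, hinv.lower j' i' (by omega)] at hs
      exact neg_eq_zero.mp hs
    · rw [skewJ_mul_odd _ _ hi hi', Matrix.transpose_apply, hinv.lower j' i' (by omega),
        neg_zero] at hs
      exact neg_eq_zero.mp hs
    · rw [skewJ_mul_last _ _ hi hi'] at hs
      exact neg_eq_zero.mp hs
  · have := i.2
    omega

theorem diag_eq_one_or_neg_one {R : Matrix (Fin N) (Fin N) ℂ}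
    (hR : IsScalarBlockLower R) (hdet : IsUnit R.det)
    (h : R * skewJ N * R.transpose = skewJ N) {i j : Fin N} (hi : (i : ℕ) % 2 = 0)
    (hj : (j : ℕ) = i + 1) : R i i = 1 ∨ R i i = -1 := by
  have hs := congrFun (congrFun h i) j
  rw [Matrix.mul_apply, Finset.sum_eq_single j] at hs
  · rw [mul_skewJ_odd _ _ hi hj, Matrix.transpose_apply, ← hR.diag i j hi hj] at hs
    have h1 : skewJ N i j = 1 := if_pos ⟨hi, hj⟩
    rw [h1] at hs
    exact mul_self_eq_one_iff.mp hs
  · intro k _ hk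
    rw [Matrix.transpose_apply, eq_zero_of_mul_skewJ_mul_transpose hR hdet h hk.symm, mul_zero]
  · simp

/-! ### Lax matrices -/

theorem mul_shiftMat_succ (Q : Matrix (Fin N) (Fin N) ℂ) (i : Fin N) {j j' : Fin N}
    (hj : (j' : ℕ) = j + 1) : (Q * shiftMat ℂ N) i j' = Q i j := by
  rw [Matrix.mul_apply, Finset.sum_eq_single j]
  · rw [shiftMat, Matrix.of_apply, if_pos hj.symm, mul_one]
  · intro k _ hk
    have : (k : ℕ) ≠ j := fun h => hk (Fin.ext h)
    rw [shiftMat, Matrix.of_apply, if_neg (by omega), mul_zero]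
  · simp

theorem mul_shiftMat_zero (Q : Matrix (Fin N) (Fin N) ℂ) (i : Fin N) {j : Fin N}
    (hj : (j : ℕ) = 0) : (Q * shiftMat ℂ N) i j = 0 := by
  rw [Matrix.mul_apply]
  refine Finset.sum_eq_zero fun k _ => ?_
  rw [shiftMat, Matrix.of_apply, if_neg (by omega), mul_zero]

theorem mul_shiftMat_of_lt {Q : Matrix (Fin N) (Fin N) ℂ}
    (hQ : ∀ i j : Fin N, (i : ℕ) < j → Q i j = 0) {i j : Fin N} (hij : (i : ℕ) + 1 < j) :
    (Q * shiftMat ℂ N) i j = 0 := by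
  rw [mul_shiftMat_succ Q i (j := ⟨j - 1, by omega⟩) (by simp only; omega)]
  exact hQ _ _ (by simp only; omega)

/-- The diagonal entry `i` is `Q_{i,i-1} Q⁻¹_{ii} + Q_{ii} Q⁻¹_{i+1,i}`, with missing indices read
as zero. Inside a block the subdiagonal entries vanish, so odd `i` keeps only the second term and
even `i` only the first. For consecutive odd and even indices these are opposite because the
subdiagonal of `Q Q⁻¹` is zero. Scalar blocks give the superdiagonal entries `1`. -/
theorem isPfaffForm_conj {Q : Matrix (Fin N) (Fin N) ℂ} (hQ : IsScalarBlockLower Q)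
    (hdet : IsUnit Q.det) : IsPfaffForm (Q * shiftMat ℂ N * Q⁻¹) := by
  have hinv := hQ.inv hdet
  have hdiag : ∀ i, Q i i * Q⁻¹ i i = 1 := diag_mul_inv_diag hdet hQ.lower
  have happly : ∀ i j, (Q * shiftMat ℂ N * Q⁻¹) i j =
      ∑ k, (Q * shiftMat ℂ N) i k * Q⁻¹ k j := fun i j => Matrix.mul_apply
  have hterm : ∀ i j k : Fin N, ((k : ℕ) < j ∨ (i : ℕ) + 1 < k) →
      (Q * shiftMat ℂ N) i k * Q⁻¹ k j = 0 := by
    rintro i j k (h | h)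
    · rw [hinv.lower k j h, mul_zero]
    · rw [mul_shiftMat_of_lt hQ.lower h, zero_mul]
  have hdiag2 : ∀ i j : Fin N, (j : ℕ) = i + 1 → (Q * shiftMat ℂ N * Q⁻¹) i i =
      (Q * shiftMat ℂ N) i i * Q⁻¹ i i + Q i i * Q⁻¹ j i := by
    intro i j hij
    rw [happly, Finset.sum_eq_add i j, mul_shiftMat_succ Q i hij]
    · intro h; rw [h] at hij; omega
    · intro k _ hk
      have h1 : (k : ℕ) ≠ i := fun h => hk.1 (Fin.ext h)
      have h2 : (k : ℕ) ≠ j := fun h => hk.2 (Fin.ext h)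
      exact hterm i i k (by omega)
    · simp
    · simp
  have hdiag1 : ∀ i : Fin N, (i : ℕ) + 1 = N → (Q * shiftMat ℂ N * Q⁻¹) i i =
      (Q * shiftMat ℂ N) i i * Q⁻¹ i i := by
    intro i hi
    rw [happly, Finset.sum_eq_single i]
    · intro k _ hk
      have h1 : (k : ℕ) ≠ i := fun h => hk (Fin.ext h)
      have := k.2
      exact hterm i i k (by omega)
    · simp
  constructor
  · intro i j hij
    rw [happly]
    exact Finset.sum_eq_zero fun k _ => hterm i j k (by omega)
  · intro i j hi hij
    rw [happly, Finset.sum_eq_single j, mul_shiftMat_succ Q i hij, hQ.diag i j hi hij, hdiag]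
    · intro k _ hk
      have h1 : (k : ℕ) ≠ j := fun h => hk (Fin.ext h)
      exact hterm i j k (by omega)
    · simp
  · intro i hi
    by_cases h : (i : ℕ) + 1 = N
    · rw [hdiag1 i h, mul_shiftMat_zero Q i hi, zero_mul]
    · rw [hdiag2 i ⟨i + 1, by omega⟩ rfl, mul_shiftMat_zero Q i hi,
        hinv.sub ⟨i + 1, by omega⟩ i (by omega) rfl]
      ring
  · intro i j hi hij
    obtain ⟨e, he⟩ : ∃ e : Fin N, (i : ℕ) = e + 1 := ⟨⟨i - 1, by omega⟩, by simp only; omega⟩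
    have h1 : (Q * shiftMat ℂ N) i i = 0 := by
      rw [mul_shiftMat_succ Q i he, hQ.sub i e (by omega) he]
    have h2 := sub_mul_inv_sub hdet hQ.lower hij
    have h3 : (Q * shiftMat ℂ N * Q⁻¹) j j = Q j i * Q⁻¹ j j := by
      by_cases h : (j : ℕ) + 1 = N
      · rw [hdiag1 j h, mul_shiftMat_succ Q j hij]
      · rw [hdiag2 j ⟨j + 1, by omega⟩ rfl, mul_shiftMat_succ Q j hij,
          hinv.sub ⟨j + 1, by omega⟩ j (by omega) rfl]
        ring
    rw [hdiag2 i j hij, h1, h3]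
    have h4 := hdiag i
    have h5 := hdiag j
    linear_combination (-Q i i * Q⁻¹ j i) * h5 + (-Q j i * Q⁻¹ j j) * h4 +
      Q i i * Q⁻¹ j j * h2
  · intro i hN hi
    obtain ⟨e, he⟩ : ∃ e : Fin N, (i : ℕ) = e + 1 := ⟨⟨i - 1, by omega⟩, by simp only; omega⟩
    rw [hdiag1 i hi, mul_shiftMat_succ Q i he, hQ.sub i e (by omega) he, zero_mul]

theorem conj_pow {Q : Matrix (Fin N) (Fin N) ℂ} (hdet : IsUnit Q.det)
    (Z : Matrix (Fin N) (Fin N) ℂ) (k : ℕ) : (Q * Z * Q⁻¹) ^ k = Q * Z ^ k * Q⁻¹ := by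
  induction k with
  | zero => rw [pow_zero, pow_zero, Matrix.mul_one, Matrix.mul_nonsing_inv _ hdet]
  | succ k ih =>
    rw [pow_succ, ih, pow_succ]
    simp only [Matrix.mul_assoc]
    rw [Matrix.nonsing_inv_mul_cancel_left _ _ hdet]

/-- Conjugates of positive powers of `Λ` are traceless; this fixes the last diagonal entry for odd
`N`. -/
theorem trace_conj_shiftMat_pow {Q : Matrix (Fin N) (Fin N) ℂ} (hdet : IsUnit Q.det)
    (k : ℕ+) : ((Q * shiftMat ℂ N * Q⁻¹) ^ (k : ℕ)).trace = 0 := by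
  rw [conj_pow hdet, Matrix.trace_mul_comm, Matrix.nonsing_inv_mul_cancel_left _ _ hdet,
    Matrix.trace]
  refine Finset.sum_eq_zero fun i _ => ?_
  have := k.pos
  rw [Matrix.diag_apply, shiftMat_pow_apply, if_neg (by omega)]

end LinearAlgebra

/-! ### The matrix of coefficients of the skew-orthonormal polynomials -/

section Pointwise

variable {N : ℕ} {b : ℕ → ℂ} {r : ℕ → (ℕ+ → ℂ) → ℂ} {t : ℕ+ → ℂ}

theorem QTildeAt_self (b : ℕ → ℂ) (t : ℕ+ → ℂ) (i : Fin N) :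
    QTildeAt N b t i i = eval t (tau N b ((i : ℕ) / 2)) := by
  rw [QTildeAt, Matrix.map_apply, QTilde_apply, qCoeff_self]

theorem isScalarBlockLower_QTildeAt (N : ℕ) (b : ℕ → ℂ) (t : ℕ+ → ℂ) :
    IsScalarBlockLower (QTildeAt N b t) where
  lower i j h := by rw [QTildeAt, Matrix.map_apply, QTilde_of_lt b h, map_zero]
  sub i j hj hij := by
    have h : (j : ℕ) = 2 * (j / 2) := by omega
    rw [QTildeAt, Matrix.map_apply, QTilde_apply, hij, h, qCoeff_odd_pred, map_zero]
  diag i j hi hij := by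
    have h : (j : ℕ) / 2 = (i : ℕ) / 2 := by omega
    rw [QTildeAt_self, QTildeAt_self, h]

theorem eval_tau_ne_zero (ht : t ∈ regularSet N b) (i : Fin N) :
    eval t (tau N b ((i : ℕ) / 2)) ≠ 0 :=
  ht _ (by omega)

theorem det_QTildeAt_ne_zero (ht : t ∈ regularSet N b) : (QTildeAt N b t).det ≠ 0 := by
  rw [Matrix.det_of_isLowerTriangular _ fun i j h => (isScalarBlockLower_QTildeAt N b t).lower i j h]
  refine Finset.prod_ne_zero_iff.mpr fun i _ => ?_
  rw [QTildeAt_self]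
  exact eval_tau_ne_zero ht i

/-- Cramer's rule, with denominator `det Q̃`; this is a product of τ-functions and has no zeros on
the generic locus. -/
theorem LTilde_eq_smul (N : ℕ) (b : ℕ → ℂ) (t : ℕ+ → ℂ) :
    LTilde N b t = (eval t (QTilde N b).det)⁻¹ •
      (QTilde N b * shiftMat TPoly N * (QTilde N b).adjugate).map (eval t) := by
  have hS : (shiftMat TPoly N).map (eval t) = shiftMat ℂ N := by
    ext i j
    simp only [shiftMat, Matrix.map_apply, Matrix.of_apply]
    split_ifs <;> simp
  have hadj : (QTilde N b).adjugate.map (eval t) = (QTildeAt N b t).adjugate :=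
    RingHom.map_adjugate (eval t) (QTilde N b)
  have hdet : eval t (QTilde N b).det = (QTildeAt N b t).det :=
    RingHom.map_det (eval t) (QTilde N b)
  rw [Matrix.map_mul, Matrix.map_mul, hS, hadj, hdet, LTilde, Matrix.inv_def, Ring.inverse_eq_inv',
    Matrix.mul_smul]
  rfl

theorem eval_det_QTilde_ne_zero (ht : t ∈ regularSet N b) : eval t (QTilde N b).det ≠ 0 := by
  have hdet : eval t (QTilde N b).det = (QTildeAt N b t).det :=
    RingHom.map_det (eval t) (QTilde N b)
  rw [hdet]
  exact det_QTildeAt_ne_zero ht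

theorem eval_radicand_ne_zero (ht : t ∈ regularSet N b) {n : ℕ} (hn : 2 * n < N) :
    eval t (radicand N b n) ≠ 0 := by
  rw [radicand]
  split_ifs with h
  · rw [map_mul]
    exact mul_ne_zero (ht n (by omega)) (ht (n + 1) (by omega))
  · exact ht n (by omega)

theorem root_ne_zero (ht : t ∈ regularSet N b)
    (hr : ∀ n, 2 * n < N → r n t ^ 2 = eval t (radicand N b n)) {n : ℕ} (hn : 2 * n < N) :
    r n t ≠ 0 := by
  intro h
  apply eval_radicand_ne_zero ht hn
  rw [← hr n hn, h, zero_pow two_ne_zero]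

theorem det_diagD_ne_zero (ht : t ∈ regularSet N b)
    (hr : ∀ n, 2 * n < N → r n t ^ 2 = eval t (radicand N b n)) : (diagD N r t).det ≠ 0 := by
  rw [diagD, Matrix.det_diagonal]
  exact Finset.prod_ne_zero_iff.mpr fun i _ => inv_ne_zero (root_ne_zero ht hr (by omega))

/-- The coefficient matrix `D(t) Q̃(t)` of the polynomials `q_k`. -/
def qMat (N : ℕ) (b : ℕ → ℂ) (r : ℕ → (ℕ+ → ℂ) → ℂ) (t : ℕ+ → ℂ) : Matrix (Fin N) (Fin N) ℂ :=
  diagD N r t * QTildeAt N b t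

theorem qMat_apply (N : ℕ) (b : ℕ → ℂ) (r : ℕ → (ℕ+ → ℂ) → ℂ) (t : ℕ+ → ℂ) (k j : Fin N) :
    qMat N b r t k j = (r ((k : ℕ) / 2) t)⁻¹ * QTildeAt N b t k j := by
  rw [qMat, diagD, Matrix.diagonal_mul]

theorem isScalarBlockLower_qMat (N : ℕ) (b : ℕ → ℂ) (r : ℕ → (ℕ+ → ℂ) → ℂ) (t : ℕ+ → ℂ) :
    IsScalarBlockLower (qMat N b r t) := by
  refine IsScalarBlockLower.mul ⟨?_, ?_, ?_⟩ (isScalarBlockLower_QTildeAt N b t)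
  · intro i j h
    exact Matrix.diagonal_apply_ne _ fun e => by rw [e] at h; omega
  · intro i j _ h
    exact Matrix.diagonal_apply_ne _ fun e => by rw [e] at h; omega
  · intro i j hi hij
    have h : (j : ℕ) / 2 = (i : ℕ) / 2 := by omega
    rw [diagD, Matrix.diagonal_apply_eq, Matrix.diagonal_apply_eq, h]

theorem isUnit_det_qMat (ht : t ∈ regularSet N b)
    (hr : ∀ n, 2 * n < N → r n t ^ 2 = eval t (radicand N b n)) : IsUnit (qMat N b r t).det := by
  rw [qMat, Matrix.det_mul]
  exact (mul_ne_zero (det_diagD_ne_zero ht hr) (det_QTildeAt_ne_zero ht)).isUnit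

theorem laxL_eq_conj (N : ℕ) (b : ℕ → ℂ) (r : ℕ → (ℕ+ → ℂ) → ℂ) (t : ℕ+ → ℂ) :
    laxL N b r t = qMat N b r t * shiftMat ℂ N * (qMat N b r t)⁻¹ := by
  rw [laxL, LTilde, qMat, Matrix.mul_inv_rev]
  simp only [Matrix.mul_assoc]

theorem diagD_inv_mul_laxL_mul_diagD (ht : t ∈ regularSet N b)
    (hr : ∀ n, 2 * n < N → r n t ^ 2 = eval t (radicand N b n)) :
    (diagD N r t)⁻¹ * laxL N b r t * diagD N r t = LTilde N b t := by
  have h := (det_diagD_ne_zero ht hr).isUnit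
  rw [laxL]
  simp only [Matrix.mul_assoc]
  rw [Matrix.nonsing_inv_mul _ h, Matrix.mul_one, Matrix.nonsing_inv_mul_cancel_left _ _ h]

/-- The only nonzero pairings of the `q̃_k` are `±τ_{2n} τ_{2n+2} = ±ρ_n`, and `D` divides each of
them by `√ρ_n` twice. For odd `N` the last radicand plays no role, as `q̃_{N-1}` pairs to zero with
all the others. -/
theorem qMat_mul_momentAt_mul_transpose (ht : t ∈ regularSet N b)
    (hr : ∀ n, 2 * n < N → r n t ^ 2 = eval t (radicand N b n)) :
    qMat N b r t * momentAt N b t * (qMat N b r t).transpose = skewJ N := by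
  have hQ : ∀ k l : Fin N, (QTildeAt N b t * momentAt N b t * (QTildeAt N b t).transpose) k l =
      eval t (qPairing N b k l) := by
    intro k l
    rw [← QTilde_mul_moment_mul_transpose, QTildeAt, momentAt, ← Matrix.map_mul,
      ← Matrix.transpose_map, ← Matrix.map_mul, Matrix.map_apply]
  have hsq : ∀ n, 2 * n + 2 ≤ N → (r n t)⁻¹ * (r n t)⁻¹ *
      (eval t (tau N b n) * eval t (tau N b (n + 1))) = 1 := by
    intro n hn
    have h0 := root_ne_zero ht hr (n := n) (by omega)
    have h := hr n (by omega)
    rw [radicand, if_pos hn, map_mul] at h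
    rw [← h]
    field_simp
  have hD : (diagD N r t).transpose = diagD N r t := Matrix.diagonal_transpose _
  have hassoc : qMat N b r t * momentAt N b t * (qMat N b r t).transpose =
      diagD N r t * ((QTildeAt N b t * momentAt N b t * (QTildeAt N b t).transpose) *
        diagD N r t) := by
    rw [qMat, Matrix.transpose_mul, hD]
    simp only [Matrix.mul_assoc]
  ext k l
  rw [hassoc, diagD, Matrix.diagonal_mul, Matrix.mul_diagonal, hQ, qPairing_eq, skewJ,
    Matrix.of_apply]
  split_ifs with h1 h2
  · have h : (l : ℕ) / 2 = (k : ℕ) / 2 := by omega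
    rw [h, map_mul]
    linear_combination hsq ((k : ℕ) / 2) (by omega)
  · have h : (k : ℕ) / 2 = (l : ℕ) / 2 := by omega
    rw [h, map_neg, map_mul]
    linear_combination -hsq ((l : ℕ) / 2) (by omega)
  · rw [map_zero, zero_mul, mul_zero]

theorem coeff_qPoly (N : ℕ) (b : ℕ → ℂ) (r : ℕ → (ℕ+ → ℂ) → ℂ) (t : ℕ+ → ℂ) (k : Fin N) (j : ℕ) :
    (qPoly N b r t k).coeff j = if h : j < N then qMat N b r t k ⟨j, h⟩ else 0 := by
  simp only [qPoly, Polynomial.finsetSum_coeff, Polynomial.coeff_monomial]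
  split_ifs with h
  · rw [Finset.sum_eq_single ⟨j, h⟩]
    · rw [if_pos rfl, qMat_apply]
    · intro i _ hi
      exact if_neg fun e => hi (Fin.ext e)
    · simp
  · exact Finset.sum_eq_zero fun i _ => if_neg (by omega)

/-! ### Families of polynomials and their coefficient matrices -/

/-- The coefficient matrix of a family of polynomials. -/
def coeffMat (p : Fin N → Polynomial ℂ) : Matrix (Fin N) (Fin N) ℂ :=
  Matrix.of fun k j => (p k).coeff j

theorem skewInner_eq (m : Matrix (Fin N) (Fin N) ℂ) (p : Fin N → Polynomial ℂ) (i j : Fin N) :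
    skewInner m (p i) (p j) = (coeffMat p * m * (coeffMat p).transpose) i j := by
  simp only [skewInner, Matrix.mul_apply, Matrix.transpose_apply, coeffMat, Matrix.of_apply,
    Finset.sum_mul]
  exact Finset.sum_comm

theorem coeffMat_qPoly (N : ℕ) (b : ℕ → ℂ) (r : ℕ → (ℕ+ → ℂ) → ℂ) (t : ℕ+ → ℂ) :
    coeffMat (qPoly N b r t) = qMat N b r t := by
  ext k j
  rw [coeffMat, Matrix.of_apply, coeff_qPoly, dif_pos j.2]

theorem qMat_self_ne_zero (ht : t ∈ regularSet N b)
    (hr : ∀ n, 2 * n < N → r n t ^ 2 = eval t (radicand N b n)) (k : Fin N) :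
    qMat N b r t k k ≠ 0 := by
  rw [qMat_apply, QTildeAt_self]
  exact mul_ne_zero (inv_ne_zero (root_ne_zero ht hr (by omega))) (eval_tau_ne_zero ht k)

theorem degree_qPoly (ht : t ∈ regularSet N b)
    (hr : ∀ n, 2 * n < N → r n t ^ 2 = eval t (radicand N b n)) (k : Fin N) :
    (qPoly N b r t k).degree = ((k : ℕ) : WithBot ℕ) := by
  apply le_antisymm
  · rw [Polynomial.degree_le_iff_coeff_zero]
    intro m hm
    rw [Nat.cast_lt] at hm
    rw [coeff_qPoly]
    split_ifs with h
    · exact (isScalarBlockLower_qMat N b r t).lower _ _ hm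
    · rfl
  · apply Polynomial.le_degree_of_ne_zero
    rw [coeff_qPoly, dif_pos k.2]
    exact qMat_self_ne_zero ht hr k

theorem isSkewOrthonormal_qPoly (ht : t ∈ regularSet N b)
    (hr : ∀ n, 2 * n < N → r n t ^ 2 = eval t (radicand N b n)) :
    IsSkewOrthonormal (momentAt N b t) (qPoly N b r t) := by
  refine ⟨degree_qPoly ht hr, fun i j => ?_⟩
  rw [skewInner_eq, coeffMat_qPoly, qMat_mul_momentAt_mul_transpose ht hr]

theorem leadingCoeff_eq_coeffMat {p : Fin N → Polynomial ℂ} {k : Fin N}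
    (hp : (p k).degree = ((k : ℕ) : WithBot ℕ)) : (p k).leadingCoeff = coeffMat p k k := by
  rw [Polynomial.leadingCoeff, Polynomial.natDegree_eq_of_degree_eq_some hp]
  rfl

theorem isNormalized_qPoly (ht : t ∈ regularSet N b)
    (hr : ∀ n, 2 * n < N → r n t ^ 2 = eval t (radicand N b n)) :
    IsNormalized (qPoly N b r t) := by
  intro k l hk hl
  have hQ := isScalarBlockLower_qMat N b r t
  rw [leadingCoeff_eq_coeffMat (degree_qPoly ht hr l),
    leadingCoeff_eq_coeffMat (degree_qPoly ht hr k), coeffMat_qPoly, coeff_qPoly, dif_pos k.2]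
  exact ⟨hQ.sub l k hk hl, (hQ.diag k l hk hl).symm⟩

theorem isScalarBlockLower_coeffMat {p : Fin N → Polynomial ℂ}
    (hp : ∀ k : Fin N, (p k).degree = ((k : ℕ) : WithBot ℕ)) (hn : IsNormalized p) :
    IsScalarBlockLower (coeffMat p) where
  lower i j h := Polynomial.coeff_eq_zero_of_degree_lt (by rw [hp i]; exact_mod_cast h)
  sub i j hj hij := (hn j i hj hij).1
  diag i j hi hij := by
    rw [← leadingCoeff_eq_coeffMat (hp i), ← leadingCoeff_eq_coeffMat (hp j), (hn i j hi hij).2]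

theorem isUnit_det_coeffMat {p : Fin N → Polynomial ℂ}
    (hp : ∀ k : Fin N, (p k).degree = ((k : ℕ) : WithBot ℕ)) (hn : IsNormalized p) :
    IsUnit (coeffMat p).det := by
  rw [Matrix.det_of_isLowerTriangular _ fun i j h => (isScalarBlockLower_coeffMat hp hn).lower i j h]
  refine (Finset.prod_ne_zero_iff.mpr fun i _ => ?_).isUnit
  rw [← leadingCoeff_eq_coeffMat (hp i), Polynomial.leadingCoeff_ne_zero]
  intro h
  have := hp i
  rw [h, Polynomial.degree_zero] at this
  exact WithBot.bot_ne_coe this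

/-- The transition matrix `R` between the two families is triangular with scalar blocks and
satisfies `R J Rᵀ = J`. It is therefore diagonal, with `±1` on the 2×2 blocks; the last 1×1 block
for odd `N` is only nonzero. -/
theorem exists_eq_mul_qPoly (ht : t ∈ regularSet N b)
    (hr : ∀ n, 2 * n < N → r n t ^ 2 = eval t (radicand N b n)) {p : Fin N → Polynomial ℂ}
    (hp : IsSkewOrthonormal (momentAt N b t) p) (hn : IsNormalized p) :
    ∃ ε : ℕ → ℂ, (∀ n, 2 * n < N → ε n ≠ 0) ∧ (∀ n, 2 * n + 1 < N → ε n = 1 ∨ ε n = -1) ∧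
      ∀ k : Fin N, p k = Polynomial.C (ε ((k : ℕ) / 2)) * qPoly N b r t k := by
  have hP := isScalarBlockLower_coeffMat hp.1 hn
  have hPdet := isUnit_det_coeffMat hp.1 hn
  have hQ := isScalarBlockLower_qMat N b r t
  have hQdet := isUnit_det_qMat ht hr
  obtain ⟨R, hR⟩ : ∃ R, R = coeffMat p * (qMat N b r t)⁻¹ := ⟨_, rfl⟩
  have hRP : R * qMat N b r t = coeffMat p := by
    rw [hR, Matrix.nonsing_inv_mul_cancel_right _ _ hQdet]
  have hRlow : IsScalarBlockLower R := hR ▸ hP.mul (hQ.inv hQdet)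
  have hRdet : IsUnit R.det := by
    rw [← hRP, Matrix.det_mul] at hPdet
    exact isUnit_of_mul_isUnit_left hPdet
  have hRJ : R * skewJ N * R.transpose = skewJ N := by
    have h : coeffMat p * momentAt N b t * (coeffMat p).transpose = skewJ N := by
      ext i j
      rw [← skewInner_eq, hp.2]
    rw [← hRP, Matrix.transpose_mul] at h
    rw [← qMat_mul_momentAt_mul_transpose ht hr]
    conv_rhs => rw [qMat_mul_momentAt_mul_transpose ht hr, ← h]
    simp only [Matrix.mul_assoc]
  have hdiag : ∀ i : Fin N, R i i ≠ 0 := fun i =>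
    left_ne_zero_of_mul_eq_one (diag_mul_inv_diag hRdet hRlow.lower i)
  refine ⟨fun n => if h : 2 * n < N then R ⟨2 * n, h⟩ ⟨2 * n, h⟩ else 1, ?_, ?_, ?_⟩
  · intro n h
    simp only [dif_pos h]
    exact hdiag _
  · intro n h
    simp only [dif_pos (show 2 * n < N by omega)]
    exact diag_eq_one_or_neg_one hRlow hRdet hRJ (j := ⟨2 * n + 1, h⟩)
      (by simp only; omega) rfl
  · intro k
    have hk : 2 * ((k : ℕ) / 2) < N := by omega
    have hdk : R ⟨2 * ((k : ℕ) / 2), hk⟩ ⟨2 * ((k : ℕ) / 2), hk⟩ = R k k := by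
      rcases Nat.mod_two_eq_zero_or_one k with h | h
      · have : (⟨2 * ((k : ℕ) / 2), hk⟩ : Fin N) = k := Fin.ext (by simp only; omega)
        rw [this]
      · exact hRlow.diag _ k (by simp only; omega) (by simp only; omega)
    simp only [dif_pos hk, hdk]
    ext j
    rw [Polynomial.coeff_C_mul, coeff_qPoly]
    split_ifs with h
    · have := congrFun (congrFun hRP k) ⟨j, h⟩
      rw [Matrix.mul_apply, Finset.sum_eq_single k] at this
      · exact this.symm
      · intro i _ hi
        rw [eq_zero_of_mul_skewJ_mul_transpose hRlow hRdet hRJ hi.symm, zero_mul]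
      · simp
    · rw [mul_zero]
      refine Polynomial.coeff_eq_zero_of_degree_lt ?_
      rw [hp.1 k, Nat.cast_lt]
      omega

/-! ### The eigenvector equation -/

/-- For `2n = N` the partitions have size `0`, so a single Schur polynomial remains, and it is `1`.
-/
theorem tau_half {N : ℕ} (hN : 0 < N) (b : ℕ → ℂ) (h : N % 2 = 0) :
    tau N b (N / 2) = C (∏ i ∈ Finset.range (N / 2), b i) := by
  obtain ⟨n, rfl⟩ : ∃ n, N = 2 * n := ⟨N / 2, by omega⟩
  have hn : 2 * n / 2 = n := by omega
  have h0 : 2 * n * (2 * n - 2 * n) / 2 = 0 := by simp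
  have hself : selfDual (2 * n) 0 = {0} := by
    ext μ
    rw [mem_selfDual, Finset.mem_singleton]
    constructor
    · rintro ⟨-, hμ, -⟩
      funext i
      exact Finset.sum_eq_zero_iff.mp hμ i (Finset.mem_univ i)
    · rintro rfl
      exact ⟨antitone_const, by simp, by simp⟩
  have hschur : schur (0 : Fin (2 * n) → ℕ) = 1 := by
    rw [schur, Matrix.det_of_isUpperTriangular]
    · refine Finset.prod_eq_one fun i _ => ?_
      simp [elemSchur_zero]
    · intro i j hij
      have hij : (j : ℕ) < i := hij
      rw [Matrix.of_apply]
      exact elemSchur_of_neg (by simp; omega)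
  rw [hn, tau_eq_sum_schur hN b le_rfl, h0, hself, Finset.sum_singleton, hschur,
    MvPolynomial.smul_eq_C_mul, mul_one, ← Finset.prod_range_reflect, Finset.prod_range]
  congr 1
  refine Finset.prod_congr rfl fun i _ => ?_
  congr 1
  simp only [Pi.zero_apply]
  omega

/-- In `L Q = Q Λ`, right multiplication by `Λ` is multiplication by `z` with the power `z^N`
dropped. Only the last polynomial reaches that power, and it loses its leading coefficient `κ`. -/
theorem sum_laxL_mul_qPoly (ht : t ∈ regularSet N b)
    (hr : ∀ n, 2 * n < N → r n t ^ 2 = eval t (radicand N b n)) {κ : ℂ}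
    (hκ : ∀ k : Fin N, (k : ℕ) + 1 = N → κ = qMat N b r t k k) (k : Fin N) :
    ∑ l : Fin N, Polynomial.C (laxL N b r t k l) * qPoly N b r t l =
      Polynomial.X * qPoly N b r t k -
        if (k : ℕ) + 1 = N then Polynomial.monomial N κ else 0 := by
  have hLQ : laxL N b r t * qMat N b r t = qMat N b r t * shiftMat ℂ N := by
    rw [laxL_eq_conj, Matrix.nonsing_inv_mul_cancel_right _ _ (isUnit_det_qMat ht hr)]
  have hlow := (isScalarBlockLower_qMat N b r t).lower
  ext j
  have h1 : (∑ l : Fin N, Polynomial.C (laxL N b r t k l) * qPoly N b r t l).coeff j =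
      if h : j < N then (qMat N b r t * shiftMat ℂ N) k ⟨j, h⟩ else 0 := by
    simp only [Polynomial.finsetSum_coeff, Polynomial.coeff_C_mul, coeff_qPoly]
    split_ifs with h
    · rw [← hLQ, Matrix.mul_apply]
    · simp
  rw [h1, Polynomial.coeff_sub]
  have h2 : (if (k : ℕ) + 1 = N then Polynomial.monomial N κ else 0 : Polynomial ℂ).coeff j =
      if (k : ℕ) + 1 = N ∧ j = N then κ else 0 := by
    by_cases hk : (k : ℕ) + 1 = N
    · rw [if_pos hk, Polynomial.coeff_monomial]
      by_cases hj : j = N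
      · rw [if_pos hj.symm, if_pos ⟨hk, hj⟩]
      · rw [if_neg (Ne.symm hj), if_neg fun h => hj h.2]
    · rw [if_neg hk, if_neg fun h => hk h.1, Polynomial.coeff_zero]
  rw [h2]
  rcases j with - | j
  · rw [Polynomial.coeff_X_mul_zero, if_neg (by omega), sub_zero, dif_pos k.pos]
    exact mul_shiftMat_zero _ _ rfl
  · rw [Polynomial.coeff_X_mul, coeff_qPoly]
    rcases lt_trichotomy (j + 1) N with h | h | h
    · rw [dif_pos h, dif_pos (by omega), if_neg (by omega), sub_zero]
      exact mul_shiftMat_succ _ _ rfl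
    · rw [dif_neg (by omega), dif_pos (show j < N by omega)]
      split_ifs with hk
      · have : (⟨j, by omega⟩ : Fin N) = k := Fin.ext (by simp only; omega)
        rw [this, hκ k hk.1, sub_self]
      · have hj : (k : ℕ) < (⟨j, by omega⟩ : Fin N) := by simp only; omega
        rw [hlow k _ hj, sub_zero]
    · rw [dif_neg (by omega), dif_neg (by omega), if_neg (by omega), sub_zero]

theorem exists_boundary_coeff (hN : 0 < N) (ht : t ∈ regularSet N b)
    (hr : ∀ n, 2 * n < N → r n t ^ 2 = eval t (radicand N b n)) :
    ∃ κ : ℂ,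
      κ ^ 2 = (if N % 2 = 0 then
          eval t (tau N b ((N - 2) / 2)) / ∏ i ∈ Finset.range (N / 2), b i
        else eval t (tau N b ((N - 1) / 2))) ∧
      ∀ k : Fin N,
        ∑ l : Fin N, Polynomial.C (laxL N b r t k l) * qPoly N b r t l =
          Polynomial.X * qPoly N b r t k -
            if (k : ℕ) + 1 = N then Polynomial.monomial N κ else 0 := by
  refine ⟨qMat N b r t ⟨N - 1, by omega⟩ ⟨N - 1, by omega⟩, ?_, sum_laxL_mul_qPoly ht hr ?_⟩
  -- The last diagonal entry is `τ/√ρ`, so `κ² = τ²/ρ`. For even `N`, `ρ = τ_{N-2} τ_N` with `τ_N`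
  -- constant; for odd `N`, `ρ = τ`.
  · rw [qMat_apply, QTildeAt_self, mul_pow, inv_pow, hr _ (by simp only; omega)]
    have h0 : eval t (tau N b ((N - 1) / 2)) ≠ 0 := ht _ (by omega)
    split_ifs with h
    · have e1 : (N - 2) / 2 = (N - 1) / 2 := by omega
      have e2 : (N - 1) / 2 + 1 = N / 2 := by omega
      have h1 := tau_half hN b h
      have h2 : eval t (tau N b (N / 2)) ≠ 0 := ht _ (by omega)
      rw [h1, eval_C] at h2
      rw [radicand, if_pos (by simp only; omega), e1, e2, h1, map_mul, eval_C]
      field_simp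
    · rw [radicand, if_neg (by simp only; omega)]
      field_simp
  · intro k hk
    have : k = ⟨N - 1, by omega⟩ := Fin.ext (by simp only; omega)
    rw [this]

end Pointwise

/-! ### Derivatives with respect to the times -/

theorem hasDerivAt_eval_update (p : ℕ+) (t : ℕ+ → ℂ) (f : TPoly) :
    HasDerivAt (fun s : ℂ => eval (Function.update t p s) f) (eval t (pderiv p f)) (t p) := by
  induction f using MvPolynomial.induction_on with
  | C c => simpa using hasDerivAt_const (t p) c
  | add f g hf hg => simpa using hf.fun_add hg
  | mul_X f q hf =>
    have hX : HasDerivAt (fun s : ℂ => Function.update t p s q)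
        (eval t (pderiv p (X q : TPoly))) (t p) := by
      by_cases h : q = p
      · subst h
        simpa using hasDerivAt_id' (t q)
      · rw [pderiv_X_of_ne h, map_zero]
        simpa [Function.update_of_ne h] using hasDerivAt_const (t p) (t q)
    have := hf.mul hX
    simp only [Function.update_eq_self] at this
    simp only [map_mul, eval_X, pderiv_mul, map_add]
    exact this

/-- The difference quotient of `f` is that of `g` divided by `f x + f a`, so continuity of a square
root already gives its differentiability. -/
theorem HasDerivAt.of_sq {f g : ℂ → ℂ} {g' a : ℂ} (hf : ContinuousAt f a)
    (hg : HasDerivAt g g' a) (hfg : ∀ᶠ x in nhds a, f x ^ 2 = g x) (h0 : f a ≠ 0) :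
    HasDerivAt f (g' / (2 * f a)) a := by
  rw [hasDerivAt_iff_tendsto_slope] at hg ⊢
  have hsum : Filter.Tendsto (fun x => f x + f a) (nhdsWithin a {a}ᶜ) (nhds (2 * f a)) := by
    rw [two_mul]
    exact (hf.tendsto.mono_left nhdsWithin_le_nhds).add_const (f a)
  have h2 : 2 * f a ≠ 0 := mul_ne_zero two_ne_zero h0
  refine (hg.div hsum h2).congr' ?_
  filter_upwards [hsum.eventually_ne h2, nhdsWithin_le_nhds hfg] with x hx hfx
  simp only [Pi.div_apply, slope_def_field]
  rw [div_div, ← hfx, ← hfg.self_of_nhds]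
  rw [mul_comm, sq_sub_sq, mul_div_mul_left _ _ hx]

theorem hasDerivAt_mul_apply {l m n : Type*} [Fintype m] {A : ℂ → Matrix l m ℂ}
    {B : ℂ → Matrix m n ℂ} {A' : Matrix l m ℂ} {B' : Matrix m n ℂ} {a : ℂ}
    (hA : ∀ i j, HasDerivAt (fun s => A s i j) (A' i j) a)
    (hB : ∀ i j, HasDerivAt (fun s => B s i j) (B' i j) a) (i : l) (j : n) :
    HasDerivAt (fun s => (A s * B s) i j) ((A' * B a + A a * B') i j) a := by
  simp only [Matrix.mul_apply, Matrix.add_apply, ← Finset.sum_add_distrib]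
  exact HasDerivAt.fun_sum fun k _ => (hA i k).mul (hB k j)

/-! ### Derivatives of conjugated matrices -/

section LaxDerivative

variable {N : ℕ}

theorem differentiableAt_det {A : ℂ → Matrix (Fin N) (Fin N) ℂ} {a : ℂ}
    (hA : ∀ i j, DifferentiableAt ℂ (fun s => A s i j) a) :
    DifferentiableAt ℂ (fun s => (A s).det) a := by
  simp only [Matrix.det_apply']
  exact DifferentiableAt.fun_sum fun σ _ =>
    (DifferentiableAt.fun_finsetProd fun i _ => hA (σ i) i).const_mul _

theorem differentiableAt_inv_apply {A : ℂ → Matrix (Fin N) (Fin N) ℂ} {a : ℂ}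
    (hA : ∀ i j, DifferentiableAt ℂ (fun s => A s i j) a) (h0 : (A a).det ≠ 0) (i j : Fin N) :
    DifferentiableAt ℂ (fun s => (A s)⁻¹ i j) a := by
  simp only [Matrix.inv_def, Ring.inverse_eq_inv', Matrix.smul_apply, smul_eq_mul,
    Matrix.adjugate_apply]
  refine ((differentiableAt_det hA).inv h0).mul (differentiableAt_det fun k l => ?_)
  by_cases h : k = j
  · subst h
    simp only [Matrix.updateRow_self]
    exact differentiableAt_const _
  · simp only [Matrix.updateRow_ne h]
    exact hA k l

theorem hasDerivAt_conj_apply {A : ℂ → Matrix (Fin N) (Fin N) ℂ} {A' : Matrix (Fin N) (Fin N) ℂ}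
    {a : ℂ} (hA : ∀ i j, HasDerivAt (fun s => A s i j) (A' i j) a)
    (hdet : ∀ᶠ s in nhds a, IsUnit (A s).det) (Z : Matrix (Fin N) (Fin N) ℂ) (i j : Fin N) :
    HasDerivAt (fun s => (A s * Z * (A s)⁻¹) i j)
      ((A' * (A a)⁻¹ * (A a * Z * (A a)⁻¹) - A a * Z * (A a)⁻¹ * (A' * (A a)⁻¹)) i j) a := by
  have hu := hdet.self_of_nhds
  obtain ⟨B', hB'⟩ : ∃ B' : Matrix (Fin N) (Fin N) ℂ,
      ∀ i j, HasDerivAt (fun s => (A s)⁻¹ i j) (B' i j) a :=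
    ⟨Matrix.of fun i j => deriv (fun s => (A s)⁻¹ i j) a, fun i j =>
      (differentiableAt_inv_apply (fun i j => (hA i j).differentiableAt) hu.ne_zero i
        j).hasDerivAt⟩
  -- The inverse is differentiable by Cramer's rule; its derivative is then read off from `A A⁻¹ =
  -- 1`.
  have h1 : A' * (A a)⁻¹ + A a * B' = 0 := by
    ext k l
    refine (hasDerivAt_mul_apply hA hB' k l).unique ?_
    refine (hasDerivAt_const a ((1 : Matrix (Fin N) (Fin N) ℂ) k l)).congr_of_eventuallyEq ?_
    filter_upwards [hdet] with s hs
    rw [Matrix.mul_nonsing_inv _ hs]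
  have h2 : B' = -((A a)⁻¹ * (A' * (A a)⁻¹)) := by
    have h3 : A a * B' = -(A' * (A a)⁻¹) := eq_neg_of_add_eq_zero_right h1
    rw [← Matrix.mul_neg, ← h3, Matrix.nonsing_inv_mul_cancel_left _ _ hu]
  have h4 := hasDerivAt_mul_apply (hasDerivAt_mul_apply (B := fun _ => Z) (B' := 0) hA
    fun k l => hasDerivAt_const a (Z k l)) hB' i j
  convert h4 using 1
  rw [h2]
  have h6 : A' * (A a)⁻¹ * (A a * Z * (A a)⁻¹) = A' * Z * (A a)⁻¹ := by
    simp only [Matrix.mul_assoc]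
    rw [Matrix.nonsing_inv_mul_cancel_left _ _ hu]
  rw [h6, Matrix.mul_zero, add_zero, Matrix.mul_neg, ← sub_eq_add_neg]
  simp only [Matrix.mul_assoc]

end LaxDerivative

/-! ### The Pfaff lattice equations -/

section PfaffLattice

variable {N : ℕ} {b : ℕ → ℂ} {r : ℕ → (ℕ+ → ℂ) → ℂ} {t : ℕ+ → ℂ} {U : Set (ℕ+ → ℂ)}

theorem continuous_update_time (t : ℕ+ → ℂ) (p : ℕ+) :
    Continuous fun s : ℂ => Function.update t p s :=
  continuous_const.update p continuous_id

theorem eventually_update_mem (hU : IsOpen U) (ht : t ∈ U) (p : ℕ+) :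
    ∀ᶠ s in nhds (t p), Function.update t p s ∈ U :=
  (continuous_update_time t p).continuousAt.eventually_mem
    (hU.mem_nhds (by rwa [Function.update_eq_self]))

/-- The logarithmic derivative of `τ_{2n} / √ρ_n` with respect to `t_p`. -/
def logDerivRatio (N : ℕ) (b : ℕ → ℂ) (t : ℕ+ → ℂ) (p : ℕ+) (n : ℕ) : ℂ :=
  eval t (pderiv p (tau N b n)) / eval t (tau N b n) -
    eval t (pderiv p (radicand N b n)) / (2 * eval t (radicand N b n))

/-- The derivative of `D(t) Q̃(t)` with respect to `t_p`. -/
def qMatDeriv (N : ℕ) (b : ℕ → ℂ) (r : ℕ → (ℕ+ → ℂ) → ℂ) (t : ℕ+ → ℂ) (p : ℕ+) :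
    Matrix (Fin N) (Fin N) ℂ :=
  Matrix.of fun k j => (r ((k : ℕ) / 2) t)⁻¹ * (eval t (pderiv p (QTilde N b k j)) -
    eval t (pderiv p (radicand N b ((k : ℕ) / 2))) /
      (2 * eval t (radicand N b ((k : ℕ) / 2))) * eval t (QTilde N b k j))

theorem isScalarBlockLower_qMatDeriv (N : ℕ) (b : ℕ → ℂ) (r : ℕ → (ℕ+ → ℂ) → ℂ) (t : ℕ+ → ℂ)
    (p : ℕ+) : IsScalarBlockLower (qMatDeriv N b r t p) where
  lower i j h := by
    rw [qMatDeriv, Matrix.of_apply, QTilde_of_lt b h]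
    simp
  sub i j hj hij := by
    have h : (j : ℕ) = 2 * (j / 2) := by omega
    have h0 : QTilde N b i j = 0 := by rw [QTilde_apply, hij, h, qCoeff_odd_pred]
    rw [qMatDeriv, Matrix.of_apply, h0]
    simp
  diag i j hi hij := by
    have h : (j : ℕ) / 2 = (i : ℕ) / 2 := by omega
    rw [qMatDeriv, Matrix.of_apply, Matrix.of_apply, QTilde_apply, QTilde_apply, qCoeff_self,
      qCoeff_self, h]

theorem hasDerivAt_root (hU : IsOpen U) (hr : IsRootBranch N b U r) (hreg : U ⊆ regularSet N b)
    (ht : t ∈ U) (p : ℕ+) {n : ℕ} (hn : 2 * n < N) :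
    HasDerivAt (fun s : ℂ => r n (Function.update t p s))
      (eval t (pderiv p (radicand N b n)) / (2 * r n t)) (t p) := by
  have h0 := root_ne_zero (hreg ht) (fun n hn => (hr n hn).2 t ht) hn
  have h := HasDerivAt.of_sq (f := fun s : ℂ => r n (Function.update t p s)) ?_
    (hasDerivAt_eval_update p t (radicand N b n)) ?_ ?_
  · simpa only [Function.update_eq_self] using h
  · have hc : ContinuousAt (r n) (Function.update t p (t p)) := by
      rw [Function.update_eq_self]
      exact (hr n hn).1.continuousAt (hU.mem_nhds ht)
    exact hc.comp (f := fun s : ℂ => Function.update t p s)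
      (continuous_update_time t p).continuousAt
  · filter_upwards [eventually_update_mem hU ht p] with s hs
    exact (hr n hn).2 _ hs
  · simpa only [Function.update_eq_self] using h0

theorem hasDerivAt_qMat (hU : IsOpen U) (hr : IsRootBranch N b U r) (hreg : U ⊆ regularSet N b)
    (ht : t ∈ U) (p : ℕ+) (i j : Fin N) :
    HasDerivAt (fun s : ℂ => qMat N b r (Function.update t p s) i j) (qMatDeriv N b r t p i j)
      (t p) := by
  have hi : 2 * ((i : ℕ) / 2) < N := by omega
  have h0 := root_ne_zero (hreg ht) (fun n hn => (hr n hn).2 t ht) hi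
  have hsq := (hr _ hi).2 t ht
  have h1 := hasDerivAt_root hU hr hreg ht p hi
  have h2 := (h1.inv (by simpa only [Function.update_eq_self] using h0)).mul
    (hasDerivAt_eval_update p t (QTilde N b i j))
  have h3 := h2.congr_of_eventuallyEq (.of_forall fun s =>
    qMat_apply N b r (Function.update t p s) i j)
  refine h3.congr_deriv ?_
  simp only [Function.update_eq_self, Pi.inv_apply, qMatDeriv, Matrix.of_apply]
  rw [← hsq]
  field_simp
  ring

theorem pderiv_moment_eval (N : ℕ) (b : ℕ → ℂ) (t : ℕ+ → ℂ) (p : ℕ+) (i j : Fin N) :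
    eval t (pderiv p (moment N N b i j)) =
      (shiftMat ℂ N ^ (p : ℕ) * momentAt N b t +
        momentAt N b t * (shiftMat ℂ N ^ (p : ℕ)).transpose) i j := by
  have h : ∀ (i : Fin N) (f : Fin N → ℂ), ∑ k, (shiftMat ℂ N ^ (p : ℕ)) i k * f k =
      if h : (i : ℕ) + p < N then f ⟨i + p, h⟩ else 0 := by
    intro i f
    simp only [shiftMat_pow_apply, ite_mul, one_mul, zero_mul]
    split_ifs with h
    · rw [Finset.sum_eq_single ⟨i + p, h⟩]
      · exact if_pos rfl
      · intro k _ hk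
        exact if_neg fun e => hk (Fin.ext e.symm)
      · simp
    · exact Finset.sum_eq_zero fun k _ => if_neg (by omega)
  have hm : ∀ i j : Fin N, momentAt N b t i j = eval t (momentInf N b i j) := fun i j => by
    rw [momentAt, Matrix.map_apply, moment_apply]
  rw [Matrix.add_apply, Matrix.mul_apply, Matrix.mul_apply, h]
  simp only [Matrix.transpose_apply]
  rw [Finset.sum_congr rfl fun k _ => mul_comm _ _, h, moment_apply, pderiv_momentInf, map_add]
  simp only [hm]
  congr 1
  · split_ifs with h
    · rfl
    · rw [momentInf_of_le b (by omega), map_zero]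
  · split_ifs with h
    · rfl
    · rw [momentInf_skew, momentInf_of_le b (by omega), neg_zero, map_zero]

/-! ### Logarithmic derivatives of the diagonal entries -/

theorem sum_range_two_mul_add_one (F : ℕ → ℂ) (M : ℕ) : ∑ k ∈ Finset.range (2 * M + 1), F k =
    ∑ n ∈ Finset.range M, (F (2 * n) + F (2 * n + 1)) + F (2 * M) := by
  induction M with
  | zero => simp
  | succ M ih =>
    have h : 2 * (M + 1) + 1 = 2 * M + 1 + 1 + 1 := by ring
    rw [h, Finset.sum_range_succ, Finset.sum_range_succ, ih, Finset.sum_range_succ]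
    have h2 : 2 * M + 1 + 1 = 2 * (M + 1) := by ring
    rw [h2]
    ring

theorem two_mul_logDerivRatio (ht : t ∈ regularSet N b) (p : ℕ+) {n : ℕ} (hn : 2 * n + 2 ≤ N) :
    2 * logDerivRatio N b t p n = eval t (pderiv p (tau N b n)) / eval t (tau N b n) -
      eval t (pderiv p (tau N b (n + 1))) / eval t (tau N b (n + 1)) := by
  have h1 := ht n (by omega)
  have h2 := ht (n + 1) (by omega)
  rw [logDerivRatio, radicand, if_pos hn, pderiv_mul]
  simp only [map_mul, map_add]
  field_simp
  ring

theorem two_mul_logDerivRatio_last (ht : t ∈ regularSet N b) (p : ℕ+) {n : ℕ}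
    (hn : 2 * n + 1 = N) :
    2 * logDerivRatio N b t p n = eval t (pderiv p (tau N b n)) / eval t (tau N b n) := by
  have h1 := ht n (by omega)
  rw [logDerivRatio, radicand, if_neg (by omega)]
  field_simp
  ring

/-- The 2×2 blocks telescope to minus the logarithmic derivative of `τ_{N-1}`, which is `-2` times
the entry of the last block; that entry itself is added once. -/
theorem sum_logDerivRatio (ht : t ∈ regularSet N b) (p : ℕ+) {M : ℕ} (hM : 2 * M + 1 = N) :
    ∑ k ∈ Finset.range N, logDerivRatio N b t p (k / 2) = -logDerivRatio N b t p M := by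
  have h1 : ∀ n, 2 * n / 2 = n := fun n => by omega
  have h2 : ∀ n, (2 * n + 1) / 2 = n := fun n => by omega
  rw [← hM, sum_range_two_mul_add_one, hM]
  simp only [h1, h2]
  have h3 : ∀ n ∈ Finset.range M, logDerivRatio N b t p n + logDerivRatio N b t p n =
      eval t (pderiv p (tau N b n)) / eval t (tau N b n) -
        eval t (pderiv p (tau N b (n + 1))) / eval t (tau N b (n + 1)) := by
    intro n hn
    rw [← two_mul, two_mul_logDerivRatio ht p (by have := Finset.mem_range.mp hn; omega)]
  rw [Finset.sum_congr rfl h3, Finset.sum_range_sub', ← two_mul_logDerivRatio_last ht p hM,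
    tau_zero]
  simp
  ring

/-- Differentiating `Q m Qᵀ = J` identifies the logarithmic derivative `X` of `Q` as `-(L^p)_𝔨`, and
differentiating `L = Q Λ Q⁻¹` gives `[X, L]`. -/
theorem solvesPfaffAt_laxL (hU : IsOpen U) (hr : IsRootBranch N b U r)
    (hreg : U ⊆ regularSet N b) (ht : t ∈ U) : SolvesPfaffAt (laxL N b r) t := by
  intro p
  have hroot : ∀ t ∈ U, ∀ n, 2 * n < N → r n t ^ 2 = eval t (radicand N b n) :=
    fun t ht n hn => (hr n hn).2 t ht
  have hQ := hasDerivAt_qMat hU hr hreg ht p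
  have hUev := eventually_update_mem hU ht p
  have hdet := isUnit_det_qMat (hreg ht) (hroot t ht)
  have hlow := isScalarBlockLower_qMat N b r t
  have hlow' := isScalarBlockLower_qMatDeriv N b r t p
  obtain ⟨X, hX⟩ : ∃ X, X = qMatDeriv N b r t p * (qMat N b r t)⁻¹ := ⟨_, rfl⟩
  obtain ⟨Z, hZ⟩ : ∃ Z, Z = laxL N b r t ^ (p : ℕ) := ⟨_, rfl⟩
  have hXlow : IsScalarBlockLower X := hX ▸ hlow'.mul (hlow.inv hdet)
  have hXQ : X * qMat N b r t = qMatDeriv N b r t p := by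
    rw [hX, Matrix.nonsing_inv_mul_cancel_right _ _ hdet]
  have hZQ : Z * qMat N b r t = qMat N b r t * shiftMat ℂ N ^ (p : ℕ) := by
    rw [hZ, laxL_eq_conj, conj_pow hdet, Matrix.nonsing_inv_mul_cancel_right _ _ hdet]
  have hJ := qMat_mul_momentAt_mul_transpose (hreg ht) (hroot t ht)
  have hmom : ∀ i j, HasDerivAt (fun s : ℂ => momentAt N b (Function.update t p s) i j)
      ((shiftMat ℂ N ^ (p : ℕ) * momentAt N b t +
        momentAt N b t * (shiftMat ℂ N ^ (p : ℕ)).transpose) i j) (t p) := by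
    intro i j
    rw [← pderiv_moment_eval]
    exact hasDerivAt_eval_update p t _
  have hsum : (X + Z) * skewJ N + skewJ N * (X + Z).transpose = 0 := by
    have h1 := hasDerivAt_mul_apply (hasDerivAt_mul_apply hQ hmom)
      (B := fun s => (qMat N b r (Function.update t p s)).transpose)
      (B' := (qMatDeriv N b r t p).transpose) fun i j => hQ j i
    simp only [Function.update_eq_self] at h1
    have h2 : (qMatDeriv N b r t p * momentAt N b t + qMat N b r t *
        (shiftMat ℂ N ^ (p : ℕ) * momentAt N b t +
          momentAt N b t * (shiftMat ℂ N ^ (p : ℕ)).transpose)) * (qMat N b r t).transpose +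
        qMat N b r t * momentAt N b t * (qMatDeriv N b r t p).transpose = 0 := by
      ext k l
      refine (h1 k l).unique ?_
      refine (hasDerivAt_const (t p) (skewJ N k l)).congr_of_eventuallyEq ?_
      filter_upwards [hUev] with s hs
      rw [qMat_mul_momentAt_mul_transpose (hreg hs) (hroot _ hs)]
    rw [← h2, ← hJ, ← hXQ]
    have h3 := congrArg Matrix.transpose hZQ
    rw [Matrix.transpose_mul, Matrix.transpose_mul] at h3
    simp only [Matrix.add_mul, Matrix.mul_add, Matrix.transpose_add, Matrix.transpose_mul,
      Matrix.mul_assoc]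
    rw [h3]
    have h4 : Z * (qMat N b r t * (momentAt N b t * (qMat N b r t).transpose)) =
        qMat N b r t * (shiftMat ℂ N ^ (p : ℕ) *
          (momentAt N b t * (qMat N b r t).transpose)) := by
      rw [← Matrix.mul_assoc, hZQ, Matrix.mul_assoc]
    rw [h4]
    abel
  have hsym : ∀ i j, ((X + Z) * skewJ N) i j = ((X + Z) * skewJ N) j i := by
    have h : ((X + Z) * skewJ N).transpose = (X + Z) * skewJ N := by
      rw [Matrix.transpose_mul, skewJ_transpose, Matrix.neg_mul]
      exact (eq_neg_of_add_eq_zero_left hsum).symm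
    intro i j
    conv_lhs => rw [← h]
    rfl
  have hXdiag : ∀ k : Fin N, X k k = logDerivRatio N b t p ((k : ℕ) / 2) := by
    intro k
    have h1 := qMat_self_ne_zero (hreg ht) (hroot t ht) k
    apply mul_right_cancel₀ h1
    rw [← mul_apply_diag_of_lower hXlow.lower hlow.lower, hXQ, qMatDeriv, Matrix.of_apply,
      qMat_apply, QTildeAt_self, QTilde_apply, qCoeff_self, logDerivRatio]
    have h2 := eval_tau_ne_zero (hreg ht) k
    field_simp
  have hXZ : X = -projK Z := by
    -- Only odd `N` needs an argument here. The three traces `tr X = -X_{ll}`, `tr Z = 0` and `tr (X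
    -- + Z) = (X + Z)_{ll}` give `X_{ll} = -Z_{ll}/2`.
    refine eq_neg_projK hXlow hsym fun l hl hl' => ?_
    obtain ⟨M, hM⟩ : ∃ M, 2 * M + 1 = N := ⟨l / 2, by omega⟩
    have hlM : (l : ℕ) / 2 = M := by omega
    have htrX : X.trace = -X l l := by
      rw [hXdiag, hlM, ← sum_logDerivRatio (hreg ht) p hM, Finset.sum_range, Matrix.trace]
      exact Finset.sum_congr rfl fun k _ => hXdiag k
    have htrZ : Z.trace = 0 := by
      rw [hZ, laxL_eq_conj, trace_conj_shiftMat_pow hdet]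
    have htrY : (X + Z).trace = (X + Z) l l := by
      have h1 : (X + Z).trace = ∑ k ∈ Finset.range N,
          if h : k < N then (X + Z) ⟨k, h⟩ ⟨k, h⟩ else 0 := by
        rw [Finset.sum_range, Matrix.trace]
        refine Finset.sum_congr rfl fun k _ => ?_
        rw [dif_pos k.2, Matrix.diag_apply]
      have hrange : Finset.range N = Finset.range (2 * M + 1) := by rw [hM]
      rw [h1, hrange, sum_range_two_mul_add_one, Finset.sum_eq_zero, zero_add]
      · have : (⟨2 * M, by omega⟩ : Fin N) = l := Fin.ext (by simp only; omega)
        rw [dif_pos (by omega), this]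
      -- Symmetry of `(X + Z) J` makes the diagonal 2×2 blocks of `X + Z` traceless.
      · intro n hn
        have hn := Finset.mem_range.mp hn
        rw [dif_pos (by omega), dif_pos (by omega)]
        have h2 := hsym ⟨2 * n, by omega⟩ ⟨2 * n + 1, by omega⟩
        have h3 : 2 * n % 2 = 0 := by omega
        rw [mul_skewJ_odd _ _ (j := ⟨2 * n, by omega⟩) h3 rfl,
          mul_skewJ_even _ _ (j' := ⟨2 * n + 1, by omega⟩) h3 rfl] at h2
        rw [h2, neg_add_cancel]
    rw [Matrix.trace_add, htrX, htrZ, Matrix.add_apply] at htrY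
    linear_combination -htrY / 2
  intro k l
  have hconj := hasDerivAt_conj_apply hQ (Filter.Eventually.mono hUev fun s hs =>
    isUnit_det_qMat (hreg hs) (hroot _ hs)) (shiftMat ℂ N) k l
  simp only [Function.update_eq_self] at hconj
  rw [← hX, ← laxL_eq_conj, hXZ, hZ] at hconj
  exact hconj.congr_of_eventuallyEq (.of_forall fun s =>
    congrFun (congrFun (laxL_eq_conj N b r (Function.update t p s)) k) l)

end PfaffLattice

/-! ### Square roots on the generic locus -/

theorem isOpen_regularSet (N : ℕ) (b : ℕ → ℂ) : IsOpen (regularSet N b) := by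
  have h : regularSet N b = ⋂ n ∈ Finset.range (N + 1),
      {t | 2 * n ≤ N → eval t (tau N b n) ≠ 0} := by
    ext t
    simp only [regularSet, Set.mem_ofPred_eq, Set.mem_iInter, Finset.mem_range]
    exact ⟨fun h n _ => h n, fun h n hn => h n (by omega) hn⟩
  rw [h]
  refine isOpen_biInter_finset fun n _ => ?_
  by_cases hn : 2 * n ≤ N
  · simp only [hn, true_imp_iff]
    exact isOpen_ne_fun (continuous_eval _) continuous_const
  · simp only [hn, false_imp_iff, Set.ofPred_true, isOpen_univ]

/-- After division by its value at `t₀` each radicand is near `1`, where the principal square root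
is continuous. Finitely many radicands impose finitely many open conditions. -/
theorem exists_isRootBranch {N : ℕ} {b : ℕ → ℂ} {t₀ : ℕ+ → ℂ} (ht₀ : t₀ ∈ regularSet N b) :
    ∃ U : Set (ℕ+ → ℂ), IsOpen U ∧ t₀ ∈ U ∧ U ⊆ regularSet N b ∧
      ∃ r : ℕ → (ℕ+ → ℂ) → ℂ, IsRootBranch N b U r := by
  have hcont : ∀ n, Continuous fun t => eval t (radicand N b n) / eval t₀ (radicand N b n) :=
    fun n => (continuous_eval _).div_const _
  refine ⟨regularSet N b ∩ ⋂ n ∈ Finset.range N,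
      {t | 2 * n < N → eval t (radicand N b n) / eval t₀ (radicand N b n) ∈ Complex.slitPlane},
    ?_, ⟨ht₀, ?_⟩, Set.inter_subset_left,
    fun n t => eval t₀ (radicand N b n) ^ (1 / 2 : ℂ) *
      (eval t (radicand N b n) / eval t₀ (radicand N b n)) ^ (1 / 2 : ℂ), ?_⟩
  · refine (isOpen_regularSet N b).inter (isOpen_biInter_finset fun n _ => ?_)
    by_cases hn : 2 * n < N
    · simp only [hn, true_imp_iff]
      exact Complex.isOpen_slitPlane.preimage (hcont n)
    · simp only [hn, false_imp_iff, Set.ofPred_true, isOpen_univ]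
  · simp only [Set.mem_iInter, Set.mem_ofPred_eq]
    intro n _ hn
    rw [div_self (eval_radicand_ne_zero ht₀ hn)]
    exact Complex.one_mem_slitPlane
  · intro n hn
    constructor
    · refine continuousOn_const.mul ((hcont n).continuousOn.cpow_const fun t ht => ?_)
      exact Set.mem_iInter₂.mp ht.2 n (Finset.mem_range.mpr (by omega)) hn
    · intro t _
      have hsq : ∀ z : ℂ, (z ^ (1 / 2 : ℂ)) ^ 2 = z := fun z => by
        rw [← Complex.cpow_nat_mul]
        simp
      rw [mul_pow, hsq, hsq, mul_div_cancel₀ _ (eval_radicand_ne_zero ht₀ hn)]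

end FinitePfaff

end

/-! ### The main theorem -/

open FinitePfaff in
theorem theorem1p1 (N : ℕ) (hN : 0 < N) (b : ℕ → ℂ) :
    -- the τ-functions as sums of Schur polynomials over self-dual partitions
    tau N b 0 = 1 ∧
    (∀ n : ℕ, 2 * n ≤ N →
      tau N b n =
          ∑ μ ∈ selfDual (2 * n) (2 * n * (N - 2 * n) / 2),
            (∏ i : Fin n,
              b (μ ⟨i, by omega⟩ + 2 * n - ((i : ℕ) + 1) - (N + 1) / 2)) • schur μ ∧
        tau N b n ∈ schurSpan (2 * n) (2 * n * (N - 2 * n) / 2)) ∧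
    -- the `q̃_k` are polynomials of degree at most `k` in `z`, so that `Q̃` is lower triangular
    (∀ k : Fin N, qTilde N b k =
      ∑ j : Fin N, LaurentPolynomial.C (QTilde N b k j) * LaurentPolynomial.T ((j : ℕ) : ℤ)) ∧
    (∀ k j : Fin N, k < j → QTilde N b k j = 0) ∧
    -- the generic locus, the square roots on it, and the rationality of `Q̃ Λ Q̃⁻¹`
    ((∀ i, i < N / 2 → b i ≠ 0) → (regularSet N b).Nonempty) ∧
    (∀ t₀ ∈ regularSet N b, ∃ U : Set (ℕ+ → ℂ), IsOpen U ∧ t₀ ∈ U ∧ U ⊆ regularSet N b ∧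
      ∃ r : ℕ → (ℕ+ → ℂ) → ℂ, IsRootBranch N b U r) ∧
    (∀ t ∈ regularSet N b, (QTildeAt N b t).det ≠ 0) ∧
    (∃ (P : Matrix (Fin N) (Fin N) TPoly) (d : TPoly), ∀ t ∈ regularSet N b,
      MvPolynomial.eval t d ≠ 0 ∧
      LTilde N b t = (MvPolynomial.eval t d)⁻¹ • P.map (MvPolynomial.eval t)) ∧
    -- for every choice of the square roots:
    (∀ (U : Set (ℕ+ → ℂ)) (r : ℕ → (ℕ+ → ℂ) → ℂ), IsOpen U → U ⊆ regularSet N b →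
      IsRootBranch N b U r → ∀ t ∈ U,
        -- `L = D Q̃ Λ Q̃⁻¹ D⁻¹` is a solution of the Pfaff lattice
        (diagD N r t).det ≠ 0 ∧
        (diagD N r t)⁻¹ * laxL N b r t * diagD N r t = LTilde N b t ∧
        IsPfaffForm (laxL N b r t) ∧
        SolvesPfaffAt (laxL N b r) t ∧
        -- the `q_k` are skew-orthonormal
        IsSkewOrthonormal (momentAt N b t) (qPoly N b r t) ∧
        IsNormalized (qPoly N b r t) ∧
        -- they form an eigenvector of `L`, up to a boundary term
        (∃ κ : ℂ,
          κ ^ 2 = (if N % 2 = 0 then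
              MvPolynomial.eval t (tau N b ((N - 2) / 2)) / ∏ i ∈ Finset.range (N / 2), b i
            else MvPolynomial.eval t (tau N b ((N - 1) / 2))) ∧
          ∀ k : Fin N,
            ∑ l : Fin N, Polynomial.C (laxL N b r t k l) * qPoly N b r t l =
              Polynomial.X * qPoly N b r t k -
                if (k : ℕ) + 1 = N then Polynomial.monomial N κ else 0) ∧
        -- they are unique up to sign (for odd `N`, the last one up to a nonzero factor)
        (∀ p : Fin N → Polynomial ℂ,
          IsSkewOrthonormal (momentAt N b t) p → IsNormalized p →
          ∃ ε : ℕ → ℂ, (∀ n, 2 * n < N → ε n ≠ 0) ∧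
            (∀ n, 2 * n + 1 < N → ε n = 1 ∨ ε n = -1) ∧
            ∀ k : Fin N, p k = Polynomial.C (ε ((k : ℕ) / 2)) * qPoly N b r t k)) := by
  refine ⟨tau_zero N b, fun n hn => ⟨tau_eq_sum_schur hN b hn, tau_mem_schurSpan hN b hn⟩,
    qTilde_eq_sum_fin b, fun k j h => QTilde_of_lt b h, regularSet_nonempty hN,
    fun t₀ ht₀ => exists_isRootBranch ht₀, fun t ht => det_QTildeAt_ne_zero ht,
    -- The numerator is `Q̃ Λ adj(Q̃)` and the denominator `det Q̃`.
    ⟨_, _, fun t ht => ⟨eval_det_QTilde_ne_zero ht, LTilde_eq_smul N b t⟩⟩, ?_⟩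
  intro U r hU hreg hr t ht
  have hroot : ∀ n, 2 * n < N → r n t ^ 2 = MvPolynomial.eval t (radicand N b n) :=
    fun n hn => (hr n hn).2 t ht
  have htr := hreg ht
  refine ⟨det_diagD_ne_zero htr hroot, diagD_inv_mul_laxL_mul_diagD htr hroot, ?_,
    solvesPfaffAt_laxL hU hr hreg ht, isSkewOrthonormal_qPoly htr hroot,
    isNormalized_qPoly htr hroot, exists_boundary_coeff hN htr hroot,
    fun p hp hn => exists_eq_mul_qPoly htr hroot hp hn⟩
  rw [laxL_eq_conj]
  exact isPfaffForm_conj (isScalarBlockLower_qMat N b r t) (isUnit_det_qMat htr hroot)
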